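/- **Setting.** Let $\mathcal H$ be a complex Hilbert space and $s\mapsto H(s)$, $s\in[0,1]$, a smooth family of bounded self-adjoint operators ($s=t/T$ is the rescaled time, $T$ the annealing time). Let $U\subset\mathbb R^n$ be open and $x\mapsto\psi_x\in\mathcal H$, $x\in U$, a smooth family of unit vectors whose symplectic form $\boldsymbol\omega_{\mu\nu}(x)=2\,\mathrm{Im}\langle\partial_\mu\psi_x|\partial_\nu\psi_x\rangle$ is nondegenerate at every $x\in U$; the variational manifold is $\mathcal M=\{\psi_x : x\in U\}$. Let $P_x$ be the projector of the Lagrangian action principle onto the tangent space at $\psi_x$: in the coordinates of the basis $\partial_\mu\psi_x$, $(P_xw)^\mu=\sum_\nu(\boldsymbol\omega(x)^{-1})^{\mu\nu}\,2\,\mathrm{Im}\langle\partial_\nu\psi_x|w\rangle$, i.e. $\mathrm{Im}\langle u|w-P_xw\rangle=0$ for all tangent vectors $u$. Put $\mathcal X(s,x)=P_x(-\mathrm iH(s)\psi_x)$. Let $x_0:[0,1]\to U$ be smooth such that $x_0(s)$ minimizes $x\mapsto\langle\psi_x|H(s)|\psi_x\rangle$ over $U$ for every $s$ (instantaneous variational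 ground state), and such that $\psi_{x_0(0)}$ is a ground state of $H(0)$ in all of $\mathcal H$. Let $K^\mu{}_\nu(s)=\partial_{x^\nu}\mathcal X^\mu(s,x)|_{x=x_0(s)}$ be the linearized symplectic generator. **Adiabatic conditions.** There are given, smoothly in $s\in[0,1]$, a positive definite matrix $\eta(s)$ with $(\mathrm iK)^\dagger\eta=\eta(\mathrm iK)$ and eigenvectors $|\omega_j(s)\rangle\in\mathbb C^n$, $1\le j\le n$, with $\mathrm iK(s)|\omega_j(s)\rangle=\omega_j(s)|\omega_j(s)\rangle$, $\omega_j(s)\in\mathbb R$, and $\langle\omega_i|\eta|\omega_j\rangle=\delta_{ij}$. For every $s$ the frequencies $\omega_1(s),\dots,\omega_n(s)$ are pairwise distinct and nonzero. Write $|\tilde\omega_j\rangle=\eta|\omega_j\rangle$, $\|y\|_{\eta}=\sqrt{\langle y|\eta|y\rangle}$, $$\Gamma_j(s)=\frac{\mathrm i}{2}\int_0^s\bigl(\langle\tilde\omega_j|\dot\omega_j\rangle-\langle\dot{\tilde\omega}_j|\omega_j\rangle\bigr)\,\mathrm du,\qquad \kappa=\frac{2\max_{s,s',j}\bigl|\mathrm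 e^{-\mathrm i(\Gamma_j(s)-\Gamma_j(s'))}\bigr|\;\max_s\|\dot x_0(s)\|_{\eta(s)}}{\min_{s,j}|\omega_j(s)|}$$ (all maxima and minima over $s,s'\in[0,1]$ and $1\le j\le n$). **Theorem.** There are constants $C$ and $T_0>0$, independent of $T$ and $s$, such that for all $T\ge T_0$ and all $s\in[0,1]$ the following hold. 1. If $x:[0,1]\to U$ solves $\frac1T\frac{\mathrm d x}{\mathrm ds}=\mathcal X(s,x(s))$ with $x(0)=x_0(0)$, then $$\|\psi_{x(s)}-\psi_{x_0(s)}\|\le\frac CT\qquad\text{and}\qquad\|x(s)-x_0(s)\|_{\eta(s)}\le C\,\frac{\kappa}{T}.$$ 2. If $\xi:[0,1]\to\mathbb R^n$ solves the linearized equation $\dot\xi=TK(s)\xi-\dot x_0(s)$ with $\xi(0)=0$, then $$\|\xi(s)\|_{\eta(s)}\le\frac{\kappa}{T}+\frac{C}{T^2}.$$ 3. If, moreover, the matrix $\boldsymbol\omega(x)$ does not depend on $x\in U$ (Darboux coordinates) and $\omega_i(s)\neq\omega_j(s)+\omega_k(s)$ for all $i,j,k$ and all $s$, then the solutions $x$ in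 part 1 satisfy $$\|x(s)-x_0(s)\|_{\eta(s)}\le\frac{\kappa}{T}+\frac{C}{T^2}.$$ -/

import Mathlib

open scoped ContDiff Matrix

noncomputable section

namespace VarAdiabatic

section Family

variable {𝓗 : Type*} [NormedAddCommGroup 𝓗] [InnerProductSpace ℂ 𝓗] {n : ℕ}

/-- The tangent vector `∂_μ ψ` of the parametrized family of states `ψ` at the parameter `x`. -/
def tangentVec (ψ : (Fin n → ℝ) → 𝓗) (x : Fin n → ℝ) (μ : Fin n) : 𝓗 :=
  fderiv ℝ ψ x (Pi.single μ 1)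

/-- The symplectic form `ω_{μν} = 2 Im ⟨∂_μ ψ | ∂_ν ψ⟩` of the variational family. -/
def symplecticMatrix (ψ : (Fin n → ℝ) → 𝓗) (x : Fin n → ℝ) : Matrix (Fin n) (Fin n) ℝ :=
  Matrix.of fun μ ν => 2 * (inner ℂ (tangentVec ψ x μ) (tangentVec ψ x ν)).im

/-- Coordinates, in the basis `∂_μ ψ`, of the projection `P_x w` of a Hilbert space vector `w` onto
the tangent space at `ψ x` that belongs to the Lagrangian action principle:
`(P_x w)^μ = ∑_ν Ω^{μν} 2 Im ⟨∂_ν ψ | w⟩`, where `Ω` is the inverse of the symplectic form. It is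
characterized by `Im ⟨u | w - P_x w⟩ = 0` for all tangent vectors `u` (see `tangentProj_spec`), and
it is the orthogonal projection if the tangent space is a complex subspace (Kähler case). -/
def tangentProj (ψ : (Fin n → ℝ) → 𝓗) (x : Fin n → ℝ) (w : 𝓗) : Fin n → ℝ :=
  (symplecticMatrix ψ x)⁻¹ *ᵥ fun ν => 2 * (inner ℂ (tangentVec ψ x ν) w).im

theorem tangentProj_spec (ψ : (Fin n → ℝ) → 𝓗) (x : Fin n → ℝ)
    (h : IsUnit (symplecticMatrix ψ x).det) (w : 𝓗) (μ : Fin n) :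
    (inner ℂ (tangentVec ψ x μ)
      (w - ∑ ν, ((tangentProj ψ x w ν : ℝ) : ℂ) • tangentVec ψ x ν)).im = 0 := by
  have key : (symplecticMatrix ψ x *ᵥ tangentProj ψ x w) μ
      = 2 * (inner ℂ (tangentVec ψ x μ) w).im := by
    simp [tangentProj, Matrix.mulVec_mulVec, Matrix.mul_nonsing_inv _ h]
  simp only [Matrix.mulVec, dotProduct, symplecticMatrix, Matrix.of_apply] at key
  rw [inner_sub_right, inner_sum, Complex.sub_im, Complex.im_sum]
  simp only [inner_smul_right, Complex.im_ofReal_mul]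
  have : ∑ ν, 2 * (inner ℂ (tangentVec ψ x μ) (tangentVec ψ x ν)).im * tangentProj ψ x w ν
      = 2 * ∑ ν, tangentProj ψ x w ν *
        (inner ℂ (tangentVec ψ x μ) (tangentVec ψ x ν)).im := by
    rw [Finset.mul_sum]
    exact Finset.sum_congr rfl fun ν _ => by ring
  linarith

/-- The vector field `𝒳(s, x) = P_x(-i H(s) ψ(x))` of the variational principle. -/
def varField (ψ : (Fin n → ℝ) → 𝓗) (H : ℝ → 𝓗 →L[ℂ] 𝓗) (s : ℝ) (x : Fin n → ℝ) : Fin n → ℝ :=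
  tangentProj ψ x (-(Complex.I • H s (ψ x)))

/-- The variational energy `⟨ψ(x) | H(s) | ψ(x)⟩`. -/
def energy (ψ : (Fin n → ℝ) → 𝓗) (H : ℝ → 𝓗 →L[ℂ] 𝓗) (s : ℝ) (x : Fin n → ℝ) : ℝ :=
  (inner ℂ (ψ x) (H s (ψ x))).re

/-- The linearized symplectic generator `K^μ_ν(s) = ∂_ν 𝒳^μ` at `x = x₀(s)`. -/
def generator (ψ : (Fin n → ℝ) → 𝓗) (H : ℝ → 𝓗 →L[ℂ] 𝓗) (x₀ : ℝ → Fin n → ℝ) (s : ℝ) :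
    Matrix (Fin n) (Fin n) ℝ :=
  Matrix.of fun μ ν => fderiv ℝ (fun x => varField ψ H s x) (x₀ s) (Pi.single ν 1) μ

/-- A smooth family of unit vectors over an open set `U` of parameters, with nondegenerate
symplectic form (so that, in particular, `ψ` is an immersion). -/
structure IsVariationalFamily (U : Set (Fin n → ℝ)) (ψ : (Fin n → ℝ) → 𝓗) : Prop where
  isOpen : IsOpen U
  smooth : ContDiffOn ℝ ∞ ψ U
  norm_one : ∀ x ∈ U, ‖ψ x‖ = 1
  nondegenerate : ∀ x ∈ U, IsUnit (symplecticMatrix ψ x).det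

/-- A smooth annealing protocol `s ↦ H(s)`, `s ∈ [0,1]`, of bounded self-adjoint Hamiltonians. -/
structure IsProtocol [CompleteSpace 𝓗] (H : ℝ → 𝓗 →L[ℂ] 𝓗) : Prop where
  smooth : ContDiffOn ℝ ∞ H (Set.Icc 0 1)
  selfAdjoint : ∀ s ∈ Set.Icc (0 : ℝ) 1, IsSelfAdjoint (H s)

/-- `x₀(s)` parametrizes the instantaneous variational ground state, smoothly in `s`, and at
`s = 0` this state is a ground state of `H(0)` in the whole Hilbert space. -/
structure IsVariationalGroundState (U : Set (Fin n → ℝ)) (ψ : (Fin n → ℝ) → 𝓗)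
    (H : ℝ → 𝓗 →L[ℂ] 𝓗) (x₀ : ℝ → Fin n → ℝ) : Prop where
  smooth : ContDiffOn ℝ ∞ x₀ (Set.Icc 0 1)
  mem : ∀ s ∈ Set.Icc (0 : ℝ) 1, x₀ s ∈ U
  minimal : ∀ s ∈ Set.Icc (0 : ℝ) 1, ∀ y ∈ U, energy ψ H s (x₀ s) ≤ energy ψ H s y
  initial : ∀ φ : 𝓗, ‖φ‖ = 1 → energy ψ H 0 (x₀ 0) ≤ (inner ℂ φ (H 0 φ)).re

/-- `x` solves `(1/T) dx/ds = 𝒳(s, x)` on `[0,1]`, starting from the initial ground state. -/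
structure IsVariationalEvolution (U : Set (Fin n → ℝ)) (ψ : (Fin n → ℝ) → 𝓗)
    (H : ℝ → 𝓗 →L[ℂ] 𝓗) (x₀ : ℝ → Fin n → ℝ) (T : ℝ) (x : ℝ → Fin n → ℝ) : Prop where
  initial : x 0 = x₀ 0
  mem : ∀ s ∈ Set.Icc (0 : ℝ) 1, x s ∈ U
  ode : ∀ s ∈ Set.Icc (0 : ℝ) 1,
    HasDerivWithinAt x (T • varField ψ H s (x s)) (Set.Icc 0 1) s

end Family

section Spectral

open scoped ComplexOrder

variable {n : ℕ}

/-- The norm `‖y‖_η = √⟨y | η | y⟩` of the pseudo-inner product. -/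
def etaNorm (η : Matrix (Fin n) (Fin n) ℂ) (y : Fin n → ℂ) : ℝ :=
  √(star y ⬝ᵥ (η *ᵥ y)).re

/-- A real parameter vector as a complex vector. -/
def toComplex (y : Fin n → ℝ) : Fin n → ℂ := fun μ => (y μ : ℂ)

/-- The non-Hermitian Hamiltonian `i K`. -/
def iK (K : Matrix (Fin n) (Fin n) ℝ) : Matrix (Fin n) (Fin n) ℂ :=
  Complex.I • K.map (fun a : ℝ => (a : ℂ))

/-- The adiabatic conditions for the `η`-pseudo-Hermitian evolution generated by `i K(s)`:
`η(s)` is a smooth positive definite metric operator, `i K(s)` is `η(s)`-pseudo-Hermitian with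
frequencies `w_j(s)` and a smooth frame of right eigenvectors `v_j(s)`, which is biorthonormal
to the left eigenvectors `η(s) v_j(s)`; the frequencies are pairwise distinct at every `s`
(finiteness of the adiabatic ratios) and none of them vanishes. -/
structure IsAdiabatic (K : ℝ → Matrix (Fin n) (Fin n) ℝ) (η : ℝ → Matrix (Fin n) (Fin n) ℂ)
    (w : Fin n → ℝ → ℝ) (v : Fin n → ℝ → Fin n → ℂ) : Prop where
  smooth_metric : ∀ i j, ContDiffOn ℝ ∞ (fun s => η s i j) (Set.Icc 0 1)
  smooth_frame : ∀ j, ContDiffOn ℝ ∞ (v j) (Set.Icc 0 1)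
  posDef : ∀ s ∈ Set.Icc (0 : ℝ) 1, (η s).PosDef
  pseudoHermitian : ∀ s ∈ Set.Icc (0 : ℝ) 1, (iK (K s))ᴴ * η s = η s * iK (K s)
  eigen : ∀ s ∈ Set.Icc (0 : ℝ) 1, ∀ j, iK (K s) *ᵥ v j s = (w j s : ℂ) • v j s
  biorthonormal : ∀ s ∈ Set.Icc (0 : ℝ) 1, ∀ i j,
    star (v i s) ⬝ᵥ (η s *ᵥ v j s) = if i = j then 1 else 0
  gap : ∀ s ∈ Set.Icc (0 : ℝ) 1, ∀ i j, i ≠ j → w i s ≠ w j s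
  nonvanishing : ∀ s ∈ Set.Icc (0 : ℝ) 1, ∀ j, w j s ≠ 0

/-- The left eigenvector `η(s) v_j(s)`. -/
def leftVec (η : ℝ → Matrix (Fin n) (Fin n) ℂ) (v : Fin n → ℝ → Fin n → ℂ) (j : Fin n) (s : ℝ) :
    Fin n → ℂ :=
  η s *ᵥ v j s

/-- The generalized geometric phase
`Γ_j(s) = (i/2) ∫_0^s (⟨ṽ_j | dv_j/du⟩ - ⟨dṽ_j/du | v_j⟩) du`, with `ṽ_j` the left eigenvector. -/
def geometricPhase (η : ℝ → Matrix (Fin n) (Fin n) ℂ) (v : Fin n → ℝ → Fin n → ℂ) (j : Fin n)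
    (s : ℝ) : ℂ :=
  Complex.I / 2 * ∫ u in (0 : ℝ)..s,
    (star (leftVec η v j u) ⬝ᵥ derivWithin (v j) (Set.Icc 0 1) u
      - star (derivWithin (leftVec η v j) (Set.Icc 0 1) u) ⬝ᵥ v j u)

/-- The velocity `dx₀/ds` on `[0,1]`. -/
def velocity (x₀ : ℝ → Fin n → ℝ) (s : ℝ) : Fin n → ℝ := derivWithin x₀ (Set.Icc 0 1) s

/-- The constant
`κ = 2 max_{s,s',j} |exp(-i(Γ_j(s) - Γ_j(s')))| · max_s ‖dx₀/ds‖_{η(s)} / min_{s,j} |w_j(s)|`. -/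
def kappa (η : ℝ → Matrix (Fin n) (Fin n) ℂ) (w : Fin n → ℝ → ℝ) (v : Fin n → ℝ → Fin n → ℂ)
    (x₀ : ℝ → Fin n → ℝ) : ℝ :=
  2 * (⨆ p : Set.Icc (0 : ℝ) 1 × Set.Icc (0 : ℝ) 1 × Fin n,
        ‖Complex.exp (-Complex.I *
          (geometricPhase η v p.2.2 p.1 - geometricPhase η v p.2.2 p.2.1))‖)
    * (⨆ s : Set.Icc (0 : ℝ) 1, etaNorm (η s) (toComplex (velocity x₀ s)))
    / (⨅ p : Set.Icc (0 : ℝ) 1 × Fin n, |w p.2 p.1|)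

/-- `ξ` solves the linearized equation of the deviation,
`dξ/ds = T K(s) ξ - dx₀/ds` on `[0,1]`, `ξ(0) = 0`. -/
structure IsLinearizedDeviation (K : ℝ → Matrix (Fin n) (Fin n) ℝ) (x₀ : ℝ → Fin n → ℝ) (T : ℝ)
    (ξ : ℝ → Fin n → ℝ) : Prop where
  initial : ξ 0 = 0
  ode : ∀ s ∈ Set.Icc (0 : ℝ) 1,
    HasDerivWithinAt ξ (T • (K s *ᵥ ξ s) - velocity x₀ s) (Set.Icc 0 1) s

end Spectral

end VarAdiabatic

end

set_option maxSynthPendingDepth 3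

/-! ### Compactness, continuation and Grönwall. -/

namespace VarAdiabatic

/-! Write `y = x - x₀`, `X` for the variational vector field and `ω` for the symplectic form at
`x₀`. Two independent mechanisms are at work.

(a) A Lyapunov function gives `y = O(1/T)`. The field is Hamiltonian: `dE(u) = -u·ωX`
(`fderiv_opEnergy`). Hence the flow itself conserves the energy, and the excess energy over the
ground state changes only through `dH/ds`. At `x₀` the Hessian of the energy is `-ωK`. It is
semidefinite by minimality and nondegenerate because no frequency vanishes, so the excess energy
controls `‖y‖²` uniformly in `s` (`exists_energy_coercive`). Its rate of change has a part linear in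
`y`, which alone would only give `O(1)`. Differentiating `X(s, x₀(s)) = 0` and using the symmetry of
`ωK`, this part equals `-(Ky)·ω(dx₀/ds)` (`excess_rate_eq`), and `Ky` is `(1/T) dx/ds` up to
quadratic terms. It is therefore a total derivative over `T`, which the corrector `y·ω(dx₀/ds)/T`
removes. Grönwall and a continuation argument finish (`exists_deviation_bound`). The resulting
constant is zero for a motionless ground state, and this allows the bound to be stated as a multiple
of `κ`.

(b) Averaging gives the leading constant `κ`. In the eigenframe the amplitudes obey `c_i' = -iT w_i
c_i - b_i + B_i·c + T c·Q_i c + O(1/T²)`, where `b` is the velocity of the ground state. Subtracting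
the quasi-equilibrium `p/T`, `p_i = i b_i / w_i`, leaves `e = c - p/T`, which rotates fast. A
near-identity change of variables, with denominators `w_i`, `w_i - w_k` and `w_i - w_j - w_k`,
removes every remaining term except the diagonal coupling `m_ii`, up to `O(1/T²)`. Since `e(0) =
-p(0)/T`, it follows that `c_i = (p_i(s) - u p_i(0))/T + O(1/T²)` with `|u| = exp ∫ Re m_ii`
(`exists_normal_form_bound`).

The `η`-norm is Euclidean in the eigenframe, `‖p‖` is at most speed over frequency, and `|u|` is a
geometric factor `G ≥ 1` as soon as `Re m_ii` is the real part of the frame coupling. Then `1 + G ≤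
2G` gives `κ` (`IsAdiabatic.etaNorm_le_kappa`). For the linearized equation `m_ii` is the frame
coupling itself. For the exact one `m_ii` also contains the diagonal element of the generator's
first-order change at the shifted equilibrium. In Darboux coordinates this change is infinitesimally
symplectic, so the element is imaginary (`IsAdiabatic.re_frameCoord_symplectic`). -/

theorem exists_pos_le_of_isCompact {α : Type*} [TopologicalSpace α] {K : Set α} (hK : IsCompact K)
    {f : α → ℝ} (hf : ContinuousOn f K) (hpos : ∀ x ∈ K, 0 < f x) :
    ∃ c > 0, ∀ x ∈ K, c ≤ f x := by
  rcases K.eq_empty_or_nonempty with rfl | hne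
  · exact ⟨1, one_pos, by simp⟩
  · obtain ⟨x, hx, hmin⟩ := hK.exists_isMinOn hne hf
    exact ⟨f x, hpos x hx, fun y hy => hmin hy⟩

/-- A continuity argument: a bound that improves itself on every initial interval holds. -/
theorem lt_of_self_improving {f : ℝ → ℝ} {r : ℝ} (hf : ContinuousOn f (Set.Icc 0 1))
    (h0 : f 0 < r)
    (himp : ∀ t ∈ Set.Icc (0 : ℝ) 1, (∀ u ∈ Set.Icc 0 t, f u ≤ r) → f t < r) :
    ∀ t ∈ Set.Icc (0 : ℝ) 1, f t < r := by
  by_contra! hcon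
  obtain ⟨t₁, ht₁, hft₁⟩ := hcon
  have hclosed : IsClosed (Set.Icc (0 : ℝ) 1 ∩ f ⁻¹' Set.Ici r) :=
    hf.preimage_isClosed_of_isClosed isClosed_Icc isClosed_Ici
  have hcomp : IsCompact (Set.Icc (0 : ℝ) 1 ∩ f ⁻¹' Set.Ici r) :=
    isCompact_Icc.of_isClosed_subset hclosed Set.inter_subset_left
  -- At the first time where `r` is reached the value is exactly `r`, and the bound holds up to that
  -- time, so the improvement gives a strict inequality there.
  obtain ⟨t, ⟨ht, hft⟩, hleast⟩ := hcomp.exists_isLeast ⟨t₁, ht₁, hft₁⟩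
  have hft' : r ≤ f t := hft
  obtain ⟨u, hu, hfu⟩ := intermediate_value_Icc ht.1
    (hf.mono (Set.Icc_subset_Icc_right ht.2)) ⟨h0.le, hft'⟩
  have hut : u = t := le_antisymm hu.2
    (hleast ⟨⟨hu.1, hu.2.trans ht.2⟩, by simp [hfu]⟩)
  subst hut
  refine absurd hfu (himp u ht fun z hz => ?_).ne
  by_contra! hz'
  have : z = u := le_antisymm hz.2 (hleast ⟨⟨hz.1, hz.2.trans ht.2⟩, hz'.le⟩)
  subst this
  exact hz'.ne' hfu

/-- With `1 ≤ K` the singular case `K = 0` of `gronwallBound` is avoided and `ε / K` becomes `ε`.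
Callers add 1 to their rate for this reason. -/
theorem gronwallBound_le {δ K ε s : ℝ} (hδ : 0 ≤ δ) (hε : 0 ≤ ε) (hK : 1 ≤ K)
    (hs1 : s ≤ 1) : gronwallBound δ K ε (s - 0) ≤ (δ + ε) * Real.exp K := by
  rw [gronwallBound_of_K_ne_0 (by positivity)]
  have h1 : Real.exp (K * (s - 0)) ≤ Real.exp K := by
    apply Real.exp_le_exp.2
    nlinarith
  have h2 : ε / K ≤ ε := div_le_self hε hK
  have h3 : 0 ≤ ε / K := by positivity
  have h4 := Real.exp_pos (K * (s - 0))
  have h5 : δ * Real.exp (K * (s - 0)) ≤ δ * Real.exp K := by gcongr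
  have h6 : ε / K * (Real.exp (K * (s - 0)) - 1) ≤ ε * Real.exp K := by
    calc _ ≤ ε / K * Real.exp (K * (s - 0)) := by gcongr; linarith
      _ ≤ _ := by gcongr
  simp only
  linarith

/-- Grönwall's inequality on a subinterval of `[0,1]`. -/
theorem le_exp_of_deriv_le {f f' : ℝ → ℝ} {δ K ε t : ℝ} (ht1 : t ≤ 1)
    (hf : ∀ s ∈ Set.Icc 0 t, HasDerivWithinAt f (f' s) (Set.Icc 0 t) s) (h0 : f 0 ≤ δ)
    (hδ : 0 ≤ δ) (hε : 0 ≤ ε) (hK : 1 ≤ K)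
    (hbound : ∀ s ∈ Set.Icc 0 t, f' s ≤ K * f s + ε) :
    ∀ s ∈ Set.Icc 0 t, f s ≤ (δ + ε) * Real.exp K := by
  intro s hs
  have h := le_gronwallBound_of_liminf_deriv_right_le (f := f) (f' := f') (δ := δ) (K := K)
    (ε := ε) (a := 0) (b := t) (fun s hs => (hf s hs).continuousWithinAt)
    (fun x hx r hr => ((hf x ⟨hx.1, hx.2.le⟩).mono_of_mem_nhdsWithin
      (Icc_mem_nhdsGE_of_mem hx)).liminf_right_slope_le hr) h0
    (fun x hx => hbound x ⟨hx.1, hx.2.le⟩) s hs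
  exact h.trans (gronwallBound_le hδ hε hK (hs.2.trans ht1))

/-! ### Taylor estimates, uniform in a tube around a curve. -/

section Taylor

variable {V E F : Type*} [NormedAddCommGroup V] [NormedSpace ℝ V]
  [NormedAddCommGroup E] [NormedSpace ℝ E] [NormedAddCommGroup F] [NormedSpace ℝ F]

/-- The partial derivative of a jointly smooth function is jointly smooth. -/
theorem contDiffOn_fderiv_param {U : Set E} (hU : IsOpen U) {f : V → E → F}
    (hf : ContDiffOn ℝ ∞ (fun p : V × E => f p.1 p.2) (Set.univ ×ˢ U)) :
    ContDiffOn ℝ ∞ (fun p : V × E => fderiv ℝ (f p.1) p.2) (Set.univ ×ˢ U) := by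
  intro p hp
  have hnhds : (Set.univ ×ˢ U : Set (V × E)) ∈ nhds p := (isOpen_univ.prod hU).mem_nhds hp
  have h1 : ContDiffAt ℝ ∞ (fun p : V × E => f p.1 p.2) p := hf.contDiffAt hnhds
  have h2 : ContDiffAt ℝ ∞ (Function.uncurry fun (q : V × E) (x : E) => f q.1 x) (p, p.2) := by
    have : ContDiffAt ℝ ∞ (fun q : (V × E) × E => (q.1.1, q.2)) (p, p.2) := by fun_prop
    exact ContDiffAt.comp (p, p.2) (g := fun p : V × E => f p.1 p.2) h1 this
  exact (ContDiffAt.fderiv h2 contDiffAt_snd (by simp)).contDiffWithinAt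

theorem contDiffAt_slice {U : Set E} (hU : IsOpen U) {f : V → E → F}
    (hf : ContDiffOn ℝ ∞ (fun p : V × E => f p.1 p.2) (Set.univ ×ˢ U)) (A : V) {x : E}
    (hx : x ∈ U) : ContDiffAt ℝ ∞ (f A) x := by
  have h1 : ContDiffAt ℝ ∞ (fun p : V × E => f p.1 p.2) (A, x) :=
    hf.contDiffAt ((isOpen_univ.prod hU).mem_nhds ⟨trivial, hx⟩)
  exact ContDiffAt.comp x (f := fun x : E => (A, x)) h1 (by fun_prop)

/-- Mean value inequality for `φ τ - τ a - (τ²/2) b`. It is the common source of the Taylor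
estimates of all orders below, which therefore carry no factorials. -/
theorem norm_sub_affine_le {φ φ' : ℝ → F} {a b : F} {C : ℝ}
    (hφ : ∀ τ ∈ Set.Icc (0 : ℝ) 1, HasDerivAt φ (φ' τ) τ)
    (hb : ∀ τ ∈ Set.Icc (0 : ℝ) 1, ‖φ' τ - a - τ • b‖ ≤ C) :
    ‖φ 1 - φ 0 - a - (1 / 2 : ℝ) • b‖ ≤ C := by
  have key := norm_image_sub_le_of_norm_deriv_le_segment_01'
    (f := fun τ => φ τ - τ • a - (τ ^ 2 / 2) • b) (f' := fun τ => φ' τ - a - τ • b) (C := C)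
    (fun τ hτ => by
      have h1 : HasDerivAt (fun τ : ℝ => τ • a) ((1 : ℝ) • a) τ := (hasDerivAt_id τ).smul_const a
      have h2 : HasDerivAt (fun τ : ℝ => (τ ^ 2 / 2) • b) (τ • b) τ := by
        have : HasDerivAt (fun τ : ℝ => τ ^ 2 / 2) τ τ := by
          have := ((hasDerivAt_pow 2 τ).div_const 2)
          simpa using this
        exact this.smul_const b
      have h3 := (((hφ τ hτ).sub h1).sub h2).hasDerivWithinAt (s := Set.Icc 0 1)
      rw [one_smul] at h3
      exact h3)
    (fun τ hτ => hb τ ⟨hτ.1, hτ.2.le⟩)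
  convert key using 2
  simp
  abel

theorem hasDerivAt_comp_line {f : E → F} {x y : E} {τ : ℝ}
    (hf : DifferentiableAt ℝ f (x + τ • y)) :
    HasDerivAt (fun τ : ℝ => f (x + τ • y)) (fderiv ℝ f (x + τ • y) y) τ := by
  have h : HasDerivAt (fun τ : ℝ => x + τ • y) y τ := by
    simpa using ((hasDerivAt_id τ).smul_const y).const_add x
  exact hf.hasFDerivAt.comp_hasDerivAt τ h

theorem norm_smul_le_of_mem_Icc {y : E} {τ r : ℝ} (hτ : τ ∈ Set.Icc (0 : ℝ) 1) (hy : ‖y‖ ≤ r) :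
    ‖τ • y‖ ≤ ‖y‖ ∧ ‖τ • y‖ ≤ r := by
  have : ‖τ • y‖ ≤ ‖y‖ := by
    rw [norm_smul, Real.norm_of_nonneg hτ.1]
    exact mul_le_of_le_one_left (norm_nonneg _) hτ.2
  exact ⟨this, this.trans hy⟩

theorem norm_sub_le_of_norm_fderiv_le {f : E → F} {x : E} {r C : ℝ}
    (hf : ∀ y, ‖y‖ ≤ r → DifferentiableAt ℝ f (x + y))
    (hC : ∀ y, ‖y‖ ≤ r → ‖fderiv ℝ f (x + y)‖ ≤ C) {y : E} (hy : ‖y‖ ≤ r) :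
    ‖f (x + y) - f x‖ ≤ C * ‖y‖ := by
  have := norm_sub_affine_le (φ := fun τ : ℝ => f (x + τ • y)) (a := 0) (b := 0)
    (C := C * ‖y‖) (fun τ hτ => hasDerivAt_comp_line (hf _ (norm_smul_le_of_mem_Icc hτ hy).2))
    (fun τ hτ => by
      simpa using (ContinuousLinearMap.le_of_opNorm_le _
        (hC _ (norm_smul_le_of_mem_Icc hτ hy).2) y))
  simpa using this

/-- Along the segment, the error of the derivative is controlled by the estimate of one order less,
applied to `fderiv ℝ f`. The next order is obtained in the same way. -/
theorem norm_sub_taylor_one_le {f : E → F} {x : E} {r C : ℝ}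
    (hf : ∀ y, ‖y‖ ≤ r → ContDiffAt ℝ ∞ f (x + y))
    (hC : ∀ y, ‖y‖ ≤ r → ‖fderiv ℝ (fderiv ℝ f) (x + y)‖ ≤ C) {y : E} (hy : ‖y‖ ≤ r) :
    ‖f (x + y) - f x - fderiv ℝ f x y‖ ≤ C * ‖y‖ ^ 2 := by
  have hC0 : 0 ≤ C := (norm_nonneg _).trans (hC y hy)
  have := norm_sub_affine_le (φ := fun τ : ℝ => f (x + τ • y)) (a := fderiv ℝ f x y) (b := 0)
    (C := C * ‖y‖ ^ 2) (fun τ hτ => hasDerivAt_comp_line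
      ((hf _ (norm_smul_le_of_mem_Icc hτ hy).2).differentiableAt (by simp)))
    (fun τ hτ => by
      have h1 := norm_sub_le_of_norm_fderiv_le (f := fderiv ℝ f) (fun z hz =>
        ((hf z hz).fderiv_right (m := ∞) (by simp)).differentiableAt (by simp)) hC
        (norm_smul_le_of_mem_Icc hτ hy).2
      have h2 := ContinuousLinearMap.le_of_opNorm_le _ h1 y
      have h3 := (norm_smul_le_of_mem_Icc hτ hy).1
      simp only [smul_zero, sub_zero]
      calc _ ≤ C * ‖τ • y‖ * ‖y‖ := h2
        _ ≤ C * ‖y‖ * ‖y‖ := by gcongr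
        _ = _ := by ring)
  simpa using this

theorem norm_sub_taylor_two_le {f : E → F} {x : E} {r C : ℝ}
    (hf : ∀ y, ‖y‖ ≤ r → ContDiffAt ℝ ∞ f (x + y))
    (hC : ∀ y, ‖y‖ ≤ r → ‖fderiv ℝ (fderiv ℝ (fderiv ℝ f)) (x + y)‖ ≤ C) {y : E} (hy : ‖y‖ ≤ r) :
    ‖f (x + y) - f x - fderiv ℝ f x y - (1 / 2 : ℝ) • fderiv ℝ (fderiv ℝ f) x y y‖
      ≤ C * ‖y‖ ^ 3 := by
  have hC0 : 0 ≤ C := (norm_nonneg _).trans (hC y hy)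
  have := norm_sub_affine_le (φ := fun τ : ℝ => f (x + τ • y)) (a := fderiv ℝ f x y)
    (b := fderiv ℝ (fderiv ℝ f) x y y)
    (C := C * ‖y‖ ^ 3) (fun τ hτ => hasDerivAt_comp_line
      ((hf _ (norm_smul_le_of_mem_Icc hτ hy).2).differentiableAt (by simp)))
    (fun τ hτ => by
      have h1 := norm_sub_taylor_one_le (f := fderiv ℝ f) (fun z hz =>
        ((hf z hz).fderiv_right (m := ∞) (by simp))) hC
        (norm_smul_le_of_mem_Icc hτ hy).2
      have h2 := ContinuousLinearMap.le_of_opNorm_le _ h1 y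
      have h3 := (norm_smul_le_of_mem_Icc hτ hy).1
      have h4 : fderiv ℝ f (x + τ • y) y - fderiv ℝ f x y - τ • fderiv ℝ (fderiv ℝ f) x y y
          = (fderiv ℝ f (x + τ • y) - fderiv ℝ f x - fderiv ℝ (fderiv ℝ f) x (τ • y)) y := by
        simp
      rw [h4]
      calc _ ≤ C * ‖τ • y‖ ^ 2 * ‖y‖ := h2
        _ ≤ C * ‖y‖ ^ 2 * ‖y‖ := by gcongr
        _ = _ := by ring)
  simpa using this

/-- A continuous curve in an open set has a tube of positive radius inside the set. -/
theorem exists_tube {E : Type*} [NormedAddCommGroup E] {U : Set E} (hU : IsOpen U) {x₀ : ℝ → E}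
    (hx : ContinuousOn x₀ (Set.Icc 0 1)) (hxU : ∀ s ∈ Set.Icc (0 : ℝ) 1, x₀ s ∈ U) :
    ∃ r > 0, ∀ s ∈ Set.Icc (0 : ℝ) 1, ∀ y, ‖y‖ ≤ r → x₀ s + y ∈ U := by
  obtain ⟨r, hr, hsub⟩ := (isCompact_Icc.image_of_continuousOn hx).exists_cthickening_subset_open
    hU (by rintro _ ⟨s, hs, rfl⟩; exact hxU s hs)
  refine ⟨r, hr, fun s hs y hy => hsub ?_⟩
  exact Metric.mem_cthickening_of_dist_le _ (x₀ s) _ _ ⟨s, hs, rfl⟩ (by simpa using hy)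

/-- Only `E` has to be proper: the space `V` of operators may be infinite-dimensional, but it is
visited only along the compact curve `A`. -/
theorem exists_tube_bound {V E F : Type*} [NormedAddCommGroup V] [NormedAddCommGroup E]
    [NormedAddCommGroup F] [ProperSpace E] {U : Set E} {f : V → E → F}
    (hf : ContinuousOn (fun p : V × E => f p.1 p.2) (Set.univ ×ˢ U))
    {A : ℝ → V} (hA : ContinuousOn A (Set.Icc 0 1)) {x₀ : ℝ → E}
    (hx : ContinuousOn x₀ (Set.Icc 0 1)) {r : ℝ}
    (hr : ∀ s ∈ Set.Icc (0 : ℝ) 1, ∀ y, ‖y‖ ≤ r → x₀ s + y ∈ U) :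
    ∃ C, ∀ s ∈ Set.Icc (0 : ℝ) 1, ∀ y, ‖y‖ ≤ r → ‖f (A s) (x₀ s + y)‖ ≤ C := by
  have hcomp : IsCompact (Set.Icc (0 : ℝ) 1 ×ˢ Metric.closedBall (0 : E) r) :=
    isCompact_Icc.prod (isCompact_closedBall _ _)
  have hcont : ContinuousOn (fun q : ℝ × E => f (A q.1) (x₀ q.1 + q.2))
      (Set.Icc (0 : ℝ) 1 ×ˢ Metric.closedBall (0 : E) r) := by
    refine hf.comp (f := fun q : ℝ × E => (A q.1, x₀ q.1 + q.2)) ?_ ?_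
    · exact (hA.comp continuousOn_fst fun q hq => hq.1).prodMk
        ((hx.comp continuousOn_fst fun q hq => hq.1).add continuousOn_snd)
    · exact fun q hq => ⟨trivial, hr _ hq.1 _ (by simpa using hq.2)⟩
  obtain ⟨C, hC⟩ := hcomp.exists_bound_of_continuousOn hcont
  exact ⟨C, fun s hs y hy => hC (s, y) ⟨hs, by simpa using hy⟩⟩

/-- Second order Taylor estimate, uniform in a tube around a curve. -/
theorem exists_tube_taylor_one [ProperSpace E] {U : Set E} (hU : IsOpen U) {f : V → E → F}
    (hf : ContDiffOn ℝ ∞ (fun p : V × E => f p.1 p.2) (Set.univ ×ˢ U))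
    {A : ℝ → V} (hA : ContinuousOn A (Set.Icc 0 1)) {x₀ : ℝ → E}
    (hx : ContinuousOn x₀ (Set.Icc 0 1)) {r : ℝ}
    (hr : ∀ s ∈ Set.Icc (0 : ℝ) 1, ∀ y, ‖y‖ ≤ r → x₀ s + y ∈ U) :
    ∃ C, ∀ s ∈ Set.Icc (0 : ℝ) 1, ∀ y, ‖y‖ ≤ r →
      ‖f (A s) (x₀ s + y) - f (A s) (x₀ s) - fderiv ℝ (f (A s)) (x₀ s) y‖ ≤ C * ‖y‖ ^ 2 := by
  obtain ⟨C, hC⟩ := exists_tube_bound (f := fun A x => fderiv ℝ (fderiv ℝ (f A)) x)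
    (contDiffOn_fderiv_param (f := fun A => fderiv ℝ (f A)) hU
      (contDiffOn_fderiv_param hU hf)).continuousOn hA hx hr
  exact ⟨C, fun s hs y hy => norm_sub_taylor_one_le
    (fun z hz => contDiffAt_slice hU hf _ (hr s hs z hz)) (hC s hs) hy⟩

/-- Third order Taylor estimate, uniform in a tube around a curve. -/
theorem exists_tube_taylor_two [ProperSpace E] {U : Set E} (hU : IsOpen U) {f : V → E → F}
    (hf : ContDiffOn ℝ ∞ (fun p : V × E => f p.1 p.2) (Set.univ ×ˢ U))
    {A : ℝ → V} (hA : ContinuousOn A (Set.Icc 0 1)) {x₀ : ℝ → E}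
    (hx : ContinuousOn x₀ (Set.Icc 0 1)) {r : ℝ}
    (hr : ∀ s ∈ Set.Icc (0 : ℝ) 1, ∀ y, ‖y‖ ≤ r → x₀ s + y ∈ U) :
    ∃ C, ∀ s ∈ Set.Icc (0 : ℝ) 1, ∀ y, ‖y‖ ≤ r →
      ‖f (A s) (x₀ s + y) - f (A s) (x₀ s) - fderiv ℝ (f (A s)) (x₀ s) y
        - (1 / 2 : ℝ) • fderiv ℝ (fderiv ℝ (f (A s))) (x₀ s) y y‖ ≤ C * ‖y‖ ^ 3 := by
  obtain ⟨C, hC⟩ := exists_tube_bound (f := fun A x => fderiv ℝ (fderiv ℝ (fderiv ℝ (f A))) x)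
    (contDiffOn_fderiv_param (f := fun A => fderiv ℝ (fderiv ℝ (f A))) hU
      (contDiffOn_fderiv_param (f := fun A => fderiv ℝ (f A)) hU
        (contDiffOn_fderiv_param hU hf))).continuousOn hA hx hr
  exact ⟨C, fun s hs y hy => norm_sub_taylor_two_le
    (fun z hz => contDiffAt_slice hU hf _ (hr s hs z hz)) (hC s hs) hy⟩

end Taylor

/-! ### Hamiltonian structure of the variational field. -/

section Geometry

variable {𝓗 : Type*} [NormedAddCommGroup 𝓗] [InnerProductSpace ℂ 𝓗] {n : ℕ}

/-- The vector field `P_x(-i A ψ(x))` as a function of the operator `A` and the parameter `x`. -/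
noncomputable def opField (ψ : (Fin n → ℝ) → 𝓗) (A : 𝓗 →L[ℂ] 𝓗) (x : Fin n → ℝ) : Fin n → ℝ :=
  tangentProj ψ x (-(Complex.I • A (ψ x)))

/-- The expectation value of the operator `A` in the state `ψ(x)`. -/
noncomputable def opEnergy (ψ : (Fin n → ℝ) → 𝓗) (A : 𝓗 →L[ℂ] 𝓗) (x : Fin n → ℝ) : ℝ :=
  (inner ℂ (ψ x) (A (ψ x))).re

theorem contDiffOn_matrix_det {E : Type*} [NormedAddCommGroup E] [NormedSpace ℝ E] {S : Set E}
    {m : ℕ} {M : E → Matrix (Fin m) (Fin m) ℝ}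
    (hM : ∀ i j, ContDiffOn ℝ ∞ (fun x => M x i j) S) :
    ContDiffOn ℝ ∞ (fun x => (M x).det) S := by
  simp only [Matrix.det_apply]
  refine ContDiffOn.sum fun σ _ => ?_
  exact (contDiffOn_prod fun i _ => hM (σ i) i).const_smul _

theorem contDiffOn_matrix_inv {E : Type*} [NormedAddCommGroup E] [NormedSpace ℝ E] {S : Set E}
    {m : ℕ} {M : E → Matrix (Fin m) (Fin m) ℝ}
    (hM : ∀ i j, ContDiffOn ℝ ∞ (fun x => M x i j) S) (hdet : ∀ x ∈ S, IsUnit (M x).det)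
    (i j : Fin m) : ContDiffOn ℝ ∞ (fun x => (M x)⁻¹ i j) S := by
  simp only [Matrix.inv_def, Matrix.smul_apply, Ring.inverse_eq_inv', smul_eq_mul,
    Matrix.adjugate_apply]
  refine ((contDiffOn_matrix_det hM).inv fun x hx => (hdet x hx).ne_zero).mul
    (contDiffOn_matrix_det fun k l => ?_)
  simp only [Matrix.updateRow_apply]
  split_ifs
  · exact contDiffOn_const
  · exact hM k l

theorem contDiffOn_tangentVec {U : Set (Fin n → ℝ)} {ψ : (Fin n → ℝ) → 𝓗}
    (hψ : IsVariationalFamily U ψ) (μ : Fin n) :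
    ContDiffOn ℝ ∞ (fun x => tangentVec ψ x μ) U :=
  (hψ.smooth.fderiv_of_isOpen hψ.isOpen (by simp)).clm_apply contDiffOn_const

theorem contDiffOn_symplecticMatrix {U : Set (Fin n → ℝ)} {ψ : (Fin n → ℝ) → 𝓗}
    (hψ : IsVariationalFamily U ψ) (μ ν : Fin n) :
    ContDiffOn ℝ ∞ (fun x => symplecticMatrix ψ x μ ν) U := by
  simp only [symplecticMatrix, Matrix.of_apply]
  exact contDiffOn_const.mul (Complex.imCLM.contDiff.comp_contDiffOn
    ((contDiffOn_tangentVec hψ μ).inner ℂ (contDiffOn_tangentVec hψ ν)))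

theorem symplecticMatrix_transpose (ψ : (Fin n → ℝ) → 𝓗) (x : Fin n → ℝ) :
    (symplecticMatrix ψ x)ᵀ = -symplecticMatrix ψ x := by
  ext μ ν
  simp only [symplecticMatrix, Matrix.transpose_apply, Matrix.neg_apply, Matrix.of_apply]
  rw [← inner_conj_symm, Complex.conj_im]
  ring

theorem dotProduct_symplecticMatrix_comm (ψ : (Fin n → ℝ) → 𝓗) (x u v : Fin n → ℝ) :
    u ⬝ᵥ (symplecticMatrix ψ x *ᵥ v) = -(v ⬝ᵥ (symplecticMatrix ψ x *ᵥ u)) := by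
  rw [Matrix.dotProduct_mulVec, ← Matrix.mulVec_transpose, symplecticMatrix_transpose,
    Matrix.neg_mulVec, neg_dotProduct, dotProduct_comm]

theorem dotProduct_symplecticMatrix_self (ψ : (Fin n → ℝ) → 𝓗) (x u : Fin n → ℝ) :
    u ⬝ᵥ (symplecticMatrix ψ x *ᵥ u) = 0 := by
  linarith [dotProduct_symplecticMatrix_comm ψ x u u]

theorem contDiffOn_apply_state {U : Set (Fin n → ℝ)} {ψ : (Fin n → ℝ) → 𝓗}
    (hψ : IsVariationalFamily U ψ) :
    ContDiffOn ℝ ∞ (fun p : (𝓗 →L[ℂ] 𝓗) × (Fin n → ℝ) => p.1 (ψ p.2)) (Set.univ ×ˢ U) := by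
  have hb : IsBoundedBilinearMap ℝ (fun q : (𝓗 →L[ℂ] 𝓗) × 𝓗 => q.1 q.2) :=
    { add_left := fun _ _ _ => rfl
      smul_left := fun _ _ _ => rfl
      add_right := fun A _ _ => map_add A _ _
      smul_right := fun c A y => A.map_smul_of_tower c y
      bound := ⟨1, one_pos, fun A y => by simpa using A.le_opNorm y⟩ }
  exact hb.contDiff.comp_contDiffOn
    (contDiffOn_fst.prodMk (hψ.smooth.comp contDiffOn_snd fun p hp => hp.2))

theorem contDiffOn_opField {U : Set (Fin n → ℝ)} {ψ : (Fin n → ℝ) → 𝓗}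
    (hψ : IsVariationalFamily U ψ) :
    ContDiffOn ℝ ∞ (fun p : (𝓗 →L[ℂ] 𝓗) × (Fin n → ℝ) => opField ψ p.1 p.2)
      (Set.univ ×ˢ U) := by
  have hsnd : ContDiffOn ℝ ∞ (Prod.snd : (𝓗 →L[ℂ] 𝓗) × (Fin n → ℝ) → _) (Set.univ ×ˢ U) :=
    contDiffOn_snd
  have hmaps : Set.MapsTo (Prod.snd : (𝓗 →L[ℂ] 𝓗) × (Fin n → ℝ) → _) (Set.univ ×ˢ U) U :=
    fun p hp => hp.2
  rw [contDiffOn_pi]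
  intro μ
  simp only [opField, tangentProj, Matrix.mulVec, dotProduct]
  refine ContDiffOn.sum fun ν _ => ?_
  refine ((contDiffOn_matrix_inv (contDiffOn_symplecticMatrix hψ) hψ.nondegenerate μ ν).comp
    hsnd hmaps).mul (contDiffOn_const.mul ?_)
  refine Complex.imCLM.contDiff.comp_contDiffOn (ContDiffOn.inner ℂ
    ((contDiffOn_tangentVec hψ ν).comp hsnd hmaps) ?_)
  exact ((contDiffOn_apply_state hψ).const_smul Complex.I).neg

theorem contDiffOn_opEnergy {U : Set (Fin n → ℝ)} {ψ : (Fin n → ℝ) → 𝓗}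
    (hψ : IsVariationalFamily U ψ) :
    ContDiffOn ℝ ∞ (fun p : (𝓗 →L[ℂ] 𝓗) × (Fin n → ℝ) => opEnergy ψ p.1 p.2)
      (Set.univ ×ˢ U) := by
  exact Complex.reCLM.contDiff.comp_contDiffOn (ContDiffOn.inner ℂ
    (hψ.smooth.comp contDiffOn_snd fun p hp => hp.2) (contDiffOn_apply_state hψ))

/-- Chain rule for a jointly smooth function that is linear in its first argument. -/
theorem hasDerivWithinAt_of_linear_left {V E F : Type*} [NormedAddCommGroup V] [NormedSpace ℝ V]
    [NormedAddCommGroup E] [NormedSpace ℝ E] [NormedAddCommGroup F] [NormedSpace ℝ F]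
    {U : Set E} (hU : IsOpen U) {f : V → E → F}
    (hf : ContDiffOn ℝ ∞ (fun p : V × E => f p.1 p.2) (Set.univ ×ˢ U))
    (hlin : ∀ (A B : V) (c : ℝ) (x : E), f (A + c • B) x = f A x + c • f B x)
    {S : Set ℝ} {s : ℝ} {A : ℝ → V} {A' : V} {x : ℝ → E} {x' : E}
    (hA : HasDerivWithinAt A A' S s) (hx : HasDerivWithinAt x x' S s) (hxU : x s ∈ U) :
    HasDerivWithinAt (fun u => f (A u) (x u)) (f A' (x s) + fderiv ℝ (f (A s)) (x s) x') S s := by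
  have hD : HasFDerivAt (fun p : V × E => f p.1 p.2)
      (fderiv ℝ (fun p : V × E => f p.1 p.2) (A s, x s)) (A s, x s) :=
    ((hf.contDiffAt ((isOpen_univ.prod hU).mem_nhds ⟨trivial, hxU⟩)).differentiableAt
      (by simp)).hasFDerivAt
  set D := fderiv ℝ (fun p : V × E => f p.1 p.2) (A s, x s)
  have h1 : HasDerivWithinAt (fun u => f (A u) (x u)) (D (A', x')) S s :=
    hD.comp_hasDerivWithinAt (f := fun u => (A u, x u)) s (hA.prodMk hx)
  -- Along `A s + τ • A'` the function is affine with slope `f A' (x s)`, so uniqueness of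
  -- derivatives identifies the partial derivative.
  have h2 : D (A', 0) = f A' (x s) := by
    have ha : HasDerivAt (fun τ : ℝ => (A s + τ • A', x s)) (A', (0 : E)) 0 := by
      have : HasDerivAt (fun τ : ℝ => A s + τ • A') A' 0 := by
        simpa using ((hasDerivAt_id (0 : ℝ)).smul_const A').const_add (A s)
      exact this.prodMk (hasDerivAt_const _ _)
    have hb : HasDerivAt (fun τ : ℝ => f (A s + τ • A') (x s)) (D (A', 0)) 0 := by
      refine HasFDerivAt.comp_hasDerivAt (f := fun τ : ℝ => (A s + τ • A', x s)) 0
        (l := fun p : V × E => f p.1 p.2) ?_ ha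
      simpa using hD
    have hc : HasDerivAt (fun τ : ℝ => f (A s + τ • A') (x s)) (f A' (x s)) 0 := by
      simp only [hlin]
      simpa using ((hasDerivAt_id (0 : ℝ)).smul_const (f A' (x s))).const_add (f (A s) (x s))
    exact hb.unique hc
  have h3 : D (0, x') = fderiv ℝ (f (A s)) (x s) x' := by
    have ha : HasFDerivAt (fun z : E => (A s, z)) (ContinuousLinearMap.inr ℝ V E) (x s) :=
      hasFDerivAt_prodMk_right _ _
    have hb : HasFDerivAt (f (A s)) (D.comp (ContinuousLinearMap.inr ℝ V E)) (x s) :=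
      HasFDerivAt.comp (f := fun z : E => (A s, z)) (x s) hD ha
    rw [hb.fderiv]
    simp
  have h4 : D (A', x') = f A' (x s) + fderiv ℝ (f (A s)) (x s) x' := by
    rw [← h2, ← h3, ← map_add]
    simp
  rwa [h4] at h1

theorem opField_linear (ψ : (Fin n → ℝ) → 𝓗) (A B : 𝓗 →L[ℂ] 𝓗) (c : ℝ) (x : Fin n → ℝ) :
    opField ψ (A + c • B) x = opField ψ A x + c • opField ψ B x := by
  simp only [opField, tangentProj]
  rw [← Matrix.mulVec_smul, ← Matrix.mulVec_add]
  congr 1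
  ext ν
  have h : -(Complex.I • (A + c • B) (ψ x))
      = -(Complex.I • A (ψ x)) + (c : ℂ) • (-(Complex.I • B (ψ x))) := by
    simp only [add_apply, smul_apply, smul_add, smul_neg,
      neg_add, ← Complex.coe_smul]
    rw [smul_comm]
  rw [h, inner_add_right, inner_smul_right, Complex.add_im, Complex.im_ofReal_mul]
  simp
  ring

theorem opEnergy_linear (ψ : (Fin n → ℝ) → 𝓗) (A B : 𝓗 →L[ℂ] 𝓗) (c : ℝ) (x : Fin n → ℝ) :
    opEnergy ψ (A + c • B) x = opEnergy ψ A x + c • opEnergy ψ B x := by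
  simp only [opEnergy, add_apply, smul_apply,
    inner_add_right, Complex.add_re, smul_eq_mul, ← Complex.coe_smul, inner_smul_right,
    Complex.re_ofReal_mul]

theorem clm_apply_eq_sum_single {F : Type*} [NormedAddCommGroup F] [NormedSpace ℝ F]
    (L : (Fin n → ℝ) →L[ℝ] F) (u : Fin n → ℝ) : L u = ∑ ν, u ν • L (Pi.single ν 1) := by
  conv_lhs => rw [pi_eq_sum_univ' u]
  simp only [map_sum, map_smul]

/-- Hamilton's equations. Self-adjointness gives `dE(u) = 2 Re⟨∂_u ψ|Aψ⟩`, and the factor `-i` in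
the field turns this real part into minus the imaginary part that defines `ωX`. -/
theorem fderiv_opEnergy [CompleteSpace 𝓗] {U : Set (Fin n → ℝ)} {ψ : (Fin n → ℝ) → 𝓗}
    (hψ : IsVariationalFamily U ψ) {A : 𝓗 →L[ℂ] 𝓗} (hA : IsSelfAdjoint A) {x : Fin n → ℝ}
    (hx : x ∈ U) (u : Fin n → ℝ) :
    fderiv ℝ (opEnergy ψ A) x u = -(u ⬝ᵥ (symplecticMatrix ψ x *ᵥ opField ψ A x)) := by
  have hd : HasFDerivAt ψ (fderiv ℝ ψ x) x :=
    ((hψ.smooth.contDiffAt (hψ.isOpen.mem_nhds hx)).differentiableAt (by simp)).hasFDerivAt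
  have hAd : HasFDerivAt (fun x => A (ψ x)) ((A.restrictScalars ℝ).comp (fderiv ℝ ψ x)) x :=
    (A.restrictScalars ℝ).hasFDerivAt.comp x hd
  have h1 := (Complex.reCLM.hasFDerivAt.comp x (hd.inner ℂ hAd)).fderiv
  have h2 : fderiv ℝ (opEnergy ψ A) x u = 2 * (inner ℂ (fderiv ℝ ψ x u) (A (ψ x))).re := by
    have h3 : inner ℂ (ψ x) (A (fderiv ℝ ψ x u)) = inner ℂ (A (ψ x)) (fderiv ℝ ψ x u) := by
      rw [← ContinuousLinearMap.adjoint_inner_left, ← ContinuousLinearMap.star_eq_adjoint, hA]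
    change fderiv ℝ (Complex.reCLM ∘ fun t => inner ℂ (ψ t) (A (ψ t))) x u = _
    rw [h1]
    simp only [ContinuousLinearMap.comp_apply, fderivInnerCLM_apply, ContinuousLinearMap.prod_apply,
      Complex.reCLM_apply, Complex.add_re, ContinuousLinearMap.coe_restrictScalars']
    rw [h3, ← inner_conj_symm (A (ψ x)), Complex.conj_re]
    ring
  rw [h2, opField, tangentProj, Matrix.mulVec_mulVec,
    Matrix.mul_nonsing_inv _ (hψ.nondegenerate x hx), Matrix.one_mulVec,
    clm_apply_eq_sum_single (fderiv ℝ ψ x) u]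
  simp only [dotProduct, sum_inner, Complex.re_sum, Finset.mul_sum, ← Finset.sum_neg_distrib]
  refine Finset.sum_congr rfl fun ν _ => ?_
  rw [← Complex.coe_smul, inner_smul_left, Complex.conj_ofReal, Complex.re_ofReal_mul,
    inner_neg_right, inner_smul_right]
  simp [tangentVec]
  ring

theorem eq_zero_of_dotProduct_symplecticMatrix {U : Set (Fin n → ℝ)} {ψ : (Fin n → ℝ) → 𝓗}
    (hψ : IsVariationalFamily U ψ) {x : Fin n → ℝ} (hx : x ∈ U) {y : Fin n → ℝ}
    (h : ∀ u, u ⬝ᵥ (symplecticMatrix ψ x *ᵥ y) = 0) : y = 0 := by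
  have h1 : symplecticMatrix ψ x *ᵥ y = 0 := by
    ext μ
    simpa using h (Pi.single μ 1)
  have h2 := congrArg ((symplecticMatrix ψ x)⁻¹ *ᵥ ·) h1
  simpa [Matrix.mulVec_mulVec, Matrix.nonsing_inv_mul _ (hψ.nondegenerate x hx)] using h2

theorem opField_eq_zero_of_isMin [CompleteSpace 𝓗] {U : Set (Fin n → ℝ)} {ψ : (Fin n → ℝ) → 𝓗}
    (hψ : IsVariationalFamily U ψ) {A : 𝓗 →L[ℂ] 𝓗} (hA : IsSelfAdjoint A) {x : Fin n → ℝ}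
    (hx : x ∈ U) (hmin : ∀ y ∈ U, opEnergy ψ A x ≤ opEnergy ψ A y) : opField ψ A x = 0 := by
  have hloc : IsLocalMin (opEnergy ψ A) x :=
    Filter.mem_of_superset (hψ.isOpen.mem_nhds hx) fun y hy => hmin y hy
  refine eq_zero_of_dotProduct_symplecticMatrix hψ hx fun u => ?_
  have := fderiv_opEnergy hψ hA hx u
  rw [hloc.fderiv_eq_zero] at this
  simpa using this.symm

/-- Differentiate `dE(v) = -v·ωX`. The hypothesis `h0` kills the term with `dω`, and it covers both
situations needed later: critical points, where `X = 0`, and Darboux coordinates, where `dω = 0`. -/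
theorem fderiv_fderiv_opEnergy [CompleteSpace 𝓗] {U : Set (Fin n → ℝ)} {ψ : (Fin n → ℝ) → 𝓗}
    (hψ : IsVariationalFamily U ψ) {A : 𝓗 →L[ℂ] 𝓗} (hA : IsSelfAdjoint A) {x : Fin n → ℝ}
    (hx : x ∈ U) (u v : Fin n → ℝ)
    (h0 : ∀ μ ν, fderiv ℝ (fun x => symplecticMatrix ψ x μ ν) x u * opField ψ A x ν = 0) :
    fderiv ℝ (fderiv ℝ (opEnergy ψ A)) x u v
      = -(v ⬝ᵥ (symplecticMatrix ψ x *ᵥ fderiv ℝ (opField ψ A) x u)) := by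
  have hE := contDiffAt_slice hψ.isOpen (contDiffOn_opEnergy hψ) A hx
  have hX : HasFDerivAt (opField ψ A) (fderiv ℝ (opField ψ A) x) x :=
    ((contDiffAt_slice hψ.isOpen (contDiffOn_opField hψ) A hx).differentiableAt
      (by simp)).hasFDerivAt
  have h1 : HasFDerivAt (fun z => fderiv ℝ (opEnergy ψ A) z v)
      ((fderiv ℝ (fderiv ℝ (opEnergy ψ A)) x).flip v) x :=
    (((hE.fderiv_right (m := ∞) (by simp)).differentiableAt (by simp)).hasFDerivAt.clm_apply
      (hasFDerivAt_const v x)).congr_fderiv (by ext; simp)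
  have h2 : HasFDerivAt (fun z => -∑ μ, v μ * ∑ ν, symplecticMatrix ψ z μ ν * opField ψ A z ν)
      (-∑ μ, v μ • ∑ ν, (symplecticMatrix ψ x μ ν •
          ((ContinuousLinearMap.proj (R := ℝ) (φ := fun _ : Fin n => ℝ) ν).comp
            (fderiv ℝ (opField ψ A) x))
        + opField ψ A x ν • fderiv ℝ (fun x => symplecticMatrix ψ x μ ν) x)) x := by
    refine (HasFDerivAt.fun_sum fun μ _ => (HasFDerivAt.fun_sum fun ν _ => ?_).const_mul (v μ)).neg
    refine HasFDerivAt.mul ?_ (hasFDerivAt_pi'.1 hX ν)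
    exact (((contDiffOn_symplecticMatrix hψ μ ν).contDiffAt
      (hψ.isOpen.mem_nhds hx)).differentiableAt (by simp)).hasFDerivAt
  have h3 : (fun z => fderiv ℝ (opEnergy ψ A) z v) =ᶠ[nhds x]
      fun z => -∑ μ, v μ * ∑ ν, symplecticMatrix ψ z μ ν * opField ψ A z ν := by
    filter_upwards [hψ.isOpen.mem_nhds hx] with z hz
    exact fderiv_opEnergy hψ hA hz v
  have h4 := congrArg (fun L => L u) (h1.unique (h2.congr_of_eventuallyEq h3))
  simp only [ContinuousLinearMap.flip_apply] at h4
  rw [h4]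
  simp only [neg_apply, sum_apply,
    smul_apply, add_apply, smul_eq_mul,
    ContinuousLinearMap.comp_apply, ContinuousLinearMap.proj_apply, dotProduct, Matrix.mulVec,
    neg_inj]
  refine Finset.sum_congr rfl fun μ _ => ?_
  congr 1
  refine Finset.sum_congr rfl fun ν _ => ?_
  rw [mul_comm (opField ψ A x ν), h0, add_zero]

/-- Symmetry of the Hessian of the energy, read as: the linearized field is infinitesimally
symplectic. -/
theorem symplecticMatrix_fderiv_opField_symm [CompleteSpace 𝓗] {U : Set (Fin n → ℝ)}
    {ψ : (Fin n → ℝ) → 𝓗} (hψ : IsVariationalFamily U ψ) {A : 𝓗 →L[ℂ] 𝓗} (hA : IsSelfAdjoint A)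
    {x : Fin n → ℝ} (hx : x ∈ U)
    (h0 : ∀ u μ ν, fderiv ℝ (fun x => symplecticMatrix ψ x μ ν) x u * opField ψ A x ν = 0)
    (u v : Fin n → ℝ) :
    v ⬝ᵥ (symplecticMatrix ψ x *ᵥ fderiv ℝ (opField ψ A) x u)
      = u ⬝ᵥ (symplecticMatrix ψ x *ᵥ fderiv ℝ (opField ψ A) x v) := by
  have hsymm := (contDiffAt_slice hψ.isOpen (contDiffOn_opEnergy hψ) A hx).isSymmSndFDerivAt
    (by simpa using WithTop.coe_le_coe.2 (le_top : (2 : ℕ∞) ≤ ⊤)) u v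
  rw [fderiv_fderiv_opEnergy hψ hA hx u v (h0 u), fderiv_fderiv_opEnergy hψ hA hx v u (h0 v)]
    at hsymm
  linarith

/-- The Hessian of the energy at a minimum, which is `-ω K`, is positive semidefinite. -/
theorem symplecticMatrix_fderiv_opField_nonpos [CompleteSpace 𝓗] {U : Set (Fin n → ℝ)}
    {ψ : (Fin n → ℝ) → 𝓗} (hψ : IsVariationalFamily U ψ) {A : 𝓗 →L[ℂ] 𝓗} (hA : IsSelfAdjoint A)
    {x : Fin n → ℝ} (hx : x ∈ U) (hmin : ∀ y ∈ U, opEnergy ψ A x ≤ opEnergy ψ A y)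
    (u : Fin n → ℝ) :
    u ⬝ᵥ (symplecticMatrix ψ x *ᵥ fderiv ℝ (opField ψ A) x u) ≤ 0 := by
  have hX0 := opField_eq_zero_of_isMin hψ hA hx hmin
  have hsnd := fderiv_fderiv_opEnergy hψ hA hx u u (by simp [hX0])
  have hloc : IsLocalMin (opEnergy ψ A) x :=
    Filter.mem_of_superset (hψ.isOpen.mem_nhds hx) fun y hy => hmin y hy
  obtain ⟨r, hr, htube⟩ := exists_tube hψ.isOpen (x₀ := fun _ => x) continuousOn_const
    fun _ _ => hx
  obtain ⟨C, hC⟩ := exists_tube_taylor_two hψ.isOpen (contDiffOn_opEnergy hψ)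
    (A := fun _ => A) continuousOn_const (x₀ := fun _ => x) continuousOn_const htube
  have hC := hC 0 (by simp)
  rw [hloc.fderiv_eq_zero] at hC
  by_contra! hpos
  set q := u ⬝ᵥ (symplecticMatrix ψ x *ᵥ fderiv ℝ (opField ψ A) x u) with hq
  -- Along `t • u` the energy changes by `-t² q / 2 + O(t³)`, which minimality makes nonnegative.
  -- Divide by `t²` and let `t` tend to 0.
  have key : ∀ t : ℝ, 0 < t → t * ‖u‖ ≤ r → q / 2 ≤ C * ‖u‖ ^ 3 * t := by
    intro t ht htr
    have hn : ‖t • u‖ = t * ‖u‖ := by rw [norm_smul, Real.norm_of_nonneg ht.le]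
    have h1 := hC (t • u) (by rwa [hn])
    have h2 := hmin _ (htube 0 (by simp) (t • u) (by rwa [hn]))
    simp only [zero_apply, map_smul,
      smul_apply, smul_eq_mul, hsnd, hn] at h1
    have h3 := (abs_le.1 (Real.norm_eq_abs _ ▸ h1)).2
    have h4 : t ^ 2 * (q / 2) ≤ t ^ 2 * (C * ‖u‖ ^ 3 * t) := by
      have : C * (t * ‖u‖) ^ 3 = t ^ 2 * (C * ‖u‖ ^ 3 * t) := by ring
      rw [← this]
      nlinarith
    exact le_of_mul_le_mul_left h4 (by positivity)
  have hlim : Filter.Tendsto (fun t : ℝ => C * ‖u‖ ^ 3 * t) (nhdsWithin 0 (Set.Ioi 0))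
      (nhds (C * ‖u‖ ^ 3 * 0)) :=
    ((continuous_const.mul continuous_id).tendsto 0).mono_left nhdsWithin_le_nhds
  have hev : ∀ᶠ t : ℝ in nhdsWithin 0 (Set.Ioi 0), q / 2 ≤ C * ‖u‖ ^ 3 * t := by
    have h1 : ∀ᶠ t : ℝ in nhdsWithin 0 (Set.Ioi 0), t * ‖u‖ < r := by
      have : Filter.Tendsto (fun t : ℝ => t * ‖u‖) (nhdsWithin 0 (Set.Ioi 0))
          (nhds (0 * ‖u‖)) :=
        ((continuous_id.mul continuous_const).tendsto 0).mono_left nhdsWithin_le_nhds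
      exact this.eventually_lt_const (by simpa using hr)
    filter_upwards [h1, self_mem_nhdsWithin] with t ht ht0
    exact key t ht0 ht.le
  have := ge_of_tendsto hlim hev
  simp only [mul_zero] at this
  linarith

/-- At a nondegenerate minimum the Hessian of the energy is positive definite. -/
theorem symplecticMatrix_fderiv_opField_neg [CompleteSpace 𝓗] {U : Set (Fin n → ℝ)}
    {ψ : (Fin n → ℝ) → 𝓗} (hψ : IsVariationalFamily U ψ) {A : 𝓗 →L[ℂ] 𝓗} (hA : IsSelfAdjoint A)
    {x : Fin n → ℝ} (hx : x ∈ U) (hmin : ∀ y ∈ U, opEnergy ψ A x ≤ opEnergy ψ A y)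
    (hinj : ∀ u, fderiv ℝ (opField ψ A) x u = 0 → u = 0) {u : Fin n → ℝ} (hu : u ≠ 0) :
    u ⬝ᵥ (symplecticMatrix ψ x *ᵥ fderiv ℝ (opField ψ A) x u) < 0 := by
  have hX0 := opField_eq_zero_of_isMin hψ hA hx hmin
  have hle := symplecticMatrix_fderiv_opField_nonpos hψ hA hx hmin
  refine lt_of_le_of_ne (hle u) fun hzero => hu (hinj u ?_)
  refine eq_zero_of_dotProduct_symplecticMatrix hψ hx fun v => ?_
  have hsymm := symplecticMatrix_fderiv_opField_symm hψ hA hx (by simp [hX0]) u v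
  set a := v ⬝ᵥ (symplecticMatrix ψ x *ᵥ fderiv ℝ (opField ψ A) x u) with ha
  set b := v ⬝ᵥ (symplecticMatrix ψ x *ᵥ fderiv ℝ (opField ψ A) x v) with hb
  -- A null vector of a semidefinite form lies in its kernel: if `2at + bt² ≤ 0` for all `t`, then
  -- `a = 0`.
  have hquad : ∀ t : ℝ, 2 * a * t + b * t ^ 2 ≤ 0 := by
    intro t
    have h := hle (u + t • v)
    simp only [map_add, map_smul, Matrix.mulVec_add, Matrix.mulVec_smul, add_dotProduct,
      dotProduct_add, smul_dotProduct, dotProduct_smul, smul_eq_mul, hzero, ← hsymm,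
      ← ha, ← hb] at h
    linarith
  have hb0 : b ≤ 0 := hle v
  by_contra hne
  rcases hb0.eq_or_lt with hb1 | hb1
  · have := hquad a
    rw [hb1] at this
    have : 0 < a ^ 2 := by positivity
    nlinarith
  · have h1 := hquad (-a / b)
    have h2 : 2 * a * (-a / b) + b * (-a / b) ^ 2 = -(a ^ 2 / b) := by field_simp; ring
    have h3 : a ^ 2 / b < 0 := div_neg_of_pos_of_neg (by positivity) hb1
    linarith

theorem generator_mulVec (ψ : (Fin n → ℝ) → 𝓗) (H : ℝ → 𝓗 →L[ℂ] 𝓗) (x₀ : ℝ → Fin n → ℝ) (s : ℝ)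
    (u : Fin n → ℝ) : generator ψ H x₀ s *ᵥ u = fderiv ℝ (opField ψ (H s)) (x₀ s) u := by
  rw [clm_apply_eq_sum_single (fderiv ℝ (opField ψ (H s)) (x₀ s)) u]
  ext μ
  simp only [Matrix.mulVec, dotProduct, Finset.sum_apply, Pi.smul_apply, smul_eq_mul]
  exact Finset.sum_congr rfl fun ν _ => mul_comm _ _

end Geometry

/-! ### The `O(1/T)` bound from an almost conserved energy. -/

/-- Grönwall-type estimate for a coercive almost conserved quantity. -/
theorem norm_le_of_energy_estimate {E : Type*} [NormedAddCommGroup E] {y : ℝ → E} {m m' : ℝ → ℝ}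
    {c C ε t : ℝ} (hc : 0 < c) (hC : 0 ≤ C) (hε : 0 ≤ ε) (ht1 : t ≤ 1)
    (hm : ∀ s ∈ Set.Icc 0 t, HasDerivWithinAt m (m' s) (Set.Icc 0 t) s) (h0 : m 0 = 0)
    (hlow : ∀ s ∈ Set.Icc 0 t, c * ‖y s‖ ^ 2 ≤ m s + ε * ‖y s‖)
    (hup : ∀ s ∈ Set.Icc 0 t, m' s ≤ C * ‖y s‖ ^ 2 + ε * ‖y s‖) :
    ∀ s ∈ Set.Icc 0 t, ‖y s‖ ≤ √(2 / c ^ 2 * Real.exp (2 * C / c + 1)) * ε := by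
  -- Young's inequality with weight `c / 2`, so that the linear terms use up only half of the
  -- coercivity.
  have hyoung : ∀ a : ℝ, ε * a ≤ c / 2 * a ^ 2 + ε ^ 2 / (2 * c) := by
    intro a
    have h1 : c / 2 * a ^ 2 + ε ^ 2 / (2 * c) - ε * a = (c * a - ε) ^ 2 / (2 * c) := by
      field_simp
      ring
    have h2 : 0 ≤ (c * a - ε) ^ 2 / (2 * c) := by positivity
    linarith
  have hlow' : ∀ s ∈ Set.Icc 0 t, c / 2 * ‖y s‖ ^ 2 ≤ m s + ε ^ 2 / (2 * c) := by
    intro s hs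
    linarith [hlow s hs, hyoung ‖y s‖]
  -- The shift by `ε² / (2c)` makes the quantity dominate `(c/2) ‖y‖²`. In the rate, `2C / c`
  -- accounts for `C ‖y‖²` and the 1 for the `(c/2) ‖y‖²` from Young's inequality.
  have hg := le_exp_of_deriv_le (f := fun s => m s + ε ^ 2 / (2 * c)) (f' := m')
    (δ := ε ^ 2 / (2 * c)) (K := 2 * C / c + 1) (ε := ε ^ 2 / (2 * c)) ht1
    (fun s hs => (hm s hs).add_const _) (by simp [h0]) (by positivity) (by positivity)
    (by linarith [show 0 ≤ 2 * C / c by positivity])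
    (fun s hs => by
      have h1 : (2 * C / c + 1) * (c / 2 * ‖y s‖ ^ 2) = (C + c / 2) * ‖y s‖ ^ 2 := by
        field_simp
      have h2 : (2 * C / c + 1) * (c / 2 * ‖y s‖ ^ 2)
          ≤ (2 * C / c + 1) * (m s + ε ^ 2 / (2 * c)) :=
        mul_le_mul_of_nonneg_left (hlow' s hs) (by positivity)
      linarith [hup s hs, hyoung ‖y s‖])
  intro s hs
  have h1 := (hlow' s hs).trans (hg s hs)
  have h2 : ‖y s‖ ^ 2 ≤ 2 / c ^ 2 * Real.exp (2 * C / c + 1) * ε ^ 2 := by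
    have h3 : ‖y s‖ ^ 2 = 2 / c * (c / 2 * ‖y s‖ ^ 2) := by field_simp
    rw [h3]
    calc _ ≤ 2 / c * ((ε ^ 2 / (2 * c) + ε ^ 2 / (2 * c)) * Real.exp (2 * C / c + 1)) := by
          gcongr
      _ = _ := by field_simp; ring
  calc ‖y s‖ = √(‖y s‖ ^ 2) := (Real.sqrt_sq (norm_nonneg _)).symm
    _ ≤ √(2 / c ^ 2 * Real.exp (2 * C / c + 1) * ε ^ 2) := Real.sqrt_le_sqrt h2
    _ = _ := by rw [Real.sqrt_mul (by positivity), Real.sqrt_sq hε]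

theorem abs_dotProduct_le {n : ℕ} (u v : Fin n → ℝ) : |u ⬝ᵥ v| ≤ n * ‖v‖ * ‖u‖ := by
  calc |u ⬝ᵥ v| ≤ ∑ i, |u i * v i| := Finset.abs_sum_le_sum_abs _ _
    _ ≤ ∑ _i : Fin n, ‖v‖ * ‖u‖ := by
        refine Finset.sum_le_sum fun i _ => ?_
        rw [abs_mul, mul_comm]
        exact mul_le_mul (norm_le_pi_norm v i) (norm_le_pi_norm u i) (abs_nonneg _) (norm_nonneg _)
    _ = _ := by simp; ring

theorem hasDerivWithinAt_dotProduct {n : ℕ} {u v : ℝ → Fin n → ℝ} {u' v' : Fin n → ℝ} {S : Set ℝ}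
    {s : ℝ} (hu : HasDerivWithinAt u u' S s) (hv : HasDerivWithinAt v v' S s) :
    HasDerivWithinAt (fun t => u t ⬝ᵥ v t) (u' ⬝ᵥ v s + u s ⬝ᵥ v') S s := by
  simp only [dotProduct, ← Finset.sum_add_distrib]
  exact HasDerivWithinAt.fun_sum fun i _ =>
    (hasDerivWithinAt_pi.1 hu i).mul (hasDerivWithinAt_pi.1 hv i)

section Energy

variable {𝓗 : Type*} [NormedAddCommGroup 𝓗] [InnerProductSpace ℂ 𝓗] {n : ℕ}
  {U : Set (Fin n → ℝ)} {ψ : (Fin n → ℝ) → 𝓗} {H : ℝ → 𝓗 →L[ℂ] 𝓗} {x₀ : ℝ → Fin n → ℝ}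

theorem IsVariationalGroundState.hasDerivWithinAt (hx₀ : IsVariationalGroundState U ψ H x₀) {s : ℝ}
    (hs : s ∈ Set.Icc (0 : ℝ) 1) :
    HasDerivWithinAt x₀ (velocity x₀ s) (Set.Icc 0 1) s :=
  (hx₀.smooth.differentiableOn (by simp) s hs).hasDerivWithinAt

theorem contDiffOn_velocity (hx₀ : IsVariationalGroundState U ψ H x₀) :
    ContDiffOn ℝ ∞ (velocity x₀) (Set.Icc 0 1) :=
  hx₀.smooth.derivWithin (uniqueDiffOn_Icc zero_lt_one) (by simp)

theorem contDiffOn_symplecticMatrix_mulVec_velocity (hψ : IsVariationalFamily U ψ)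
    (hx₀ : IsVariationalGroundState U ψ H x₀) :
    ContDiffOn ℝ ∞ (fun s => symplecticMatrix ψ (x₀ s) *ᵥ velocity x₀ s) (Set.Icc 0 1) := by
  rw [contDiffOn_pi]
  intro μ
  simp only [Matrix.mulVec, dotProduct]
  exact ContDiffOn.sum fun ν _ => ((contDiffOn_symplecticMatrix hψ μ ν).comp hx₀.smooth
    hx₀.mem).mul (contDiffOn_pi.1 (contDiffOn_velocity hx₀) ν)

/-- Bounds for the momentum `ω(x₀) dx₀/ds` and its derivative, which vanish if the ground state does
not move. -/
theorem exists_momentum_bound (hψ : IsVariationalFamily U ψ)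
    (hx₀ : IsVariationalGroundState U ψ H x₀) :
    ∃ L : ℝ, 0 ≤ L ∧ ((∀ s ∈ Set.Icc (0 : ℝ) 1, velocity x₀ s = 0) → L = 0) ∧
      ∀ s ∈ Set.Icc (0 : ℝ) 1, ∀ y : Fin n → ℝ,
        |y ⬝ᵥ (symplecticMatrix ψ (x₀ s) *ᵥ velocity x₀ s)| ≤ L * ‖y‖ ∧
        |y ⬝ᵥ derivWithin (fun s => symplecticMatrix ψ (x₀ s) *ᵥ velocity x₀ s) (Set.Icc 0 1) s|
          ≤ L * ‖y‖ := by
  have hsm := contDiffOn_symplecticMatrix_mulVec_velocity hψ hx₀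
  -- A compactness bound need not vanish for a motionless ground state, but a bound proportional to
  -- `κ` requires it.
  by_cases hv : ∀ s ∈ Set.Icc (0 : ℝ) 1, velocity x₀ s = 0
  · refine ⟨0, le_rfl, fun _ => rfl, fun s hs y => ?_⟩
    have h1 : derivWithin (fun s => symplecticMatrix ψ (x₀ s) *ᵥ velocity x₀ s) (Set.Icc 0 1) s
        = 0 := by
      rw [derivWithin_congr (f := fun _ => 0) (fun t ht => by simp [hv t ht]) (by simp [hv s hs])]
      simp
    rw [h1, hv s hs]
    simp
  · obtain ⟨C₁, hC₁⟩ := isCompact_Icc.exists_bound_of_continuousOn hsm.continuousOn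
    obtain ⟨C₂, hC₂⟩ := isCompact_Icc.exists_bound_of_continuousOn
      (hsm.continuousOn_derivWithin (uniqueDiffOn_Icc zero_lt_one) (by simp))
    have h0 : (0 : ℝ) ∈ Set.Icc (0 : ℝ) 1 := by simp
    have hC₁0 : 0 ≤ C₁ := (norm_nonneg _).trans (hC₁ 0 h0)
    have hC₂0 : 0 ≤ C₂ := (norm_nonneg _).trans (hC₂ 0 h0)
    refine ⟨n * (C₁ + C₂), by positivity, fun h => absurd h hv, fun s hs y => ⟨?_, ?_⟩⟩
    · refine (abs_dotProduct_le _ _).trans ?_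
      gcongr
      linarith [hC₁ s hs]
    · refine (abs_dotProduct_le _ _).trans ?_
      gcongr
      linarith [hC₂ s hs]

variable [CompleteSpace 𝓗]

theorem IsProtocol.hasDerivWithinAt (hH : IsProtocol H) {s : ℝ} (hs : s ∈ Set.Icc (0 : ℝ) 1) :
    HasDerivWithinAt H (derivWithin H (Set.Icc 0 1) s) (Set.Icc 0 1) s :=
  (hH.smooth.differentiableOn (by simp) s hs).hasDerivWithinAt

theorem IsProtocol.isSelfAdjoint_derivWithin (hH : IsProtocol H) {s : ℝ}
    (hs : s ∈ Set.Icc (0 : ℝ) 1) : IsSelfAdjoint (derivWithin H (Set.Icc 0 1) s) := by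
  have h1 := hH.hasDerivWithinAt hs
  have h2 : HasDerivWithinAt (fun t => star (H t)) (star (derivWithin H (Set.Icc 0 1) s))
      (Set.Icc 0 1) s := h1.star
  have h3 : HasDerivWithinAt H (star (derivWithin H (Set.Icc 0 1) s)) (Set.Icc 0 1) s :=
    h2.congr (fun t ht => (hH.selfAdjoint t ht).symm) (hH.selfAdjoint s hs).symm
  exact (uniqueDiffOn_Icc zero_lt_one s hs).eq_deriv _ h3 h1

theorem IsVariationalGroundState.opField_eq_zero (hψ : IsVariationalFamily U ψ) (hH : IsProtocol H)
    (hx₀ : IsVariationalGroundState U ψ H x₀) {s : ℝ} (hs : s ∈ Set.Icc (0 : ℝ) 1) :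
    opField ψ (H s) (x₀ s) = 0 :=
  opField_eq_zero_of_isMin hψ (hH.selfAdjoint s hs) (hx₀.mem s hs) (hx₀.minimal s hs)

/-- Differentiating the equilibrium condition along the curve of ground states. -/
theorem IsVariationalGroundState.opField_derivWithin (hψ : IsVariationalFamily U ψ)
    (hH : IsProtocol H) (hx₀ : IsVariationalGroundState U ψ H x₀) {s : ℝ}
    (hs : s ∈ Set.Icc (0 : ℝ) 1) :
    opField ψ (derivWithin H (Set.Icc 0 1) s) (x₀ s)
      + fderiv ℝ (opField ψ (H s)) (x₀ s) (velocity x₀ s) = 0 := by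
  have h1 := hasDerivWithinAt_of_linear_left hψ.isOpen (contDiffOn_opField hψ) (opField_linear ψ)
    (hH.hasDerivWithinAt hs) (hx₀.hasDerivWithinAt hs) (hx₀.mem s hs)
  have h2 : HasDerivWithinAt (fun u => opField ψ (H u) (x₀ u)) 0 (Set.Icc 0 1) s :=
    (hasDerivWithinAt_const s (Set.Icc 0 1) (0 : Fin n → ℝ)).congr
      (fun t ht => hx₀.opField_eq_zero hψ hH ht) (hx₀.opField_eq_zero hψ hH hs)
  exact (uniqueDiffOn_Icc zero_lt_one s hs).eq_deriv _ h1 h2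

theorem contDiffOn_curve {F : Type*} [NormedAddCommGroup F] [NormedSpace ℝ F]
    (hH : IsProtocol H) (hx₀ : IsVariationalGroundState U ψ H x₀)
    {f : (𝓗 →L[ℂ] 𝓗) → (Fin n → ℝ) → F}
    (hf : ContDiffOn ℝ ∞ (fun p : (𝓗 →L[ℂ] 𝓗) × (Fin n → ℝ) => f p.1 p.2) (Set.univ ×ˢ U)) :
    ContDiffOn ℝ ∞ (fun s => f (H s) (x₀ s)) (Set.Icc 0 1) :=
  hf.comp (f := fun s => (H s, x₀ s)) (hH.smooth.prodMk hx₀.smooth)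
    fun s hs => ⟨trivial, hx₀.mem s hs⟩

/-- The energy is uniformly coercive around the curve of ground states. -/
theorem exists_energy_coercive (hψ : IsVariationalFamily U ψ) (hH : IsProtocol H)
    (hx₀ : IsVariationalGroundState U ψ H x₀)
    (hinj : ∀ s ∈ Set.Icc (0 : ℝ) 1, ∀ u, generator ψ H x₀ s *ᵥ u = 0 → u = 0) :
    ∃ r > 0, ∃ c > 0, ∀ s ∈ Set.Icc (0 : ℝ) 1, ∀ y, ‖y‖ ≤ r → x₀ s + y ∈ U ∧
      c * ‖y‖ ^ 2 ≤ opEnergy ψ (H s) (x₀ s + y) - opEnergy ψ (H s) (x₀ s) := by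
  obtain ⟨r, hr, htube⟩ := exists_tube hψ.isOpen hx₀.smooth.continuousOn hx₀.mem
  obtain ⟨C, hC⟩ := exists_tube_taylor_two hψ.isOpen (contDiffOn_opEnergy hψ)
    hH.smooth.continuousOn hx₀.smooth.continuousOn htube
  have hcomp : IsCompact (Set.Icc (0 : ℝ) 1 ×ˢ Metric.sphere (0 : Fin n → ℝ) 1) :=
    isCompact_Icc.prod (isCompact_sphere _ _)
  have hX : ContDiffOn ℝ ∞ (fun s => fderiv ℝ (opField ψ (H s)) (x₀ s)) (Set.Icc 0 1) :=
    contDiffOn_curve hH hx₀ (f := fun A => fderiv ℝ (opField ψ A))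
      (contDiffOn_fderiv_param hψ.isOpen (contDiffOn_opField hψ))
  have hcont : ContinuousOn (fun q : ℝ × (Fin n → ℝ) => -(q.2 ⬝ᵥ
      (symplecticMatrix ψ (x₀ q.1) *ᵥ fderiv ℝ (opField ψ (H q.1)) (x₀ q.1) q.2)))
      (Set.Icc (0 : ℝ) 1 ×ˢ Metric.sphere (0 : Fin n → ℝ) 1) := by
    have hmaps : Set.MapsTo Prod.fst (Set.Icc (0 : ℝ) 1 ×ˢ Metric.sphere (0 : Fin n → ℝ) 1)
      (Set.Icc (0 : ℝ) 1) := fun q hq => hq.1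
    simp only [dotProduct, Matrix.mulVec]
    refine (continuousOn_finsetSum _ fun μ _ => ContinuousOn.mul ?_
      (continuousOn_finsetSum _ fun ν _ => ContinuousOn.mul ?_ ?_)).neg
    · fun_prop
    · exact ((contDiffOn_symplecticMatrix hψ μ ν).continuousOn.comp hx₀.smooth.continuousOn
        hx₀.mem).comp continuousOn_fst hmaps
    · exact continuousOn_pi.1 ((hX.continuousOn.comp continuousOn_fst hmaps).clm_apply
        continuousOn_snd) ν
  -- The Hessian is positive at each `s` in each unit direction, and these pairs form a compact set.
  obtain ⟨c, hc, hcmin⟩ := exists_pos_le_of_isCompact hcomp hcont (by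
    rintro ⟨s, u⟩ ⟨hs, hu⟩
    have hu0 : u ≠ 0 := by
      rintro rfl
      simp at hu
    have := symplecticMatrix_fderiv_opField_neg hψ (hH.selfAdjoint s hs) (hx₀.mem s hs)
      (hx₀.minimal s hs) (fun u hu => hinj s hs u (by rw [generator_mulVec, hu])) hu0
    simpa using this)
  have hquad : ∀ s ∈ Set.Icc (0 : ℝ) 1, ∀ y : Fin n → ℝ, c * ‖y‖ ^ 2
      ≤ fderiv ℝ (fderiv ℝ (opEnergy ψ (H s))) (x₀ s) y y := by
    intro s hs y
    rw [fderiv_fderiv_opEnergy hψ (hH.selfAdjoint s hs) (hx₀.mem s hs) y y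
      (by simp [hx₀.opField_eq_zero hψ hH hs])]
    rcases eq_or_ne y 0 with rfl | hy
    · simp
    have hyn : ‖y‖ ≠ 0 := norm_ne_zero_iff.2 hy
    have h1 := hcmin (s, ‖y‖⁻¹ • y) ⟨hs, by simp [norm_smul, hyn]⟩
    simp only [map_smul, Matrix.mulVec_smul, smul_dotProduct, dotProduct_smul, smul_eq_mul] at h1
    have h2 : 0 < ‖y‖ ^ 2 := by positivity
    calc c * ‖y‖ ^ 2 ≤ -(‖y‖⁻¹ * (‖y‖⁻¹ * (y ⬝ᵥ (symplecticMatrix ψ (x₀ s) *ᵥ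
          fderiv ℝ (opField ψ (H s)) (x₀ s) y)))) * ‖y‖ ^ 2 := by gcongr
      _ = _ := by field_simp
  have hC0 : 0 ≤ |C| := abs_nonneg C
  -- In this radius the cubic remainder is at most `(c/4) ‖y‖²`, half of the `(c/2) ‖y‖²` that the
  -- Hessian provides.
  refine ⟨min r (c / (4 * (|C| + 1))), by positivity, c / 4, by positivity, fun s hs y hy => ?_⟩
  have hyr : ‖y‖ ≤ r := hy.trans (min_le_left _ _)
  have hyc : ‖y‖ * (4 * (|C| + 1)) ≤ c :=
    (le_div_iff₀ (by positivity)).1 (hy.trans (min_le_right _ _))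
  refine ⟨htube s hs y hyr, ?_⟩
  have h1 := hC s hs y hyr
  have hD : fderiv ℝ (opEnergy ψ (H s)) (x₀ s) y = 0 := by
    rw [fderiv_opEnergy hψ (hH.selfAdjoint s hs) (hx₀.mem s hs),
      hx₀.opField_eq_zero hψ hH hs]
    simp
  rw [hD, Real.norm_eq_abs, smul_eq_mul] at h1
  have h2 := (abs_le.1 h1).1
  have h3 := hquad s hs y
  have h4 : C * ‖y‖ ^ 3 ≤ c / 4 * ‖y‖ ^ 2 := by
    have h5 : C * ‖y‖ ≤ c / 4 := by nlinarith [le_abs_self C, norm_nonneg y]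
    calc C * ‖y‖ ^ 3 = C * ‖y‖ * ‖y‖ ^ 2 := by ring
      _ ≤ _ := by gcongr
  linarith

/-- Along a variational evolution the excess energy changes at the rate of the explicit time
dependence only. -/
theorem hasDerivWithinAt_excess_energy (hψ : IsVariationalFamily U ψ) (hH : IsProtocol H)
    (hx₀ : IsVariationalGroundState U ψ H x₀) {T : ℝ} {x : ℝ → Fin n → ℝ}
    (hx : IsVariationalEvolution U ψ H x₀ T x) {s : ℝ} (hs : s ∈ Set.Icc (0 : ℝ) 1) :
    HasDerivWithinAt (fun t => opEnergy ψ (H t) (x t) - opEnergy ψ (H t) (x₀ t))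
      (opEnergy ψ (derivWithin H (Set.Icc 0 1) s) (x s)
        - opEnergy ψ (derivWithin H (Set.Icc 0 1) s) (x₀ s)) (Set.Icc 0 1) s := by
  have h1 := hasDerivWithinAt_of_linear_left hψ.isOpen (contDiffOn_opEnergy hψ) (opEnergy_linear ψ)
    (hH.hasDerivWithinAt hs) (hx.ode s hs) (hx.mem s hs)
  have h2 := hasDerivWithinAt_of_linear_left hψ.isOpen (contDiffOn_opEnergy hψ) (opEnergy_linear ψ)
    (hH.hasDerivWithinAt hs) (hx₀.hasDerivWithinAt hs) (hx₀.mem s hs)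
  rw [fderiv_opEnergy hψ (hH.selfAdjoint s hs) (hx.mem s hs)] at h1
  rw [fderiv_opEnergy hψ (hH.selfAdjoint s hs) (hx₀.mem s hs), hx₀.opField_eq_zero hψ hH hs] at h2
  -- Conservation of energy: the field is paired with itself by an antisymmetric form.
  have h3 : (T • varField ψ H s (x s)) ⬝ᵥ (symplecticMatrix ψ (x s) *ᵥ opField ψ (H s) (x s))
      = 0 := by
    rw [smul_dotProduct]
    exact smul_eq_zero_of_right _ (dotProduct_symplecticMatrix_self ψ (x s) _)
  rw [h3] at h1
  exact (h1.fun_sub h2).congr_deriv (by simp)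

/-- The first order part of the rate of change of the excess energy is, up to quadratic terms, a
total derivative divided by `T`. -/
theorem excess_rate_eq (hψ : IsVariationalFamily U ψ) (hH : IsProtocol H)
    (hx₀ : IsVariationalGroundState U ψ H x₀) {s : ℝ} (hs : s ∈ Set.Icc (0 : ℝ) 1)
    (y : Fin n → ℝ) :
    fderiv ℝ (opEnergy ψ (derivWithin H (Set.Icc 0 1) s)) (x₀ s) y
      = -(fderiv ℝ (opField ψ (H s)) (x₀ s) y ⬝ᵥ
          (symplecticMatrix ψ (x₀ s) *ᵥ velocity x₀ s)) := by
  -- The differentiated equilibrium condition replaces the field of `dH/ds` by `-K (dx₀/ds)`; the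
  -- symmetry of `ωK` then moves `K` onto `y`.
  rw [fderiv_opEnergy hψ (hH.isSelfAdjoint_derivWithin hs) (hx₀.mem s hs),
    eq_neg_of_add_eq_zero_left (hx₀.opField_derivWithin hψ hH hs), Matrix.mulVec_neg,
    dotProduct_neg, neg_neg,
    symplecticMatrix_fderiv_opField_symm hψ (hH.selfAdjoint s hs) (hx₀.mem s hs)
      (by simp [hx₀.opField_eq_zero hψ hH hs]),
    dotProduct_symplecticMatrix_comm]

/-- The variational evolution stays `O(1/T)`-close to the curve of ground states, and does not
deviate from it at all if the ground state does not move. -/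
theorem exists_deviation_bound (hψ : IsVariationalFamily U ψ) (hH : IsProtocol H)
    (hx₀ : IsVariationalGroundState U ψ H x₀)
    (hinj : ∀ s ∈ Set.Icc (0 : ℝ) 1, ∀ u, generator ψ H x₀ s *ᵥ u = 0 → u = 0) :
    ∃ C T₀ : ℝ, 0 ≤ C ∧ 1 ≤ T₀ ∧ ((∀ s ∈ Set.Icc (0 : ℝ) 1, velocity x₀ s = 0) → C = 0) ∧
      ∀ T ≥ T₀, ∀ x, IsVariationalEvolution U ψ H x₀ T x →
        ∀ s ∈ Set.Icc (0 : ℝ) 1, ‖x s - x₀ s‖ ≤ C / T := by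
  obtain ⟨r, hr, c, hc, hcoer⟩ := exists_energy_coercive hψ hH hx₀ hinj
  have htube : ∀ s ∈ Set.Icc (0 : ℝ) 1, ∀ y, ‖y‖ ≤ r → x₀ s + y ∈ U :=
    fun s hs y hy => (hcoer s hs y hy).1
  obtain ⟨L, hL, hLzero, hLb⟩ := exists_momentum_bound hψ hx₀
  obtain ⟨C₁, hC₁⟩ := exists_tube_taylor_one hψ.isOpen (contDiffOn_opEnergy hψ)
    (hH.smooth.continuousOn_derivWithin (uniqueDiffOn_Icc zero_lt_one) (by simp))
    hx₀.smooth.continuousOn htube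
  obtain ⟨C₂, hC₂⟩ := exists_tube_taylor_one hψ.isOpen (contDiffOn_opField hψ)
    hH.smooth.continuousOn hx₀.smooth.continuousOn htube
  set β : ℝ → Fin n → ℝ := fun s => symplecticMatrix ψ (x₀ s) *ᵥ velocity x₀ s with hβ
  -- Two quadratic errors: `C₁` from linearizing the energy rate, and `L * |C₂|` from replacing `Ky`
  -- by the field in the pairing with `β`.
  set C : ℝ := |C₁| + L * |C₂| with hC
  set D : ℝ := √(2 / c ^ 2 * Real.exp (2 * C / c + 1)) with hD
  have hD0 : 0 ≤ D := Real.sqrt_nonneg _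
  -- Beyond this time the resulting bound `D L / T` is smaller than the radius `r`, which makes the
  -- estimate self-improving.
  refine ⟨D * L, D * L / r + 1, by positivity, by linarith [show 0 ≤ D * L / r by positivity],
    fun h => by simp [hLzero h], fun T hT x hx => ?_⟩
  have hT0 : 0 < T := by linarith [show 0 ≤ D * L / r by positivity]
  have hTr : D * L / T < r := by
    rw [div_lt_iff₀ hT0]
    have : D * L / r < T := by linarith
    rw [div_lt_iff₀ hr] at this
    linarith
  set y : ℝ → Fin n → ℝ := fun s => x s - x₀ s with hy
  have hxy : ∀ s, x s = x₀ s + y s := fun s => by simp [hy]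
  have hyd : ∀ s ∈ Set.Icc (0 : ℝ) 1, HasDerivWithinAt y
      (T • opField ψ (H s) (x s) - velocity x₀ s) (Set.Icc 0 1) s := fun s hs =>
    (hx.ode s hs).sub (hx₀.hasDerivWithinAt hs)
  -- The derivative of the corrector `y·β / T` contains `X·β`, which cancels `-(Ky)·β` in the energy
  -- rate up to quadratic terms. The corrector itself costs only `(L/T) ‖y‖`.
  set m : ℝ → ℝ := fun s => opEnergy ψ (H s) (x s) - opEnergy ψ (H s) (x₀ s)
    + T⁻¹ * (y s ⬝ᵥ β s) with hm
  have hmd : ∀ s ∈ Set.Icc (0 : ℝ) 1, HasDerivWithinAt m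
      (opEnergy ψ (derivWithin H (Set.Icc 0 1) s) (x s)
        - opEnergy ψ (derivWithin H (Set.Icc 0 1) s) (x₀ s)
        + T⁻¹ * ((T • opField ψ (H s) (x s) - velocity x₀ s) ⬝ᵥ β s
          + y s ⬝ᵥ derivWithin β (Set.Icc 0 1) s)) (Set.Icc 0 1) s := fun s hs =>
    (hasDerivWithinAt_excess_energy hψ hH hx₀ hx hs).add
      ((hasDerivWithinAt_dotProduct (hyd s hs)
        ((contDiffOn_symplecticMatrix_mulVec_velocity hψ hx₀).differentiableOn (by simp) s
          hs).hasDerivWithinAt).const_mul _)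
  have key : ∀ t ∈ Set.Icc (0 : ℝ) 1, (∀ u ∈ Set.Icc 0 t, ‖y u‖ ≤ r) →
      ∀ u ∈ Set.Icc 0 t, ‖y u‖ ≤ D * (L / T) := by
    intro t ht hyr
    have hsub : Set.Icc 0 t ⊆ Set.Icc (0 : ℝ) 1 := Set.Icc_subset_Icc_right ht.2
    refine norm_le_of_energy_estimate (m := m) hc (by positivity) (by positivity) ht.2
      (fun s hs => (hmd s (hsub hs)).mono hsub) (by simp [hm, hy, hx.initial]) ?_ ?_
    · intro s hs
      have h1 := (hcoer s (hsub hs) (y s) (hyr s hs)).2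
      rw [← hxy] at h1
      have h2 := (abs_le.1 (hLb s (hsub hs) (y s)).1).1
      have h3 : -(L / T * ‖y s‖) ≤ T⁻¹ * (y s ⬝ᵥ β s) := by
        calc -(L / T * ‖y s‖) = T⁻¹ * -(L * ‖y s‖) := by ring
          _ ≤ _ := by gcongr
      simp only [hm]
      linarith
    · intro s hs
      have hs' := hsub hs
      have h1 := hC₁ s hs' (y s) (hyr s hs)
      have h2 := hC₂ s hs' (y s) (hyr s hs)
      rw [← hxy, hx₀.opField_eq_zero hψ hH hs', sub_zero] at h2
      rw [← hxy, excess_rate_eq hψ hH hx₀ hs', Real.norm_eq_abs] at h1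
      have h3 := (hLb s hs' (opField ψ (H s) (x s)
        - fderiv ℝ (opField ψ (H s)) (x₀ s) (y s))).1
      have h4 := (hLb s hs' (y s)).2
      -- By antisymmetry the corrector leaves no term of order `1/T` without a factor `y`; such a
      -- term would only give `‖y‖ = O(T^(-1/2))`.
      have h5 : velocity x₀ s ⬝ᵥ β s = 0 := dotProduct_symplecticMatrix_self ψ _ _
      rw [sub_dotProduct, smul_dotProduct, h5, sub_zero, smul_eq_mul, mul_add, ← mul_assoc,
        inv_mul_cancel₀ hT0.ne', one_mul]
      rw [sub_dotProduct] at h3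
      have h6 : T⁻¹ * (y s ⬝ᵥ derivWithin β (Set.Icc 0 1) s) ≤ L / T * ‖y s‖ := by
        calc _ ≤ T⁻¹ * (L * ‖y s‖) := by gcongr; exact (abs_le.1 h4).2
          _ = _ := by ring
      have h7 := (abs_le.1 h1).2
      have h8 := (abs_le.1 h3).2
      have h9 : L * ‖opField ψ (H s) (x s) - fderiv ℝ (opField ψ (H s)) (x₀ s) (y s)‖
          ≤ L * |C₂| * ‖y s‖ ^ 2 := by
        rw [mul_assoc]
        gcongr
        exact h2.trans (by gcongr; exact le_abs_self _)
      have h10 : C₁ * ‖y s‖ ^ 2 ≤ |C₁| * ‖y s‖ ^ 2 := by gcongr; exact le_abs_self _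
      rw [hC, add_mul]
      linarith
  have hlt := lt_of_self_improving (f := fun s => ‖y s‖) (r := r)
    (fun s hs => (hyd s hs).continuousWithinAt.norm) (by simpa [hy, hx.initial] using hr)
    (fun t ht hle => (key t ht hle t ⟨ht.1, le_rfl⟩).trans_lt (by rwa [← mul_div_assoc]))
  intro s hs
  rw [mul_div_assoc]
  exact key 1 (by simp) (fun u hu => (hlt u hu).le) s hs

end Energy

/-! ### Averaging: normal form of the mode equations. -/

section NormalForm

open Asymptotics Filter

/-- Complex primitives on `[0,1]`. -/
theorem exists_primitive {f : ℝ → ℂ} (hf : ContinuousOn f (Set.Icc 0 1)) :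
    ∃ F : ℝ → ℂ, F 0 = 0 ∧ (∀ s ∈ Set.Icc (0 : ℝ) 1, HasDerivWithinAt F (f s) (Set.Icc 0 1) s) ∧
      ∀ s ∈ Set.Icc (0 : ℝ) 1, (F s).re = ∫ t in (0 : ℝ)..s, (f t).re := by
  have hint : ∀ s ∈ Set.Icc (0 : ℝ) 1, IntervalIntegrable f MeasureTheory.volume 0 s := by
    intro s hs
    refine ContinuousOn.intervalIntegrable (hf.mono ?_)
    rw [Set.uIcc_of_le hs.1]
    exact Set.Icc_subset_Icc_right hs.2
  refine ⟨fun s => ∫ t in (0 : ℝ)..s, f t, by simp, fun s hs => ?_, fun s hs => ?_⟩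
  · have : Fact (s ∈ Set.Icc (0 : ℝ) 1) := ⟨hs⟩
    exact intervalIntegral.integral_hasDerivWithinAt_right (hint s hs)
      (hf.stronglyMeasurableAtFilter_nhdsWithin measurableSet_Icc s) (hf s hs)
  · have := Complex.reCLM.intervalIntegral_comp_comm (hint s hs)
    simpa using this.symm

/-- Grönwall's inequality for the norm of a vector valued function on `[0,1]`. -/
theorem norm_le_exp_of_norm_deriv_le {E : Type*} [NormedAddCommGroup E] [NormedSpace ℝ E]
    {f f' : ℝ → E} {δ K ε : ℝ}
    (hf : ∀ s ∈ Set.Icc (0 : ℝ) 1, HasDerivWithinAt f (f' s) (Set.Icc 0 1) s) (h0 : ‖f 0‖ ≤ δ)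
    (hε : 0 ≤ ε) (hK : 1 ≤ K)
    (hbound : ∀ s ∈ Set.Icc (0 : ℝ) 1, ‖f' s‖ ≤ K * ‖f s‖ + ε) :
    ∀ s ∈ Set.Icc (0 : ℝ) 1, ‖f s‖ ≤ (δ + ε) * Real.exp K := by
  intro s hs
  have hδ : 0 ≤ δ := (norm_nonneg _).trans h0
  have h := norm_le_gronwallBound_of_norm_deriv_right_le (f := f) (f' := f') (δ := δ) (K := K)
    (ε := ε) (a := 0) (b := 1) (fun s hs => (hf s hs).continuousWithinAt)
    (fun x hx => (hf x ⟨hx.1, hx.2.le⟩).mono_of_mem_nhdsWithin (Icc_mem_nhdsGE_of_mem hx)) h0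
    (fun x hx => hbound x ⟨hx.1, hx.2.le⟩) s hs
  exact h.trans (gronwallBound_le hδ hε hK hs.2)

variable {n : ℕ}

theorem contDiffOn_dotProduct {u v : ℝ → Fin n → ℂ} {S : Set ℝ}
    (hu : ∀ i, ContDiffOn ℝ ∞ (fun s => u s i) S) (hv : ∀ i, ContDiffOn ℝ ∞ (fun s => v s i) S) :
    ContDiffOn ℝ ∞ (fun s => u s ⬝ᵥ v s) S :=
  ContDiffOn.sum fun i _ => (hu i).mul (hv i)

theorem contDiffOn_mulVec {q : ℝ → Matrix (Fin n) (Fin n) ℂ} {v : ℝ → Fin n → ℂ} {S : Set ℝ}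
    (hq : ∀ i j, ContDiffOn ℝ ∞ (fun s => q s i j) S)
    (hv : ∀ i, ContDiffOn ℝ ∞ (fun s => v s i) S) (i : Fin n) :
    ContDiffOn ℝ ∞ (fun s => (q s *ᵥ v s) i) S :=
  contDiffOn_dotProduct (hq i) hv

theorem hasDerivWithinAt_dotProduct_complex {u v : ℝ → Fin n → ℂ} {u' v' : Fin n → ℂ} {S : Set ℝ}
    {s : ℝ} (hu : ∀ i, HasDerivWithinAt (fun t => u t i) (u' i) S s)
    (hv : ∀ i, HasDerivWithinAt (fun t => v t i) (v' i) S s) :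
    HasDerivWithinAt (fun t => u t ⬝ᵥ v t) (u' ⬝ᵥ v s + u s ⬝ᵥ v') S s := by
  simp only [dotProduct, ← Finset.sum_add_distrib]
  exact HasDerivWithinAt.fun_sum fun i _ => (hu i).mul (hv i)

theorem hasDerivWithinAt_quadratic {e : ℝ → Fin n → ℂ} {q : ℝ → Matrix (Fin n) (Fin n) ℂ}
    {e' : Fin n → ℂ} {q' : Matrix (Fin n) (Fin n) ℂ} {S : Set ℝ} {s : ℝ}
    (he : ∀ i, HasDerivWithinAt (fun t => e t i) (e' i) S s)
    (hq : ∀ i j, HasDerivWithinAt (fun t => q t i j) (q' i j) S s) :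
    HasDerivWithinAt (fun t => e t ⬝ᵥ (q t *ᵥ e t))
      (e' ⬝ᵥ (q s *ᵥ e s) + e s ⬝ᵥ (q' *ᵥ e s + q s *ᵥ e')) S s :=
  hasDerivWithinAt_dotProduct_complex he fun i =>
    hasDerivWithinAt_dotProduct_complex (hq i) he

theorem isBigO_dotProduct {α : Type*} {l : Filter α} {u v : α → Fin n → ℂ} {f g : α → ℝ}
    (hu : ∀ i, (fun x => u x i) =O[l] f) (hv : ∀ i, (fun x => v x i) =O[l] g) :
    (fun x => u x ⬝ᵥ v x) =O[l] fun x => f x * g x :=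
  IsBigO.fun_sum fun i _ => (hu i).mul (hv i)

theorem isBigO_mulVec {α : Type*} {l : Filter α} {q : α → Matrix (Fin n) (Fin n) ℂ}
    {v : α → Fin n → ℂ} {f g : α → ℝ} (hq : ∀ i j, (fun x => q x i j) =O[l] f)
    (hv : ∀ i, (fun x => v x i) =O[l] g) (i : Fin n) :
    (fun x => (q x *ᵥ v x) i) =O[l] fun x => f x * g x :=
  isBigO_dotProduct (hq i) hv

/-- The displacement (times `T`) of the quasi-equilibrium in the eigenframe. -/
noncomputable def equilibriumShift (w : Fin n → ℝ → ℝ) (b : ℝ → Fin n → ℂ) (s : ℝ) : Fin n → ℂ :=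
  fun i => Complex.I * b s i / w i s

/-- The couplings of the deviation from the quasi-equilibrium. -/
noncomputable def shiftedCoupling (w : Fin n → ℝ → ℝ) (b : ℝ → Fin n → ℂ)
    (B : Fin n → ℝ → Fin n → ℂ) (Q : Fin n → ℝ → Matrix (Fin n) (Fin n) ℂ) (i : Fin n) (s : ℝ) :
    Fin n → ℂ :=
  B i s + (Q i s *ᵥ equilibriumShift w b s + equilibriumShift w b s ᵥ* Q i s)

theorem contDiffOn_div_real {f : ℝ → ℂ} {g : ℝ → ℝ} {S : Set ℝ} (hf : ContDiffOn ℝ ∞ f S)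
    (hg : ContDiffOn ℝ ∞ g S) (h0 : ∀ s ∈ S, g s ≠ 0) :
    ContDiffOn ℝ ∞ (fun s => f s / (g s : ℂ)) S := by
  simp only [div_eq_mul_inv]
  exact hf.mul ((Complex.ofRealCLM.contDiff.comp_contDiffOn hg).inv fun s hs =>
    Complex.ofReal_ne_zero.2 (h0 s hs))

theorem contDiffOn_equilibriumShift {w : Fin n → ℝ → ℝ} {b : ℝ → Fin n → ℂ}
    (hw : ∀ i, ContDiffOn ℝ ∞ (w i) (Set.Icc 0 1))
    (hb : ∀ i, ContDiffOn ℝ ∞ (fun s => b s i) (Set.Icc 0 1))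
    (hw0 : ∀ s ∈ Set.Icc (0 : ℝ) 1, ∀ i, w i s ≠ 0) (i : Fin n) :
    ContDiffOn ℝ ∞ (fun s => equilibriumShift w b s i) (Set.Icc 0 1) :=
  contDiffOn_div_real (contDiffOn_const.mul (hb i)) (hw i) fun s hs => hw0 s hs i

/-- Homological equation for the linear couplings: the term `N·e` rotates at `w_k` relative to the
mode at `w_i`, and the mismatch compensates `m_k`. The entry `k = i` is resonant and stays. -/
theorem dotProduct_detuning {m N e : Fin n → ℂ} {w : Fin n → ℝ} (i : Fin n) (hN : N i = 0)
    (h : ∀ k, k ≠ i → m k + Complex.I * (w i - w k) * N k = 0) :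
    m ⬝ᵥ e - m i * e i + Complex.I * w i * (N ⬝ᵥ e)
      - Complex.I * (N ⬝ᵥ fun k => w k * e k) = 0 := by
  have h1 : m i * e i = ∑ k, if k = i then m k * e k else 0 := by simp
  rw [h1]
  simp only [dotProduct, Finset.mul_sum, ← Finset.sum_sub_distrib, ← Finset.sum_add_distrib]
  refine Finset.sum_eq_zero fun k _ => ?_
  split_ifs with hk
  · subst hk
    rw [hN]
    ring
  · linear_combination e k * h k hk

/-- The same for quadratic terms, with mismatch `w_i - w_j - w_k`. Stated as an equation rather than
with a quotient, it holds for `q = r = 0` without any nonresonance, as the linearized problem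
requires. -/
theorem quadratic_detuning {q r : Matrix (Fin n) (Fin n) ℂ} {e : Fin n → ℂ} {w : Fin n → ℝ}
    (i : Fin n) (h : ∀ j k, q j k + Complex.I * (w i - w j - w k) * r j k = 0) :
    e ⬝ᵥ (q *ᵥ e) + Complex.I * w i * (e ⬝ᵥ (r *ᵥ e))
      - Complex.I * ((fun k => w k * e k) ⬝ᵥ (r *ᵥ e) + e ⬝ᵥ (r *ᵥ fun k => w k * e k)) = 0 := by
  simp only [dotProduct, Matrix.mulVec, Finset.mul_sum, ← Finset.sum_sub_distrib,
    ← Finset.sum_add_distrib]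
  refine Finset.sum_eq_zero fun j _ => Finset.sum_eq_zero fun k _ => ?_
  linear_combination e j * e k * h j k

/-- Completing the shift to the quasi-equilibrium in the equation of motion. -/
theorem shifted_rhs_eq {T : ℝ} (hT : T ≠ 0) {w : ℝ} (hw : w ≠ 0) {ci bi pi pd ρ : ℂ}
    {B c p e : Fin n → ℂ} {q : Matrix (Fin n) (Fin n) ℂ} (hpi : pi = Complex.I * bi / w)
    {ei : ℂ} (hei : ei = ci - pi / T) (he : e = c - (T : ℂ)⁻¹ • p) :
    -(Complex.I * T * w) * ci - bi + B ⬝ᵥ c + T * (c ⬝ᵥ (q *ᵥ c)) + ρ - pd / T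
      = -(Complex.I * T * w) * ei + ((B ⬝ᵥ p - pd + p ⬝ᵥ (q *ᵥ p)) / T
        + (B + (q *ᵥ p + p ᵥ* q)) ⬝ᵥ e + T * (e ⬝ᵥ (q *ᵥ e)) + ρ) := by
  have hT' : (T : ℂ) ≠ 0 := Complex.ofReal_ne_zero.2 hT
  have hw' : (w : ℂ) ≠ 0 := Complex.ofReal_ne_zero.2 hw
  have hc : c = e + (T : ℂ)⁻¹ • p := by simp [he]
  have hci : ci = ei + pi / T := by rw [hei]; ring
  have hswap : (q *ᵥ p + p ᵥ* q) ⬝ᵥ e = e ⬝ᵥ (q *ᵥ p) + p ⬝ᵥ (q *ᵥ e) := by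
    rw [add_dotProduct, dotProduct_comm (q *ᵥ p), Matrix.dotProduct_mulVec p]
  rw [add_dotProduct B, hswap, hc, hci, hpi]
  simp only [dotProduct_add, add_dotProduct, Matrix.mulVec_add, Matrix.mulVec_smul,
    dotProduct_smul, smul_dotProduct, smul_eq_mul]
  field_simp
  linear_combination (-bi * T) * Complex.I_sq

/-- The algebra of the change of variables. Writing `e' = -iTw e + σ`, the fast part of `e'` in the
correction terms cancels the forcing `f/T`, the off-diagonal `m` and the quadratic term by the three
homological equations. The last bracket collects what is left: the error `ρ`, derivatives of
coefficients, `σ` in place of `e'`, and `m_i` times the correction. -/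
theorem normal_form_rhs_eq {T : ℝ} (hT : T ≠ 0) {w : Fin n → ℝ} (i : Fin n)
    {e e' σ m N Nd : Fin n → ℂ} {q r rd : Matrix (Fin n) (Fin n) ℂ} {f φ φd ρ : ℂ}
    (hφ : f + Complex.I * w i * φ = 0) (hN : N i = 0)
    (hNk : ∀ k, k ≠ i → m k + Complex.I * (w i - w k) * N k = 0)
    (hr : ∀ j k, q j k + Complex.I * (w i - w j - w k) * r j k = 0)
    (he' : ∀ k, e' k = -(Complex.I * T * w k) * e k + σ k)
    (hσ : σ i = f / T + m ⬝ᵥ e + T * (e ⬝ᵥ (q *ᵥ e)) + ρ) :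
    e' i + φd / T ^ 2 + (T : ℂ)⁻¹ * (Nd ⬝ᵥ e + N ⬝ᵥ e')
        + (e' ⬝ᵥ (r *ᵥ e) + e ⬝ᵥ (rd *ᵥ e + r *ᵥ e'))
      = (-(Complex.I * T * w i) + m i)
          * (e i + φ / T ^ 2 + (T : ℂ)⁻¹ * (N ⬝ᵥ e) + e ⬝ᵥ (r *ᵥ e))
        + (ρ + φd / T ^ 2 + (T : ℂ)⁻¹ * (Nd ⬝ᵥ e + N ⬝ᵥ σ)
          + (σ ⬝ᵥ (r *ᵥ e) + e ⬝ᵥ (rd *ᵥ e + r *ᵥ σ))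
          - m i * (φ / T ^ 2 + (T : ℂ)⁻¹ * (N ⬝ᵥ e) + e ⬝ᵥ (r *ᵥ e))) := by
  have hT' : (T : ℂ) ≠ 0 := Complex.ofReal_ne_zero.2 hT
  have h1 := dotProduct_detuning (e := e) i hN hNk
  have h2 := quadratic_detuning (e := e) i hr
  have h3 : e' = (-(Complex.I * T)) • (fun k => w k * e k) + σ := by
    ext k
    rw [he' k]
    simp
    ring
  rw [he' i, hσ, h3]
  simp only [dotProduct_add, add_dotProduct, Matrix.mulVec_add, Matrix.mulVec_smul,
    dotProduct_smul, smul_dotProduct, smul_eq_mul]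
  have h4 : (T : ℂ)⁻¹ * (-(Complex.I * T) * (N ⬝ᵥ fun k => w k * e k))
      = -(Complex.I * (N ⬝ᵥ fun k => w k * e k)) := by field_simp
  have h5 : -(Complex.I * T * w i) * ((T : ℂ)⁻¹ * (N ⬝ᵥ e))
      = -(Complex.I * w i * (N ⬝ᵥ e)) := by field_simp
  have h6 : -(Complex.I * T * w i) * (φ / T ^ 2) = -(Complex.I * w i * φ) / T := by field_simp
  simp only [mul_add, add_mul] at *
  linear_combination h1 + T * h2 + hφ / T + h4 - h5 - h6

/-- For `e = O(1/T)` the term `T e·Qe` is again `O(1/T)`, so everything except the fast rotation has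
this size. -/
theorem isBigO_shifted_rhs {α : Type*} {l : Filter α} {T : α → ℝ} (hT : ∀ᶠ x in l, T x ≠ 0)
    {e m : α → Fin n → ℂ} {q : α → Matrix (Fin n) (Fin n) ℂ} {f ρ : α → ℂ}
    (he : ∀ k, (fun x => e x k) =O[l] fun x => (T x)⁻¹)
    (hm : ∀ k, (fun x => m x k) =O[l] fun _ => (1 : ℝ))
    (hq : ∀ j k, (fun x => q x j k) =O[l] fun _ => (1 : ℝ))
    (hf : f =O[l] fun _ => (1 : ℝ)) (hρ : ρ =O[l] fun x => (T x)⁻¹) :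
    (fun x => f x / T x + m x ⬝ᵥ e x + T x * (e x ⬝ᵥ (q x *ᵥ e x)) + ρ x)
      =O[l] fun x => (T x)⁻¹ := by
  have hTi : (fun x => ((T x : ℂ))⁻¹) =O[l] fun x => (T x)⁻¹ :=
    IsBigO.of_bound 1 (Eventually.of_forall fun x => by simp)
  have hTT : (fun x => (T x : ℂ)) =O[l] T :=
    IsBigO.of_bound 1 (Eventually.of_forall fun x => by simp)
  refine ((IsBigO.add ?_ ?_).add ?_).add hρ
  · simpa only [div_eq_mul_inv, one_mul] using hf.mul hTi
  · simpa only [one_mul] using isBigO_dotProduct hm he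
  · refine (hTT.mul (isBigO_dotProduct he (isBigO_mulVec hq he))).congr' EventuallyEq.rfl ?_
    filter_upwards [hT] with x hx
    field_simp

/-- The change of variables differs from the identity by `O(1/T²)`, so it may be undone at both ends
of the time interval. -/
theorem isBigO_correction {α : Type*} {l : Filter α} {T : α → ℝ}
    {e N : α → Fin n → ℂ} {r : α → Matrix (Fin n) (Fin n) ℂ} {φ : α → ℂ}
    (he : ∀ k, (fun x => e x k) =O[l] fun x => (T x)⁻¹)
    (hN : ∀ k, (fun x => N x k) =O[l] fun _ => (1 : ℝ))
    (hr : ∀ j k, (fun x => r x j k) =O[l] fun _ => (1 : ℝ))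
    (hφ : φ =O[l] fun _ => (1 : ℝ)) :
    (fun x => φ x / T x ^ 2 + (T x : ℂ)⁻¹ * (N x ⬝ᵥ e x) + e x ⬝ᵥ (r x *ᵥ e x))
      =O[l] fun x => ((T x)⁻¹) ^ 2 := by
  have hTi : (fun x => ((T x : ℂ))⁻¹) =O[l] fun x => (T x)⁻¹ :=
    IsBigO.of_bound 1 (Eventually.of_forall fun x => by simp)
  refine (IsBigO.add ?_ ?_).add ?_
  · simpa only [div_eq_mul_inv, one_mul, inv_pow] using hφ.mul (hTi.pow 2)
  · simpa only [one_mul, ← sq] using hTi.mul (isBigO_dotProduct hN he)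
  · simpa only [one_mul, ← sq] using isBigO_dotProduct he (isBigO_mulVec hr he)

theorem isBigO_remainder {α : Type*} {l : Filter α} {T : α → ℝ}
    {e σ N Nd : α → Fin n → ℂ} {r rd : α → Matrix (Fin n) (Fin n) ℂ} {mi φ φd ρ : α → ℂ}
    (he : ∀ k, (fun x => e x k) =O[l] fun x => (T x)⁻¹)
    (hσ : ∀ k, (fun x => σ x k) =O[l] fun x => (T x)⁻¹)
    (hN : ∀ k, (fun x => N x k) =O[l] fun _ => (1 : ℝ))
    (hNd : ∀ k, (fun x => Nd x k) =O[l] fun _ => (1 : ℝ))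
    (hr : ∀ j k, (fun x => r x j k) =O[l] fun _ => (1 : ℝ))
    (hrd : ∀ j k, (fun x => rd x j k) =O[l] fun _ => (1 : ℝ))
    (hφ : φ =O[l] fun _ => (1 : ℝ)) (hφd : φd =O[l] fun _ => (1 : ℝ))
    (hmi : mi =O[l] fun _ => (1 : ℝ)) (hρ : ρ =O[l] fun x => ((T x)⁻¹) ^ 2) :
    (fun x => ρ x + φd x / T x ^ 2 + (T x : ℂ)⁻¹ * (Nd x ⬝ᵥ e x + N x ⬝ᵥ σ x)
        + (σ x ⬝ᵥ (r x *ᵥ e x) + e x ⬝ᵥ (rd x *ᵥ e x + r x *ᵥ σ x))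
        - mi x * (φ x / T x ^ 2 + (T x : ℂ)⁻¹ * (N x ⬝ᵥ e x) + e x ⬝ᵥ (r x *ᵥ e x)))
      =O[l] fun x => ((T x)⁻¹) ^ 2 := by
  have hTi : (fun x => ((T x : ℂ))⁻¹) =O[l] fun x => (T x)⁻¹ :=
    IsBigO.of_bound 1 (Eventually.of_forall fun x => by simp)
  refine (((hρ.add ?_).add ?_).add (IsBigO.add ?_ ?_)).sub ?_
  · simpa only [div_eq_mul_inv, one_mul, inv_pow] using hφd.mul (hTi.pow 2)
  · simpa only [one_mul, ← sq] using
      hTi.mul ((isBigO_dotProduct hNd he).add (isBigO_dotProduct hN hσ))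
  · simpa only [one_mul, ← sq] using isBigO_dotProduct hσ (isBigO_mulVec hr he)
  · simpa only [one_mul, ← sq] using isBigO_dotProduct
      (v := fun x => rd x *ᵥ e x + r x *ᵥ σ x) he
      fun i => (isBigO_mulVec hrd he i).add (isBigO_mulVec hr hσ i)
  · simpa only [one_mul] using hmi.mul (isBigO_correction he hN hr hφ)

/-- The amplitudes `c` of a deviation in the eigenframe: they solve the equation of motion with
frequencies `w`, drive `b`, couplings `B`, quadratic terms `Q` and an error term `ρ`. -/
structure IsModeEvolution (w : Fin n → ℝ → ℝ) (b : ℝ → Fin n → ℂ) (B : Fin n → ℝ → Fin n → ℂ)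
    (Q : Fin n → ℝ → Matrix (Fin n) (Fin n) ℂ) (T : ℝ) (c ρ : ℝ → Fin n → ℂ) : Prop where
  initial : c 0 = 0
  ode : ∀ s ∈ Set.Icc (0 : ℝ) 1, ∀ i, HasDerivWithinAt (fun t => c t i)
    (-(Complex.I * T * w i s) * c s i - b s i + B i s ⬝ᵥ c s + T * (c s ⬝ᵥ (Q i s *ᵥ c s)) + ρ s i)
    (Set.Icc 0 1) s

/-- The solution of a scalar linear equation with a small inhomogeneity. -/
theorem exists_propagator_bound {z z' f : ℝ → ℂ} {D ε : ℝ}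
    (hf : ContinuousOn f (Set.Icc 0 1))
    (hz : ∀ s ∈ Set.Icc (0 : ℝ) 1, HasDerivWithinAt z (z' s) (Set.Icc 0 1) s)
    (hD : ∀ s ∈ Set.Icc (0 : ℝ) 1, |∫ t in (0 : ℝ)..s, (f t).re| ≤ D)
    (hε : ∀ s ∈ Set.Icc (0 : ℝ) 1, ‖z' s - f s * z s‖ ≤ ε) :
    ∀ s ∈ Set.Icc (0 : ℝ) 1, ∃ u : ℂ, ‖u‖ = Real.exp (∫ t in (0 : ℝ)..s, (f t).re) ∧
      ‖z s - u * z 0‖ ≤ Real.exp D * Real.exp D * ε := by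
  obtain ⟨F, hF0, hFd, hFre⟩ := exists_primitive hf
  intro s hs
  have hε0 : 0 ≤ ε := (norm_nonneg _).trans (hε s hs)
  -- Integrating factor. Only the real part of `f` enters its modulus, so an imaginary part of size
  -- `T` does no harm.
  have hζ : ∀ t ∈ Set.Icc (0 : ℝ) 1, HasDerivWithinAt (fun t => Complex.exp (-F t) * z t)
      (Complex.exp (-F t) * (z' t - f t * z t)) (Set.Icc 0 1) t := by
    intro t ht
    exact ((((hFd t ht).neg).cexp).mul (hz t ht)).congr_deriv (by simp only [Pi.neg_apply]; ring)
  have hbd : ∀ t ∈ Set.Icc (0 : ℝ) 1,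
      ‖Complex.exp (-F t) * (z' t - f t * z t)‖ ≤ Real.exp D * ε := by
    intro t ht
    rw [norm_mul, Complex.norm_exp, Complex.neg_re, hFre t ht]
    gcongr
    · exact (neg_le_abs _).trans (hD t ht)
    · exact hε t ht
  have hmv := (convex_Icc (0 : ℝ) 1).norm_image_sub_le_of_norm_hasDerivWithin_le hζ hbd
    (by simp : (0 : ℝ) ∈ Set.Icc (0 : ℝ) 1) hs
  refine ⟨Complex.exp (F s), by rw [Complex.norm_exp, hFre s hs], ?_⟩
  have h1 : z s - Complex.exp (F s) * z 0
      = Complex.exp (F s) * (Complex.exp (-F s) * z s - Complex.exp (-F 0) * z 0) := by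
    rw [hF0, mul_sub, ← mul_assoc, ← Complex.exp_add]
    simp
  rw [h1, norm_mul, Complex.norm_exp, hFre s hs, mul_assoc]
  gcongr
  · exact (le_abs_self _).trans (hD s hs)
  · refine hmv.trans ?_
    have : ‖s - 0‖ ≤ 1 := by
      rw [sub_zero, Real.norm_of_nonneg hs.1]
      exact hs.2
    exact mul_le_of_le_one_right (by positivity) this

theorem isBigO_one_of_continuousOn {F : Type*} [NormedAddCommGroup F] [NormedSpace ℝ F]
    {α : Type*} {l : Filter α} {τ : α → ℝ} (hτ : ∀ᶠ x in l, τ x ∈ Set.Icc (0 : ℝ) 1) {f : ℝ → F}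
    (hf : ContinuousOn f (Set.Icc 0 1)) : (fun x => f (τ x)) =O[l] fun _ => (1 : ℝ) := by
  obtain ⟨C, hC⟩ := isCompact_Icc.exists_bound_of_continuousOn hf
  refine IsBigO.of_bound C ?_
  filter_upwards [hτ] with x hx
  simpa using hC _ hx

set_option maxHeartbeats 1000000 in
/-- Averaging: if there are no resonances of first and second order, then the amplitudes of a
deviation of order `1/T` consist, up to `O(1/T²)`, of the displacement of the quasi-equilibrium and
a free oscillation around it. -/
theorem exists_normal_form_bound {w : Fin n → ℝ → ℝ} {b : ℝ → Fin n → ℂ}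
    {B : Fin n → ℝ → Fin n → ℂ} {Q R : Fin n → ℝ → Matrix (Fin n) (Fin n) ℂ}
    (hw : ∀ i, ContDiffOn ℝ ∞ (w i) (Set.Icc 0 1))
    (hb : ∀ i, ContDiffOn ℝ ∞ (fun s => b s i) (Set.Icc 0 1))
    (hB : ∀ i k, ContDiffOn ℝ ∞ (fun s => B i s k) (Set.Icc 0 1))
    (hQ : ∀ i j k, ContDiffOn ℝ ∞ (fun s => Q i s j k) (Set.Icc 0 1))
    (hR : ∀ i j k, ContDiffOn ℝ ∞ (fun s => R i s j k) (Set.Icc 0 1))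
    (hw0 : ∀ s ∈ Set.Icc (0 : ℝ) 1, ∀ i, w i s ≠ 0)
    (hgap : ∀ s ∈ Set.Icc (0 : ℝ) 1, ∀ i j, i ≠ j → w i s ≠ w j s)
    (hres : ∀ s ∈ Set.Icc (0 : ℝ) 1, ∀ i j k,
      Q i s j k + Complex.I * (w i s - w j s - w k s) * R i s j k = 0) (A : ℝ) :
    ∃ C, ∀ T ≥ 1, ∀ c ρ : ℝ → Fin n → ℂ, IsModeEvolution w b B Q T c ρ →
      (∀ s ∈ Set.Icc (0 : ℝ) 1, ∀ i, ‖c s i‖ ≤ A / T) →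
      (∀ s ∈ Set.Icc (0 : ℝ) 1, ∀ i, ‖ρ s i‖ ≤ A / T ^ 2) →
      ∀ i, ∀ s ∈ Set.Icc (0 : ℝ) 1, ∃ u : ℂ,
        ‖u‖ = Real.exp (∫ t in (0 : ℝ)..s, (shiftedCoupling w b B Q i t i).re) ∧
        ‖c s i - (equilibriumShift w b s i - u * equilibriumShift w b 0 i) / T‖ ≤ C / T ^ 2 := by
  have hud : UniqueDiffOn ℝ (Set.Icc (0 : ℝ) 1) := uniqueDiffOn_Icc zero_lt_one
  have hder : ∀ {f : ℝ → ℂ}, ContDiffOn ℝ ∞ f (Set.Icc 0 1) → ∀ s ∈ Set.Icc (0 : ℝ) 1,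
      HasDerivWithinAt f (derivWithin f (Set.Icc 0 1) s) (Set.Icc 0 1) s :=
    fun hf s hs => (hf.differentiableOn (by simp) s hs).hasDerivWithinAt
  set p := equilibriumShift w b with hp
  set m := shiftedCoupling w b B Q with hm
  have hpc : ∀ i, ContDiffOn ℝ ∞ (fun s => p s i) (Set.Icc 0 1) :=
    contDiffOn_equilibriumShift hw hb hw0
  have hmc : ∀ i k, ContDiffOn ℝ ∞ (fun s => m i s k) (Set.Icc 0 1) := fun i k =>
    (hB i k).add ((contDiffOn_mulVec (hQ i) hpc k).add
      (contDiffOn_dotProduct hpc fun j => hQ i j k))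
  -- Up to the factor `1/T`, the forcing that remains because the quasi-equilibrium moves and is
  -- subject to the couplings.
  set f : Fin n → ℝ → ℂ := fun i s => B i s ⬝ᵥ p s
    - derivWithin (fun s => p s i) (Set.Icc 0 1) s + p s ⬝ᵥ (Q i s *ᵥ p s) with hf
  have hfc : ∀ i, ContDiffOn ℝ ∞ (f i) (Set.Icc 0 1) := fun i =>
    ((contDiffOn_dotProduct (hB i) hpc).sub ((hpc i).derivWithin hud (by simp))).add
      (contDiffOn_dotProduct hpc (contDiffOn_mulVec (hQ i) hpc))
  set φ : Fin n → ℝ → ℂ := fun i s => Complex.I * f i s / w i s with hφ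
  have hφc : ∀ i, ContDiffOn ℝ ∞ (φ i) (Set.Icc 0 1) := fun i =>
    contDiffOn_div_real (contDiffOn_const.mul (hfc i)) (hw i) fun s hs => hw0 s hs i
  set N : Fin n → ℝ → Fin n → ℂ := fun i s k =>
    if k = i then 0 else Complex.I * m i s k / ((w i s - w k s : ℝ) : ℂ) with hN
  have hNc : ∀ i k, ContDiffOn ℝ ∞ (fun s => N i s k) (Set.Icc 0 1) := by
    intro i k
    by_cases hk : k = i
    · simp only [hN, hk, if_true]
      exact contDiffOn_const
    · simp only [hN, hk, if_false]
      exact contDiffOn_div_real (contDiffOn_const.mul (hmc i k)) ((hw i).sub (hw k))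
        fun s hs => sub_ne_zero.2 (hgap s hs i k (Ne.symm hk))
  -- the family of all evolutions, as an index set for uniform estimates
  set S : Set (ℝ × (ℝ → Fin n → ℂ) × (ℝ → Fin n → ℂ) × ℝ) := {x | 1 ≤ x.1 ∧
    (∀ s ∈ Set.Icc (0 : ℝ) 1, ∀ i, ‖x.2.1 s i‖ ≤ A / x.1) ∧
    (∀ s ∈ Set.Icc (0 : ℝ) 1, ∀ i, ‖x.2.2.1 s i‖ ≤ A / x.1 ^ 2) ∧
    x.2.2.2 ∈ Set.Icc (0 : ℝ) 1} with hS
  have hSm : ∀ᶠ x in 𝓟 S, x ∈ S := eventually_principal.2 fun x hx => hx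
  have hτ : ∀ᶠ x in 𝓟 S, x.2.2.2 ∈ Set.Icc (0 : ℝ) 1 := hSm.mono fun x hx => hx.2.2.2
  have hTne : ∀ᶠ x in 𝓟 S, x.1 ≠ 0 := hSm.mono fun x hx => by linarith [hx.1]
  have hone : ∀ {g : ℝ → ℂ}, ContDiffOn ℝ ∞ g (Set.Icc 0 1) →
      (fun x : ℝ × (ℝ → Fin n → ℂ) × (ℝ → Fin n → ℂ) × ℝ => g x.2.2.2) =O[𝓟 S]
        fun _ => (1 : ℝ) := fun hg => isBigO_one_of_continuousOn hτ hg.continuousOn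
  have honed : ∀ {g : ℝ → ℂ}, ContDiffOn ℝ ∞ g (Set.Icc 0 1) →
      (fun x : ℝ × (ℝ → Fin n → ℂ) × (ℝ → Fin n → ℂ) × ℝ =>
        derivWithin g (Set.Icc 0 1) x.2.2.2) =O[𝓟 S] fun _ => (1 : ℝ) :=
    fun hg => isBigO_one_of_continuousOn hτ (hg.continuousOn_derivWithin hud (by simp))
  set e : ℝ × (ℝ → Fin n → ℂ) × (ℝ → Fin n → ℂ) × ℝ → Fin n → ℂ := fun x =>
    x.2.1 x.2.2.2 - (x.1 : ℂ)⁻¹ • p x.2.2.2 with he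
  have heO : ∀ k, (fun x => e x k) =O[𝓟 S] fun x => (x.1)⁻¹ := by
    intro k
    have h1 : (fun x : ℝ × (ℝ → Fin n → ℂ) × (ℝ → Fin n → ℂ) × ℝ => x.2.1 x.2.2.2 k)
        =O[𝓟 S] fun x => (x.1)⁻¹ := by
      refine IsBigO.of_bound A ?_
      filter_upwards [hSm] with x hx
      have hx1 : 0 < x.1 := by linarith [hx.1]
      rw [Real.norm_of_nonneg (by positivity)]
      exact hx.2.1 _ hx.2.2.2 k
    have h2 : (fun x : ℝ × (ℝ → Fin n → ℂ) × (ℝ → Fin n → ℂ) × ℝ => (x.1 : ℂ)⁻¹ * p x.2.2.2 k)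
        =O[𝓟 S] fun x => (x.1)⁻¹ * 1 :=
      (IsBigO.of_bound 1 (Eventually.of_forall fun x => by simp)).mul (hone (hpc k))
    simp only [mul_one] at h2
    exact h1.sub h2
  have hρO2 : ∀ k, (fun x : ℝ × (ℝ → Fin n → ℂ) × (ℝ → Fin n → ℂ) × ℝ => x.2.2.1 x.2.2.2 k)
      =O[𝓟 S] fun x => ((x.1)⁻¹) ^ 2 := by
    intro k
    refine IsBigO.of_bound A ?_
    filter_upwards [hSm] with x hx
    rw [Real.norm_of_nonneg (by positivity), inv_pow]
    exact hx.2.2.1 _ hx.2.2.2 k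
  have hρO1 : ∀ k, (fun x : ℝ × (ℝ → Fin n → ℂ) × (ℝ → Fin n → ℂ) × ℝ => x.2.2.1 x.2.2.2 k)
      =O[𝓟 S] fun x => (x.1)⁻¹ := by
    intro k
    refine (hρO2 k).trans (IsBigO.of_bound 1 ?_)
    filter_upwards [hSm] with x hx
    have hx1 : 0 < x.1 := by linarith [hx.1]
    rw [Real.norm_of_nonneg (by positivity), Real.norm_of_nonneg (by positivity), one_mul]
    exact pow_le_of_le_one (by positivity) (inv_le_one_of_one_le₀ hx.1) (by norm_num)
  set σ : ℝ × (ℝ → Fin n → ℂ) × (ℝ → Fin n → ℂ) × ℝ → Fin n → ℂ := fun x i =>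
    f i x.2.2.2 / x.1 + m i x.2.2.2 ⬝ᵥ e x + x.1 * (e x ⬝ᵥ (Q i x.2.2.2 *ᵥ e x))
      + x.2.2.1 x.2.2.2 i with hσ
  have hσO : ∀ i, (fun x => σ x i) =O[𝓟 S] fun x => (x.1)⁻¹ := fun i =>
    isBigO_shifted_rhs hTne heO (fun k => hone (hmc i k)) (fun j k => hone (hQ i j k))
      (hone (hfc i)) (hρO1 i)
  have hone' := fun i => isBigO_remainder heO hσO (N := fun x => N i x.2.2.2)
    (Nd := fun x k => derivWithin (fun s => N i s k) (Set.Icc 0 1) x.2.2.2)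
    (r := fun x => R i x.2.2.2)
    (rd := fun x : ℝ × (ℝ → Fin n → ℂ) × (ℝ → Fin n → ℂ) × ℝ =>
      Matrix.of fun j k => derivWithin (fun s => R i s j k) (Set.Icc 0 1) x.2.2.2)
    (mi := fun x => m i x.2.2.2 i) (φ := fun x => φ i x.2.2.2)
    (φd := fun x => derivWithin (φ i) (Set.Icc 0 1) x.2.2.2)
    (fun k => hone (hNc i k)) (fun k => honed (hNc i k)) (fun j k => hone (hR i j k))
    (fun j k => honed (hR i j k)) (hone (hφc i)) (honed (hφc i)) (hone (hmc i i)) (hρO2 i)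
  have hcorr := fun i => isBigO_correction heO (fun k => hone (hNc i k))
    (fun j k => hone (hR i j k)) (hone (hφc i))
  simp only [isBigO_principal] at hone' hcorr
  choose C₁ hC₁ using hone'
  choose C₂ hC₂ using hcorr
  have hD : ∀ i, ∃ D, ∀ s ∈ Set.Icc (0 : ℝ) 1, |∫ t in (0 : ℝ)..s, (m i t i).re| ≤ D := by
    intro i
    obtain ⟨D, hD⟩ := isCompact_Icc.exists_bound_of_continuousOn (hmc i i).continuousOn
    refine ⟨D, fun s hs => ?_⟩
    have hD0 : 0 ≤ D := (norm_nonneg _).trans (hD s hs)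
    have h1 := intervalIntegral.norm_integral_le_of_norm_le_const (f := fun t => (m i t i).re)
      (a := 0) (b := s) (C := D) fun t ht => by
        rw [Set.uIoc_of_le hs.1] at ht
        exact (Complex.abs_re_le_norm _).trans (hD t ⟨ht.1.le, ht.2.trans hs.2⟩)
    rw [sub_zero, abs_of_nonneg hs.1] at h1
    exact h1.trans (mul_le_of_le_one_right hD0 hs.2)
  choose D hD using hD
  -- Propagated remainder, correction at time `s`, and propagated correction at time 0.
  set G : Fin n → ℝ := fun i => Real.exp (D i) * Real.exp (D i) * C₁ i + C₂ i
    + Real.exp (D i) * C₂ i with hG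
  refine ⟨∑ i, |G i|, fun T hT c ρ hc hcA hρA i s hs => ?_⟩
  have hT0 : 0 < T := by linarith
  have hmem : ∀ t ∈ Set.Icc (0 : ℝ) 1, (T, c, ρ, t) ∈ S := fun t ht => ⟨hT, hcA, hρA, ht⟩
  have hgauge : ‖((T)⁻¹) ^ 2‖ = 1 / T ^ 2 := by
    rw [Real.norm_of_nonneg (by positivity)]
    simp
  set e₁ : ℝ → Fin n → ℂ := fun t => e (T, c, ρ, t) with he₁
  have hed : ∀ t ∈ Set.Icc (0 : ℝ) 1, ∀ k, HasDerivWithinAt (fun t => e₁ t k)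
      (-(Complex.I * T * w k t) * e₁ t k + σ (T, c, ρ, t) k) (Set.Icc 0 1) t := by
    intro t ht k
    have h1 := (hc.ode t ht k).fun_sub ((hder (hpc k) t ht).const_mul (T : ℂ)⁻¹)
    refine h1.congr_deriv ?_
    rw [mul_comm ((T : ℂ)⁻¹), ← div_eq_mul_inv]
    exact shifted_rhs_eq hT0.ne' (hw0 t ht k) (pi := p t k) rfl
      (by simp [he₁, he]; ring) rfl
  -- The near-identity variable, whose equation is scalar and diagonal up to `O(1/T²)`.
  set z : ℝ → ℂ := fun t => e₁ t i + φ i t / T ^ 2 + (T : ℂ)⁻¹ * (N i t ⬝ᵥ e₁ t)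
    + e₁ t ⬝ᵥ (R i t *ᵥ e₁ t) with hz
  have hzd : ∀ t ∈ Set.Icc (0 : ℝ) 1, HasDerivWithinAt z _ (Set.Icc 0 1) t := fun t ht =>
    (((hed t ht i).fun_add ((hder (hφc i) t ht).div_const _)).fun_add
      ((hasDerivWithinAt_dotProduct_complex (fun k => hder (hNc i k) t ht)
        (hed t ht)).const_mul _)).fun_add
      (hasDerivWithinAt_quadratic (q' := Matrix.of fun j k =>
        derivWithin (fun s => R i s j k) (Set.Icc 0 1) t) (hed t ht)
        fun j k => hder (hR i j k) t ht)
  have hprop := exists_propagator_bound (z := z)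
    (f := fun t => -(Complex.I * T * w i t) + m i t i) (D := D i) (ε := C₁ i * (1 / T ^ 2))
    ?_ hzd ?_ ?_ s hs
  · obtain ⟨u, hu, hub⟩ := hprop
    have hre : ∀ t, (-(Complex.I * T * w i t) + m i t i).re = (m i t i).re := fun t => by
      simp [mul_assoc, Complex.mul_re]
    simp only [hre] at hu
    refine ⟨u, hu, ?_⟩
    have hun : ‖u‖ ≤ Real.exp (D i) := by
      rw [hu]
      exact Real.exp_le_exp.2 ((le_abs_self _).trans (hD i s hs))
    have h1 := hC₂ i _ (hmem s hs)
    have h2 := hC₂ i _ (hmem 0 (by simp))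
    rw [hgauge] at h1 h2
    simp only at h1 h2
    set k₁ : ℂ := φ i s / T ^ 2 + (T : ℂ)⁻¹ * (N i s ⬝ᵥ e₁ s) + e₁ s ⬝ᵥ (R i s *ᵥ e₁ s) with hk₁
    set k₂ : ℂ := φ i 0 / T ^ 2 + (T : ℂ)⁻¹ * (N i 0 ⬝ᵥ e₁ 0) + e₁ 0 ⬝ᵥ (R i 0 *ᵥ e₁ 0) with hk₂
    have hz1 : z s = c s i - p s i / T + k₁ := by
      simp only [hz, hk₁, he₁, he, Pi.sub_apply, Pi.smul_apply, smul_eq_mul]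
      ring
    -- The deviation starts at zero, not at the quasi-equilibrium; this mismatch is the source of
    -- the free oscillation.
    have hz2 : z 0 = -(p 0 i / T) + k₂ := by
      simp only [hz, hk₂, he₁, he, Pi.sub_apply, Pi.smul_apply, smul_eq_mul, hc.initial,
        Pi.zero_apply]
      ring
    have h3 : c s i - (p s i - u * p 0 i) / T = (z s - u * z 0) - k₁ + u * k₂ := by
      rw [hz1, hz2]
      ring
    rw [h3]
    have h4 : ‖u * k₂‖ ≤ Real.exp (D i) * (C₂ i * (1 / T ^ 2)) := by
      rw [norm_mul]
      exact mul_le_mul hun h2 (norm_nonneg _) (Real.exp_nonneg _)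
    calc _ ≤ ‖z s - u * z 0‖ + ‖k₁‖ + ‖u * k₂‖ :=
          (norm_add_le _ _).trans (add_le_add_left (norm_sub_le _ _) _)
      _ ≤ Real.exp (D i) * Real.exp (D i) * (C₁ i * (1 / T ^ 2)) + C₂ i * (1 / T ^ 2)
          + Real.exp (D i) * (C₂ i * (1 / T ^ 2)) := add_le_add (add_le_add hub h1) h4
      _ = G i / T ^ 2 := by
          simp only [hG]
          ring
      _ ≤ _ := by
          gcongr
          exact (le_abs_self _).trans
            (Finset.single_le_sum (f := fun i => |G i|) (fun _ _ => abs_nonneg _)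
              (Finset.mem_univ i))
  · exact ((continuousOn_const.mul (Complex.continuous_ofReal.comp_continuousOn
      (hw i).continuousOn)).neg).add (hmc i i).continuousOn
  · intro t ht
    have hre : ∀ t, (-(Complex.I * T * w i t) + m i t i).re = (m i t i).re := fun t => by
      simp [mul_assoc, Complex.mul_re]
    simp only [hre]
    exact hD i t ht
  · intro t ht
    have h1 := hC₁ i _ (hmem t ht)
    rw [hgauge] at h1
    refine le_trans (le_of_eq ?_) h1
    congr 1
    rw [sub_eq_iff_eq_add']
    have hwi : (w i t : ℂ) ≠ 0 := Complex.ofReal_ne_zero.2 (hw0 t ht i)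
    refine normal_form_rhs_eq (w := fun k => w k t) hT0.ne' i (f := f i t) ?_ (by simp [hN]) ?_
      (hres t ht i) (fun k => rfl) rfl
    · simp only [hφ]
      field_simp
      linear_combination f i t * Complex.I_sq
    · intro k hk
      have hwk : (w i t : ℂ) - w k t ≠ 0 := by
        rw [← Complex.ofReal_sub]
        exact Complex.ofReal_ne_zero.2 (sub_ne_zero.2 (hgap t ht i k (Ne.symm hk)))
      simp only [hN, hk, if_false, Complex.ofReal_sub]
      field_simp
      linear_combination m i t k * Complex.I_sq

theorem norm_dotProduct_le {u v : Fin n → ℂ} {C : ℝ} (hu : ∀ k, ‖u k‖ ≤ C) :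
    ‖u ⬝ᵥ v‖ ≤ n * C * ‖v‖ := by
  calc ‖u ⬝ᵥ v‖ ≤ ∑ k, ‖u k * v k‖ := norm_sum_le _ _
    _ ≤ ∑ _k : Fin n, C * ‖v‖ := Finset.sum_le_sum fun k _ => by
        rw [norm_mul]
        exact mul_le_mul (hu k) (norm_le_pi_norm v k) (norm_nonneg _)
          ((norm_nonneg _).trans (hu k))
    _ = _ := by simp; ring

/-- The amplitudes of the linearized deviation are of order `1/T`. -/
theorem exists_linear_mode_bound {w : Fin n → ℝ → ℝ} {b : ℝ → Fin n → ℂ}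
    {B : Fin n → ℝ → Fin n → ℂ}
    (hw : ∀ i, ContDiffOn ℝ ∞ (w i) (Set.Icc 0 1))
    (hb : ∀ i, ContDiffOn ℝ ∞ (fun s => b s i) (Set.Icc 0 1))
    (hB : ∀ i k, ContDiffOn ℝ ∞ (fun s => B i s k) (Set.Icc 0 1))
    (hw0 : ∀ s ∈ Set.Icc (0 : ℝ) 1, ∀ i, w i s ≠ 0) :
    ∃ A, ∀ T ≥ 1, ∀ c : ℝ → Fin n → ℂ, IsModeEvolution w b B (fun _ _ => 0) T c 0 →
      ∀ s ∈ Set.Icc (0 : ℝ) 1, ∀ i, ‖c s i‖ ≤ A / T := by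
  have hud : UniqueDiffOn ℝ (Set.Icc (0 : ℝ) 1) := uniqueDiffOn_Icc zero_lt_one
  set p := equilibriumShift w b with hp
  have hpc : ∀ i, ContDiffOn ℝ ∞ (fun s => p s i) (Set.Icc 0 1) :=
    contDiffOn_equilibriumShift hw hb hw0
  set f : ℝ → Fin n → ℂ := fun s i => B i s ⬝ᵥ p s
    - derivWithin (fun s => p s i) (Set.Icc 0 1) s with hf
  have hfc : ∀ i, ContDiffOn ℝ ∞ (fun s => f s i) (Set.Icc 0 1) := fun i =>
    (contDiffOn_dotProduct (hB i) hpc).sub ((hpc i).derivWithin hud (by simp))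
  obtain ⟨P, hP⟩ := isCompact_Icc.exists_bound_of_continuousOn
    (continuousOn_pi.2 fun i => (hpc i).continuousOn)
  obtain ⟨F, hF⟩ := isCompact_Icc.exists_bound_of_continuousOn
    (continuousOn_pi.2 fun i => (hfc i).continuousOn)
  obtain ⟨D, hD⟩ := isCompact_Icc.exists_bound_of_continuousOn (f := fun s i k => B i s k)
    (continuousOn_pi.2 fun i => continuousOn_pi.2 fun k => (hB i k).continuousOn)
  have h01 : (0 : ℝ) ∈ Set.Icc (0 : ℝ) 1 := by simp
  have hP0 : 0 ≤ P := (norm_nonneg _).trans (hP 0 h01)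
  have hF0 : 0 ≤ F := (norm_nonneg _).trans (hF 0 h01)
  have hD0 : 0 ≤ D := (norm_nonneg _).trans (hD 0 h01)
  refine ⟨(P + F) * Real.exp (n * D + 1) + P, fun T hT c hc s hs i => ?_⟩
  have hT0 : 0 < T := by linarith
  -- Multiplying by the phases `exp(iT ∫ w_k)` removes the fast rotation without changing any
  -- modulus, so the Grönwall rate does not depend on `T`.
  have hprim := fun k => exists_primitive (f := fun s => Complex.I * T * w k s)
    (continuousOn_const.mul (Complex.continuous_ofReal.comp_continuousOn (hw k).continuousOn))
  choose Φ hΦ0 hΦd hΦre using hprim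
  have hΦn : ∀ k, ∀ t ∈ Set.Icc (0 : ℝ) 1, ‖Complex.exp (Φ k t)‖ = 1 := by
    intro k t ht
    rw [Complex.norm_exp, hΦre k t ht]
    simp [mul_assoc]
  set e : ℝ → Fin n → ℂ := fun t => c t - (T : ℂ)⁻¹ • p t with he
  set g : ℝ → Fin n → ℂ := fun t k => Complex.exp (Φ k t) * e t k with hg
  have hgn : ∀ t ∈ Set.Icc (0 : ℝ) 1, ‖g t‖ = ‖e t‖ := by
    intro t ht
    have : ∀ k, ‖g t k‖₊ = ‖e t k‖₊ := fun k => by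
      ext
      simp [hg, hΦn k t ht]
    simp only [Pi.norm_def, this]
  have hed : ∀ t ∈ Set.Icc (0 : ℝ) 1, ∀ k, HasDerivWithinAt (fun t => e t k)
      (-(Complex.I * T * w k t) * e t k + (f t k / T + B k t ⬝ᵥ e t)) (Set.Icc 0 1) t := by
    intro t ht k
    have h1 := (hc.ode t ht k).fun_sub
      (((hpc k).differentiableOn (by simp) t ht).hasDerivWithinAt.const_mul (T : ℂ)⁻¹)
    refine h1.congr_deriv ?_
    rw [mul_comm ((T : ℂ)⁻¹), ← div_eq_mul_inv]
    refine (shifted_rhs_eq hT0.ne' (hw0 t ht k) (pi := p t k) rfl (ei := e t k)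
      (by simp [he]; ring) (e := e t) (p := p t) rfl).trans ?_
    simp [hf]
  have hgd : ∀ t ∈ Set.Icc (0 : ℝ) 1, HasDerivWithinAt g
      (fun k => Complex.exp (Φ k t) * (f t k / T + B k t ⬝ᵥ e t)) (Set.Icc 0 1) t := by
    intro t ht
    refine hasDerivWithinAt_pi.2 fun k => ?_
    exact ((hΦd k t ht).cexp.mul (hed t ht k)).congr_deriv (by ring)
  have hgb : ∀ t ∈ Set.Icc (0 : ℝ) 1,
      ‖fun k => Complex.exp (Φ k t) * (f t k / T + B k t ⬝ᵥ e t)‖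
        ≤ (n * D + 1) * ‖g t‖ + F / T := by
    intro t ht
    rw [hgn t ht]
    refine (pi_norm_le_iff_of_nonneg (by positivity)).2 fun k => ?_
    rw [norm_mul, hΦn k t ht, one_mul]
    have h1 : ‖f t k / T‖ ≤ F / T := by
      rw [norm_div, Complex.norm_real, Real.norm_of_nonneg hT0.le]
      gcongr
      exact (norm_le_pi_norm (f t) k).trans (hF t ht)
    have h2 : ‖B k t ⬝ᵥ e t‖ ≤ n * D * ‖e t‖ := norm_dotProduct_le fun j =>
      (norm_le_pi_norm (B k t) j).trans ((norm_le_pi_norm (fun i k => B i t k) k).trans (hD t ht))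
    linarith [norm_add_le (f t k / (T : ℂ)) (B k t ⬝ᵥ e t), norm_nonneg (e t)]
  have hpn : ∀ t ∈ Set.Icc (0 : ℝ) 1, ‖(T : ℂ)⁻¹ • p t‖ ≤ P / T := by
    intro t ht
    rw [norm_smul, norm_inv, Complex.norm_real, Real.norm_of_nonneg hT0.le, div_eq_inv_mul]
    gcongr
    exact hP t ht
  have hg0 : ‖g 0‖ ≤ P / T := by
    rw [hgn 0 h01, he]
    simp only [hc.initial, zero_sub, norm_neg]
    exact hpn 0 h01
  have hmain := norm_le_exp_of_norm_deriv_le hgd hg0 (by positivity)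
    (by linarith [show 0 ≤ (n : ℝ) * D by positivity]) hgb s hs
  rw [hgn s hs] at hmain
  have h3 : c s = e s + (T : ℂ)⁻¹ • p s := by simp [he]
  calc ‖c s i‖ ≤ ‖c s‖ := norm_le_pi_norm _ _
    _ ≤ ‖e s‖ + ‖(T : ℂ)⁻¹ • p s‖ := by
        conv_lhs => rw [h3]
        exact norm_add_le _ _
    _ ≤ (P / T + F / T) * Real.exp (n * D + 1) + P / T := add_le_add hmain (hpn s hs)
    _ = _ := by ring

end NormalForm

/-! ### The moving eigenframe. -/

section Frame

variable {n : ℕ}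

/-- The complexification of a real matrix. -/
noncomputable def complexMatrix (M : Matrix (Fin n) (Fin n) ℝ) : Matrix (Fin n) (Fin n) ℂ :=
  M.map (fun a : ℝ => (a : ℂ))

theorem complexMatrix_mulVec_toComplex (M : Matrix (Fin n) (Fin n) ℝ) (y : Fin n → ℝ) :
    complexMatrix M *ᵥ toComplex y = toComplex (M *ᵥ y) := by
  ext i
  simp [complexMatrix, toComplex, Matrix.mulVec, dotProduct]

theorem complexMatrix_mul (M N : Matrix (Fin n) (Fin n) ℝ) :
    complexMatrix (M * N) = complexMatrix M * complexMatrix N :=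
  Matrix.map_mul (f := Complex.ofRealHom)

theorem star_complexMatrix_mulVec (M : Matrix (Fin n) (Fin n) ℝ) (y : Fin n → ℂ) :
    star (complexMatrix M *ᵥ y) = complexMatrix M *ᵥ star y := by
  ext i
  simp [complexMatrix, Matrix.mulVec, dotProduct]

theorem complexMatrix_transpose (M : Matrix (Fin n) (Fin n) ℝ) :
    (complexMatrix M)ᵀ = complexMatrix Mᵀ := rfl

theorem star_star_dotProduct (u v : Fin n → ℂ) : star (star u ⬝ᵥ v) = star v ⬝ᵥ u := by
  rw [Matrix.star_dotProduct, star_star, dotProduct_comm]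

/-- The matrix with the right eigenvectors as columns. -/
def frameMatrix (v : Fin n → ℝ → Fin n → ℂ) (s : ℝ) : Matrix (Fin n) (Fin n) ℂ :=
  Matrix.of fun μ j => v j s μ

/-- The coordinates of a vector in the eigenframe. -/
noncomputable def frameCoord (η : ℝ → Matrix (Fin n) (Fin n) ℂ) (v : Fin n → ℝ → Fin n → ℂ) (s : ℝ)
    (y : Fin n → ℂ) : Fin n → ℂ :=
  fun i => star (leftVec η v i s) ⬝ᵥ y

variable {K : ℝ → Matrix (Fin n) (Fin n) ℝ} {η : ℝ → Matrix (Fin n) (Fin n) ℂ} {w : Fin n → ℝ → ℝ}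
  {v : Fin n → ℝ → Fin n → ℂ} {s : ℝ}

theorem IsAdiabatic.leftVec_dotProduct (hK : IsAdiabatic K η w v) (hs : s ∈ Set.Icc (0 : ℝ) 1)
    (i j : Fin n) : star (leftVec η v i s) ⬝ᵥ v j s = if i = j then 1 else 0 := by
  rw [← star_star_dotProduct, leftVec, hK.biorthonormal s hs j i]
  by_cases h : i = j
  · simp [h]
  · simp [h, Ne.symm h]

/-- Biorthonormality makes the left vectors a left inverse of the square frame matrix, hence also a
right inverse: the frame is complete. -/
theorem IsAdiabatic.frame_expansion (hK : IsAdiabatic K η w v) (hs : s ∈ Set.Icc (0 : ℝ) 1)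
    (y : Fin n → ℂ) : frameMatrix v s *ᵥ frameCoord η v s y = y := by
  have h1 : (Matrix.of fun i => star (leftVec η v i s)) * frameMatrix v s = 1 := by
    ext i j
    rw [Matrix.one_apply, ← hK.leftVec_dotProduct hs i j]
    rfl
  have h2 := mul_eq_one_comm.1 h1
  have h3 : frameCoord η v s y = (Matrix.of fun i => star (leftVec η v i s)) *ᵥ y := rfl
  rw [h3, Matrix.mulVec_mulVec, h2, Matrix.one_mulVec]

theorem dotProduct_frameMatrix (u c : Fin n → ℂ) :
    u ⬝ᵥ (frameMatrix v s *ᵥ c) = (fun k => u ⬝ᵥ v k s) ⬝ᵥ c := by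
  rw [Matrix.dotProduct_mulVec]
  rfl

theorem IsAdiabatic.dotProduct_expansion (hK : IsAdiabatic K η w v)
    (hs : s ∈ Set.Icc (0 : ℝ) 1) (u y : Fin n → ℂ) :
    u ⬝ᵥ y = (fun k => u ⬝ᵥ v k s) ⬝ᵥ frameCoord η v s y := by
  rw [← dotProduct_frameMatrix, hK.frame_expansion hs]

theorem IsAdiabatic.complexMatrix_mulVec (hK : IsAdiabatic K η w v)
    (hs : s ∈ Set.Icc (0 : ℝ) 1) (j : Fin n) :
    complexMatrix (K s) *ᵥ v j s = (-(Complex.I * w j s)) • v j s := by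
  have h := hK.eigen s hs j
  rw [iK, Matrix.smul_mulVec] at h
  have h2 := congrArg (fun z => (-Complex.I) • z) h
  simp only [smul_smul, neg_mul, Complex.I_mul_I, neg_neg, one_smul] at h2
  exact h2

theorem IsAdiabatic.frameCoord_generator (hK : IsAdiabatic K η w v)
    (hs : s ∈ Set.Icc (0 : ℝ) 1) (y : Fin n → ℂ) (i : Fin n) :
    frameCoord η v s (complexMatrix (K s) *ᵥ y) i
      = -(Complex.I * w i s) * frameCoord η v s y i := by
  have h1 : frameCoord η v s (complexMatrix (K s) *ᵥ y) i
      = (star (leftVec η v i s) ᵥ* complexMatrix (K s)) ⬝ᵥ y := by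
    rw [← Matrix.dotProduct_mulVec]
    rfl
  rw [h1, hK.dotProduct_expansion hs]
  simp only [← Matrix.dotProduct_mulVec, hK.complexMatrix_mulVec hs, dotProduct_smul,
    hK.leftVec_dotProduct hs, smul_eq_mul]
  simp [dotProduct]

theorem IsAdiabatic.frameCoord_injective (hK : IsAdiabatic K η w v)
    (hs : s ∈ Set.Icc (0 : ℝ) 1) {y : Fin n → ℂ} (h : frameCoord η v s y = 0) : y = 0 := by
  rw [← hK.frame_expansion hs y, h, Matrix.mulVec_zero]

theorem toComplex_injective : Function.Injective (toComplex (n := n)) := fun _ _ h =>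
  funext fun i => Complex.ofReal_injective (congrFun h i)

theorem IsAdiabatic.complexMatrix_injective (hK : IsAdiabatic K η w v)
    (hs : s ∈ Set.Icc (0 : ℝ) 1) {y : Fin n → ℂ} (h : complexMatrix (K s) *ᵥ y = 0) : y = 0 := by
  refine hK.frameCoord_injective hs (funext fun i => ?_)
  have h1 := hK.frameCoord_generator hs y i
  rw [h] at h1
  have h2 : frameCoord η v s 0 i = 0 := by simp [frameCoord]
  rw [h2] at h1
  have h3 : (w i s : ℂ) ≠ 0 := Complex.ofReal_ne_zero.2 (hK.nonvanishing s hs i)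
  have h4 : -(Complex.I * (w i s : ℂ)) ≠ 0 := neg_ne_zero.2 (mul_ne_zero Complex.I_ne_zero h3)
  exact (mul_eq_zero.1 h1.symm).resolve_left h4

/-- Zero is not a frequency. This supplies the nondegeneracy of the energy Hessian. -/
theorem IsAdiabatic.injective (hK : IsAdiabatic K η w v)
    (hs : s ∈ Set.Icc (0 : ℝ) 1) {y : Fin n → ℝ} (h : K s *ᵥ y = 0) : y = 0 := by
  apply toComplex_injective
  have h0 : toComplex (0 : Fin n → ℝ) = 0 := by ext; simp [toComplex]
  rw [h0]
  exact hK.complexMatrix_injective hs (by rw [complexMatrix_mulVec_toComplex, h, h0])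

/-- In the eigenframe the `η`-norm is the Euclidean norm. -/
theorem IsAdiabatic.etaNorm_eq (hK : IsAdiabatic K η w v) (hs : s ∈ Set.Icc (0 : ℝ) 1)
    (y : Fin n → ℂ) : etaNorm (η s) y = ‖WithLp.toLp 2 (frameCoord η v s y)‖ := by
  rw [etaNorm, EuclideanSpace.norm_eq]
  congr 1
  have h1 : star y ⬝ᵥ (η s *ᵥ y) = (star y ᵥ* η s) ⬝ᵥ y := by rw [Matrix.dotProduct_mulVec]
  rw [h1, hK.dotProduct_expansion hs]
  simp only [← Matrix.dotProduct_mulVec]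
  simp only [dotProduct, Complex.re_sum]
  refine Finset.sum_congr rfl fun i _ => ?_
  have h2 : star y ⬝ᵥ (η s *ᵥ v i s) = star (frameCoord η v s y i) :=
    (star_star_dotProduct _ _).symm
  change (star y ⬝ᵥ (η s *ᵥ v i s) * frameCoord η v s y i).re = _
  rw [h2, Complex.star_def, mul_comm, Complex.mul_conj, Complex.ofReal_re,
    Complex.normSq_eq_norm_sq]

theorem IsAdiabatic.contDiffOn_leftVec (hK : IsAdiabatic K η w v) (i : Fin n) :
    ContDiffOn ℝ ∞ (leftVec η v i) (Set.Icc 0 1) :=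
  contDiffOn_pi.2 (contDiffOn_mulVec hK.smooth_metric (contDiffOn_pi.1 (hK.smooth_frame i)))

theorem contDiffOn_star {u : ℝ → Fin n → ℂ} {S : Set ℝ} (hu : ContDiffOn ℝ ∞ u S) (μ : Fin n) :
    ContDiffOn ℝ ∞ (fun s => star (u s) μ) S :=
  Complex.conjCLE.contDiff.comp_contDiffOn (contDiffOn_pi.1 hu μ)

theorem contDiffOn_toComplex {u : ℝ → Fin n → ℝ} {S : Set ℝ} (hu : ContDiffOn ℝ ∞ u S)
    (μ : Fin n) : ContDiffOn ℝ ∞ (fun s => toComplex (u s) μ) S :=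
  Complex.ofRealCLM.contDiff.comp_contDiffOn (contDiffOn_pi.1 hu μ)

/-- The couplings between the modes by the motion of the eigenframe. -/
noncomputable def frameCoupling (η : ℝ → Matrix (Fin n) (Fin n) ℂ) (v : Fin n → ℝ → Fin n → ℂ)
    (i : Fin n) (s : ℝ) : Fin n → ℂ :=
  fun k => star (derivWithin (leftVec η v i) (Set.Icc 0 1) s) ⬝ᵥ v k s

theorem IsAdiabatic.contDiffOn_frameCoupling (hK : IsAdiabatic K η w v) (i k : Fin n) :
    ContDiffOn ℝ ∞ (fun s => frameCoupling η v i s k) (Set.Icc 0 1) :=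
  contDiffOn_dotProduct (contDiffOn_star
    ((hK.contDiffOn_leftVec i).derivWithin (uniqueDiffOn_Icc zero_lt_one) (by simp)))
    (contDiffOn_pi.1 (hK.smooth_frame k))

theorem IsAdiabatic.contDiffOn_frameCoord (hK : IsAdiabatic K η w v) {y : ℝ → Fin n → ℂ}
    (hy : ∀ μ, ContDiffOn ℝ ∞ (fun s => y s μ) (Set.Icc 0 1)) (i : Fin n) :
    ContDiffOn ℝ ∞ (fun s => frameCoord η v s (y s) i) (Set.Icc 0 1) :=
  contDiffOn_dotProduct (contDiffOn_star (hK.contDiffOn_leftVec i)) hy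

/-- Smoothness of the frequencies is not part of `IsAdiabatic`; it follows from `w_i = Re (i ⟨ṽ_i|K
v_i⟩)`. -/
theorem IsAdiabatic.contDiffOn_frequency (hK : IsAdiabatic K η w v)
    (hKc : ∀ μ ν, ContDiffOn ℝ ∞ (fun s => K s μ ν) (Set.Icc 0 1)) (i : Fin n) :
    ContDiffOn ℝ ∞ (w i) (Set.Icc 0 1) := by
  have h1 : ContDiffOn ℝ ∞ (fun s => (Complex.I *
      frameCoord η v s (complexMatrix (K s) *ᵥ v i s) i).re) (Set.Icc 0 1) :=
    Complex.reCLM.contDiff.comp_contDiffOn (contDiffOn_const.mul (hK.contDiffOn_frameCoord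
      (contDiffOn_mulVec (fun μ ν => Complex.ofRealCLM.contDiff.comp_contDiffOn (hKc μ ν))
        (contDiffOn_pi.1 (hK.smooth_frame i))) i))
  refine h1.congr fun s hs => ?_
  have h2 : frameCoord η v s (v i s) i = 1 := by
    rw [frameCoord, hK.leftVec_dotProduct hs, if_pos rfl]
  rw [hK.frameCoord_generator hs, h2, mul_one, mul_neg, ← mul_assoc, Complex.I_mul_I]
  simp

/-- The equation of motion of the coordinates in the moving eigenframe. -/
theorem IsAdiabatic.hasDerivWithinAt_frameCoord (hK : IsAdiabatic K η w v)
    (hs : s ∈ Set.Icc (0 : ℝ) 1) {y : ℝ → Fin n → ℝ} {y' : Fin n → ℝ}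
    (hy : HasDerivWithinAt y y' (Set.Icc 0 1) s) (i : Fin n) :
    HasDerivWithinAt (fun t => frameCoord η v t (toComplex (y t)) i)
      (frameCoupling η v i s ⬝ᵥ frameCoord η v s (toComplex (y s))
        + frameCoord η v s (toComplex y') i) (Set.Icc 0 1) s := by
  have h1 : ∀ μ, HasDerivWithinAt (fun t => star (leftVec η v i t) μ)
      (star (derivWithin (leftVec η v i) (Set.Icc 0 1) s) μ) (Set.Icc 0 1) s := fun μ =>
    (hasDerivWithinAt_pi.1 ((hK.contDiffOn_leftVec i).differentiableOn (by simp) s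
      hs).hasDerivWithinAt μ).star
  have h2 : ∀ μ, HasDerivWithinAt (fun t => toComplex (y t) μ) (toComplex y' μ) (Set.Icc 0 1) s :=
    fun μ => (hasDerivWithinAt_pi.1 hy μ).ofReal_comp
  refine (hasDerivWithinAt_dotProduct_complex h1 h2).congr_deriv ?_
  rw [hK.dotProduct_expansion hs]
  rfl

/-- A symplectic perturbation of the generator does not change the modulus of the propagators in
first order: its diagonal matrix elements are imaginary. -/
theorem IsAdiabatic.re_frameCoord_symplectic (hK : IsAdiabatic K η w v)
    (hs : s ∈ Set.Icc (0 : ℝ) 1) {Ω G : Matrix (Fin n) (Fin n) ℝ} (hΩ : Ωᵀ = -Ω)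
    (hdet : IsUnit Ω.det) (hΩK : (Ω * K s)ᵀ = Ω * K s) (hΩG : (Ω * G)ᵀ = Ω * G) (i : Fin n) :
    (frameCoord η v s (complexMatrix G *ᵥ v i s) i).re = 0 := by
  -- Since `ΩK` is symmetric and `Ω` antisymmetric, this row is a left eigenvector of `K` for the
  -- same eigenvalue as the left vector of mode `i`. The spectrum is simple, so the two are
  -- proportional, with factor `τ`.
  set r : Fin n → ℂ := star (v i s) ᵥ* complexMatrix Ω with hr
  have hsym : ∀ (M : Matrix (Fin n) (Fin n) ℝ), Mᵀ = M → ∀ y z : Fin n → ℂ,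
      star y ⬝ᵥ (complexMatrix M *ᵥ z) = star (complexMatrix M *ᵥ y) ⬝ᵥ z := by
    intro M hM y z
    rw [Matrix.dotProduct_mulVec, ← Matrix.mulVec_transpose, complexMatrix_transpose, hM,
      star_complexMatrix_mulVec]
  have hneg : complexMatrix (-Ω) = -complexMatrix Ω := by
    ext
    simp [complexMatrix]
  have hskew : ∀ y z : Fin n → ℂ,
      star y ⬝ᵥ (complexMatrix Ω *ᵥ z) = -(star (complexMatrix Ω *ᵥ y) ⬝ᵥ z) := by
    intro y z
    rw [Matrix.dotProduct_mulVec, ← Matrix.mulVec_transpose, complexMatrix_transpose, hΩ,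
      star_complexMatrix_mulVec, hneg, Matrix.neg_mulVec, neg_dotProduct]
  have hrdot : ∀ y, r ⬝ᵥ y = star (v i s) ⬝ᵥ (complexMatrix Ω *ᵥ y) := fun y =>
    (Matrix.dotProduct_mulVec _ _ _).symm
  have hleft : ∀ y, r ⬝ᵥ (complexMatrix (K s) *ᵥ y) = -(Complex.I * w i s) * (r ⬝ᵥ y) := by
    intro y
    rw [hrdot, hrdot, Matrix.mulVec_mulVec, ← complexMatrix_mul, hsym _ hΩK, complexMatrix_mul,
      ← Matrix.mulVec_mulVec, hK.complexMatrix_mulVec hs, Matrix.mulVec_smul, star_smul,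
      smul_dotProduct, hskew]
    simp
  have hoff : ∀ j, j ≠ i → r ⬝ᵥ v j s = 0 := by
    intro j hj
    have h1 := hleft (v j s)
    rw [hK.complexMatrix_mulVec hs, dotProduct_smul, smul_eq_mul] at h1
    have h2 : Complex.I * ((w i s : ℂ) - w j s) * (r ⬝ᵥ v j s) = 0 := by linear_combination h1
    have h3 : (w i s : ℂ) - w j s ≠ 0 := by
      rw [← Complex.ofReal_sub]
      exact Complex.ofReal_ne_zero.2 (sub_ne_zero.2 (hK.gap s hs i j (Ne.symm hj)))
    exact (mul_eq_zero.1 h2).resolve_left (mul_ne_zero Complex.I_ne_zero h3)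
  have hprop : ∀ y, r ⬝ᵥ y = (r ⬝ᵥ v i s) * frameCoord η v s y i := by
    intro y
    rw [hK.dotProduct_expansion hs, dotProduct, Finset.sum_eq_single i]
    · intro j _ hj
      rw [hoff j hj, zero_mul]
    · simp
  set τ := r ⬝ᵥ v i s with hτ
  have hτ0 : τ ≠ 0 := by
    intro h0
    have h1 : r = 0 := by
      ext μ
      have := hprop (Pi.single μ 1)
      rw [h0, zero_mul] at this
      simpa using this
    have hdet' : IsUnit (complexMatrix Ω).det := by
      have : (complexMatrix Ω).det = (Ω.det : ℂ) :=
        (RingHom.map_det Complex.ofRealHom Ω).symm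
      rw [this]
      exact hdet.map Complex.ofRealHom
    have h2 : star (v i s) = 0 := by
      have h3 := congrArg (fun z => z ᵥ* (complexMatrix Ω)⁻¹) h1
      simpa [hr, Matrix.vecMul_vecMul, Matrix.mul_nonsing_inv _ hdet'] using h3
    have h4 := hK.leftVec_dotProduct hs i i
    rw [star_eq_zero.1 h2] at h4
    simp at h4
  -- `τ` is the value of a real antisymmetric form on `v_i` and its conjugate, hence imaginary; `τ
  -- Z` below is such a value of a real symmetric form, hence real. So `Z` is imaginary.
  have hτstar : star τ = -τ := by
    rw [hτ, hrdot, star_star_dotProduct]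
    rw [hskew, neg_neg]
  set Z := frameCoord η v s (complexMatrix G *ᵥ v i s) i with hZ
  have h1 : τ * Z = star (v i s) ⬝ᵥ (complexMatrix (Ω * G) *ᵥ v i s) := by
    rw [← hprop, hrdot, complexMatrix_mul, Matrix.mulVec_mulVec]
  have h2 : star (τ * Z) = τ * Z := by
    rw [h1, star_star_dotProduct, ← hsym _ hΩG]
  rw [star_mul', hτstar] at h2
  have h3 : star Z = -Z := by
    have : τ * (star Z + Z) = 0 := by linear_combination -h2
    exact eq_neg_of_add_eq_zero_left ((mul_eq_zero.1 this).resolve_left hτ0)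
  have h4 := congrArg Complex.re h3
  simp only [Complex.star_def, Complex.conj_re, Complex.neg_re] at h4
  linarith

end Frame

/-! ### Geometric phases and the constant `κ`. -/

section Kappa

variable {n : ℕ} {K : ℝ → Matrix (Fin n) (Fin n) ℝ} {η : ℝ → Matrix (Fin n) (Fin n) ℂ}
  {w : Fin n → ℝ → ℝ} {v : Fin n → ℝ → Fin n → ℂ} {x₀ : ℝ → Fin n → ℝ} {s s' : ℝ}

theorem intervalIntegrable_of_continuousOn {f : ℝ → ℂ} (hf : ContinuousOn f (Set.Icc 0 1))
    (hs : s ∈ Set.Icc (0 : ℝ) 1) : IntervalIntegrable f MeasureTheory.volume 0 s := by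
  refine ContinuousOn.intervalIntegrable (hf.mono ?_)
  rw [Set.uIcc_of_le hs.1]
  exact Set.Icc_subset_Icc_right hs.2

/-- The geometric phase is the integral of the diagonal couplings. -/
theorem IsAdiabatic.geometricPhase_eq (hK : IsAdiabatic K η w v) (hs : s ∈ Set.Icc (0 : ℝ) 1)
    (j : Fin n) :
    -Complex.I * geometricPhase η v j s = -∫ u in (0 : ℝ)..s, frameCoupling η v j u j := by
  have h1 : ∀ u ∈ Set.Icc (0 : ℝ) 1,
      star (leftVec η v j u) ⬝ᵥ derivWithin (v j) (Set.Icc 0 1) u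
        - star (derivWithin (leftVec η v j) (Set.Icc 0 1) u) ⬝ᵥ v j u
      = -2 * frameCoupling η v j u j := by
    intro u hu
    -- Differentiating the normalization shows that the two terms of the integrand are equal, both
    -- being minus the diagonal coupling.
    have h2 : HasDerivWithinAt (fun t => star (leftVec η v j t) ⬝ᵥ v j t) _ (Set.Icc 0 1) u :=
      hasDerivWithinAt_dotProduct_complex
        (fun μ => (hasDerivWithinAt_pi.1 ((hK.contDiffOn_leftVec j).differentiableOn (by simp) u
          hu).hasDerivWithinAt μ).star)
        (fun μ => hasDerivWithinAt_pi.1 ((hK.smooth_frame j).differentiableOn (by simp) u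
          hu).hasDerivWithinAt μ)
    have h3 : HasDerivWithinAt (fun t => star (leftVec η v j t) ⬝ᵥ v j t) 0 (Set.Icc 0 1) u := by
      refine (hasDerivWithinAt_const u (Set.Icc 0 1) (1 : ℂ)).congr (fun t ht => ?_) ?_
      · rw [hK.leftVec_dotProduct ht, if_pos rfl]
      · rw [hK.leftVec_dotProduct hu, if_pos rfl]
    have h4 : star (derivWithin (leftVec η v j) (Set.Icc 0 1) u) ⬝ᵥ v j u
        + star (leftVec η v j u) ⬝ᵥ derivWithin (v j) (Set.Icc 0 1) u = 0 :=
      (uniqueDiffOn_Icc zero_lt_one u hu).eq_deriv _ h2 h3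
    rw [frameCoupling]
    linear_combination h4
  have h2 : ∫ u in (0 : ℝ)..s, (star (leftVec η v j u) ⬝ᵥ derivWithin (v j) (Set.Icc 0 1) u
        - star (derivWithin (leftVec η v j) (Set.Icc 0 1) u) ⬝ᵥ v j u)
      = -2 * ∫ u in (0 : ℝ)..s, frameCoupling η v j u j := by
    rw [← intervalIntegral.integral_const_mul]
    refine intervalIntegral.integral_congr fun u hu => ?_
    rw [Set.uIcc_of_le hs.1] at hu
    exact h1 u ⟨hu.1, hu.2.trans hs.2⟩
  rw [geometricPhase, h2]
  linear_combination (∫ u in (0 : ℝ)..s, frameCoupling η v j u j) * Complex.I_sq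

theorem IsAdiabatic.norm_exp_geometricPhase (hK : IsAdiabatic K η w v)
    (hs : s ∈ Set.Icc (0 : ℝ) 1) (hs' : s' ∈ Set.Icc (0 : ℝ) 1) (j : Fin n) :
    ‖Complex.exp (-Complex.I * (geometricPhase η v j s - geometricPhase η v j s'))‖
      = Real.exp ((∫ u in (0 : ℝ)..s', (frameCoupling η v j u j).re)
        - ∫ u in (0 : ℝ)..s, (frameCoupling η v j u j).re) := by
  have hre : ∀ {t}, t ∈ Set.Icc (0 : ℝ) 1 → (∫ u in (0 : ℝ)..t, frameCoupling η v j u j).re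
      = ∫ u in (0 : ℝ)..t, (frameCoupling η v j u j).re := fun ht => by
    simpa using (Complex.reCLM.intervalIntegral_comp_comm (intervalIntegrable_of_continuousOn
      (hK.contDiffOn_frameCoupling j j).continuousOn ht)).symm
  rw [mul_sub, hK.geometricPhase_eq hs, hK.geometricPhase_eq hs', Complex.norm_exp,
    Complex.sub_re, Complex.neg_re, Complex.neg_re, hre hs, hre hs']
  congr 1
  ring

/-- The largest modulus of the geometric factors. -/
noncomputable def phaseMax (η : ℝ → Matrix (Fin n) (Fin n) ℂ) (v : Fin n → ℝ → Fin n → ℂ) : ℝ :=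
  ⨆ p : Set.Icc (0 : ℝ) 1 × Set.Icc (0 : ℝ) 1 × Fin n,
    ‖Complex.exp (-Complex.I *
      (geometricPhase η v p.2.2 p.1 - geometricPhase η v p.2.2 p.2.1))‖

/-- The largest speed of the ground state. -/
noncomputable def speedMax (η : ℝ → Matrix (Fin n) (Fin n) ℂ) (x₀ : ℝ → Fin n → ℝ) : ℝ :=
  ⨆ s : Set.Icc (0 : ℝ) 1, etaNorm (η s) (toComplex (velocity x₀ s))

/-- The smallest frequency. -/
noncomputable def frequencyMin (w : Fin n → ℝ → ℝ) : ℝ :=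
  ⨅ p : Set.Icc (0 : ℝ) 1 × Fin n, |w p.2 p.1|

theorem kappa_eq : kappa η w v x₀ = 2 * phaseMax η v * speedMax η x₀ / frequencyMin w := rfl

/-- The modulus of the propagator from 0 to `s` is the geometric factor at the pair of times `(0,
s)`. Boundedness of the family is needed because the supremum is a conditional one. -/
theorem IsAdiabatic.exp_integral_le_phaseMax (hK : IsAdiabatic K η w v)
    (hs : s ∈ Set.Icc (0 : ℝ) 1) (j : Fin n) :
    Real.exp (∫ u in (0 : ℝ)..s, (frameCoupling η v j u j).re) ≤ phaseMax η v := by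
  obtain ⟨D, hD⟩ := isCompact_Icc.exists_bound_of_continuousOn
    (f := fun t i => frameCoupling η v i t i)
    (continuousOn_pi.2 fun i => (hK.contDiffOn_frameCoupling i i).continuousOn)
  have hbd : ∀ t ∈ Set.Icc (0 : ℝ) 1, ∀ i,
      |∫ u in (0 : ℝ)..t, (frameCoupling η v i u i).re| ≤ D := by
    intro t ht i
    have hD0 : 0 ≤ D := (norm_nonneg _).trans (hD t ht)
    have h1 := intervalIntegral.norm_integral_le_of_norm_le_const
      (f := fun t => (frameCoupling η v i t i).re) (a := 0) (b := t) (C := D) fun u hu => by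
        rw [Set.uIoc_of_le ht.1] at hu
        exact (Complex.abs_re_le_norm _).trans
          ((norm_le_pi_norm (fun i => frameCoupling η v i u i) i).trans
            (hD u ⟨hu.1.le, hu.2.trans ht.2⟩))
    rw [sub_zero, abs_of_nonneg ht.1] at h1
    exact h1.trans (mul_le_of_le_one_right hD0 ht.2)
  have hbdd : BddAbove (Set.range fun p : Set.Icc (0 : ℝ) 1 × Set.Icc (0 : ℝ) 1 × Fin n =>
      ‖Complex.exp (-Complex.I *
        (geometricPhase η v p.2.2 p.1 - geometricPhase η v p.2.2 p.2.1))‖) := by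
    refine ⟨Real.exp (D + D), ?_⟩
    rintro _ ⟨⟨t, t', i⟩, rfl⟩
    simp only
    rw [hK.norm_exp_geometricPhase t.2 t'.2]
    apply Real.exp_le_exp.2
    linarith [(abs_le.1 (hbd t t.2 i)).1, (abs_le.1 (hbd t' t'.2 i)).2]
  have h0 : (0 : ℝ) ∈ Set.Icc (0 : ℝ) 1 := by simp
  have h1 := le_ciSup hbdd ⟨⟨0, h0⟩, ⟨s, hs⟩, j⟩
  simp only at h1
  rw [hK.norm_exp_geometricPhase h0 hs, intervalIntegral.integral_same, sub_zero] at h1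
  exact h1

theorem IsAdiabatic.one_le_phaseMax (hK : IsAdiabatic K η w v) (j : Fin n) :
    1 ≤ phaseMax η v := by
  have := hK.exp_integral_le_phaseMax (s := 0) (by simp) j
  simpa using this

theorem IsAdiabatic.etaNorm_le_speedMax (hK : IsAdiabatic K η w v)
    (hv : ContDiffOn ℝ ∞ (velocity x₀) (Set.Icc 0 1)) (hs : s ∈ Set.Icc (0 : ℝ) 1) :
    etaNorm (η s) (toComplex (velocity x₀ s)) ≤ speedMax η x₀ := by
  have hcont : ContinuousOn (fun s => WithLp.toLp 2
      (frameCoord η v s (toComplex (velocity x₀ s)))) (Set.Icc 0 1) :=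
    (PiLp.continuous_toLp 2 _).comp_continuousOn (continuousOn_pi.2 fun i =>
      (hK.contDiffOn_frameCoord (contDiffOn_toComplex hv) i).continuousOn)
  obtain ⟨D, hD⟩ := isCompact_Icc.exists_bound_of_continuousOn hcont
  have hbdd : BddAbove (Set.range fun s : Set.Icc (0 : ℝ) 1 =>
      etaNorm (η s) (toComplex (velocity x₀ s))) := by
    refine ⟨D, ?_⟩
    rintro _ ⟨t, rfl⟩
    simp only
    rw [hK.etaNorm_eq t.2]
    exact hD t t.2
  exact le_ciSup hbdd ⟨s, hs⟩

theorem frequencyMin_le (hs : s ∈ Set.Icc (0 : ℝ) 1) (i : Fin n) : frequencyMin w ≤ |w i s| :=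
  ciInf_le ⟨0, by rintro _ ⟨p, rfl⟩; exact abs_nonneg _⟩
    ((⟨s, hs⟩, i) : Set.Icc (0 : ℝ) 1 × Fin n)

theorem IsAdiabatic.frequencyMin_pos (hK : IsAdiabatic K η w v)
    (hw : ∀ i, ContDiffOn ℝ ∞ (w i) (Set.Icc 0 1)) (i : Fin n) : 0 < frequencyMin w := by
  have h1 : ∀ i, ∃ c > 0, ∀ s ∈ Set.Icc (0 : ℝ) 1, c ≤ |w i s| := fun i =>
    exists_pos_le_of_isCompact isCompact_Icc (hw i).continuousOn.abs
      fun s hs => abs_pos.2 (hK.nonvanishing s hs i)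
  choose c hc hcb using h1
  obtain ⟨k, -, hk⟩ := Finset.exists_min_image Finset.univ c ⟨i, Finset.mem_univ i⟩
  have : Nonempty (Fin n) := ⟨i⟩
  have : Nonempty (Set.Icc (0 : ℝ) 1) := ⟨⟨0, by simp⟩⟩
  exact (hc k).trans_le (le_ciInf fun p => (hk p.2 (Finset.mem_univ _)).trans (hcb p.2 p.1 p.1.2))

theorem kappa_nonneg : 0 ≤ kappa η w v x₀ := by
  rw [kappa_eq]
  refine div_nonneg (mul_nonneg (mul_nonneg zero_le_two ?_) ?_) ?_
  · exact Real.iSup_nonneg fun _ => norm_nonneg _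
  · exact Real.iSup_nonneg fun _ => Real.sqrt_nonneg _
  · exact Real.iInf_nonneg fun _ => abs_nonneg _

/-- For the degenerate case `κ = 0`, in which a bound cannot be rescaled by `κ` and the deviation
has to vanish. -/
theorem IsAdiabatic.velocity_eq_zero (hK : IsAdiabatic K η w v)
    (hw : ∀ i, ContDiffOn ℝ ∞ (w i) (Set.Icc 0 1))
    (hv : ContDiffOn ℝ ∞ (velocity x₀) (Set.Icc 0 1)) (h : kappa η w v x₀ = 0)
    (hs : s ∈ Set.Icc (0 : ℝ) 1) : velocity x₀ s = 0 := by
  -- This also provides an index: for `n = 0` the infimum defining `frequencyMin` runs over an empty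
  -- type and is not positive.
  ext i
  have h1 := hK.one_le_phaseMax i
  have h2 := hK.frequencyMin_pos hw i
  have h3 : speedMax η x₀ = 0 := by
    rw [kappa_eq, div_eq_zero_iff] at h
    rcases h with h | h
    · exact (mul_eq_zero.1 h).resolve_left (by positivity)
    · exact absurd h h2.ne'
  have h4 := hK.etaNorm_le_speedMax hv hs
  rw [hK.etaNorm_eq hs, h3] at h4
  have h5 : frameCoord η v s (toComplex (velocity x₀ s)) = 0 := by
    have := norm_le_zero_iff.1 h4
    simpa using congrArg WithLp.ofLp this
  have h6 := hK.frameCoord_injective hs h5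
  simpa [toComplex] using congrFun h6 i

theorem norm_toLp_le {C : ℝ} {c : Fin n → ℂ} (h : ∀ i, ‖c i‖ ≤ C) :
    ‖WithLp.toLp 2 c‖ ≤ √n * |C| := by
  rw [EuclideanSpace.norm_eq, ← Real.sqrt_sq_eq_abs, ← Real.sqrt_mul (by positivity)]
  refine Real.sqrt_le_sqrt ?_
  calc ∑ i, ‖c i‖ ^ 2 ≤ ∑ _i : Fin n, C ^ 2 := Finset.sum_le_sum fun i _ => by
        gcongr
        exact h i
    _ = _ := by simp

theorem norm_toLp_le_norm {c d : Fin n → ℂ} {C : ℝ} (hC : 0 ≤ C) (h : ∀ i, ‖c i‖ ≤ C * ‖d i‖) :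
    ‖WithLp.toLp 2 c‖ ≤ C * ‖WithLp.toLp 2 d‖ := by
  rw [EuclideanSpace.norm_eq, EuclideanSpace.norm_eq]
  conv_rhs => rw [← Real.sqrt_sq hC, ← Real.sqrt_mul (by positivity), Finset.mul_sum]
  refine Real.sqrt_le_sqrt (Finset.sum_le_sum fun i _ => ?_)
  rw [← mul_pow]
  gcongr
  exact h i

theorem IsAdiabatic.norm_equilibriumShift_le (hK : IsAdiabatic K η w v)
    (hw : ∀ i, ContDiffOn ℝ ∞ (w i) (Set.Icc 0 1))
    (hv : ContDiffOn ℝ ∞ (velocity x₀) (Set.Icc 0 1)) (hs : s ∈ Set.Icc (0 : ℝ) 1) (i : Fin n) :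
    ‖WithLp.toLp 2 (equilibriumShift w
      (fun s => frameCoord η v s (toComplex (velocity x₀ s))) s)‖
      ≤ speedMax η x₀ / frequencyMin w := by
  have h2 := hK.frequencyMin_pos hw i
  have h1 := norm_toLp_le_norm (C := (frequencyMin w)⁻¹) (by positivity)
    (c := equilibriumShift w (fun s => frameCoord η v s (toComplex (velocity x₀ s))) s)
    (d := frameCoord η v s (toComplex (velocity x₀ s))) (fun k => by
      rw [equilibriumShift, norm_div, norm_mul, Complex.norm_I, one_mul, Complex.norm_real,
        div_eq_inv_mul, Real.norm_eq_abs]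
      gcongr
      exact frequencyMin_le hs k)
  refine h1.trans ?_
  rw [← hK.etaNorm_eq hs, div_eq_inv_mul]
  gcongr
  exact hK.etaNorm_le_speedMax hv hs

/-- An equilibrium displacement together with the free oscillation compensating it initially has
size at most `κ`. -/
theorem IsAdiabatic.etaNorm_le_kappa (hK : IsAdiabatic K η w v)
    (hw : ∀ i, ContDiffOn ℝ ∞ (w i) (Set.Icc 0 1))
    (hv : ContDiffOn ℝ ∞ (velocity x₀) (Set.Icc 0 1)) (hs : s ∈ Set.Icc (0 : ℝ) 1) {C T : ℝ}
    (hT : 0 < T) {y : Fin n → ℂ}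
    (h : ∀ i, ∃ u : ℂ, ‖u‖ = Real.exp (∫ t in (0 : ℝ)..s, (frameCoupling η v i t i).re) ∧
      ‖frameCoord η v s y i - (equilibriumShift w
          (fun s => frameCoord η v s (toComplex (velocity x₀ s))) s i
        - u * equilibriumShift w
          (fun s => frameCoord η v s (toComplex (velocity x₀ s))) 0 i) / T‖ ≤ C / T ^ 2) :
    etaNorm (η s) y ≤ kappa η w v x₀ / T + √n * |C| / T ^ 2 := by
  -- For `n = 0` the extrema in `κ` have default values, but nonnegativity of `κ` is enough.
  rcases isEmpty_or_nonempty (Fin n) with hempty | ⟨⟨i₀⟩⟩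
  · rw [hK.etaNorm_eq hs, EuclideanSpace.norm_eq]
    simp only [Finset.univ_eq_empty, Finset.sum_empty, Real.sqrt_zero]
    have := kappa_nonneg (η := η) (w := w) (v := v) (x₀ := x₀)
    positivity
  choose u hu hub using h
  set p := equilibriumShift w (fun s => frameCoord η v s (toComplex (velocity x₀ s))) with hp
  have hG := hK.one_le_phaseMax i₀
  have hwm := hK.frequencyMin_pos hw i₀
  set a : Fin n → ℂ := fun i => u i * p 0 i with ha
  set d : Fin n → ℂ := fun i => frameCoord η v s y i - (p s i - a i) / T with hd
  have h1 : WithLp.toLp 2 (frameCoord η v s y)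
      = ((T : ℂ)⁻¹ • (WithLp.toLp 2 (p s) - WithLp.toLp 2 a) + WithLp.toLp 2 d
        : EuclideanSpace ℂ (Fin n)) := by
    ext i
    simp [hd]
    ring
  have h2 : ‖WithLp.toLp 2 a‖ ≤ phaseMax η v * (speedMax η x₀ / frequencyMin w) := by
    refine (norm_toLp_le_norm (C := phaseMax η v) (by positivity) (d := p 0) fun i => ?_).trans ?_
    · rw [ha, norm_mul, hu]
      gcongr
      exact hK.exp_integral_le_phaseMax hs i
    · gcongr
      exact hK.norm_equilibriumShift_le hw hv (by simp) i₀
  have h3 := hK.norm_equilibriumShift_le hw hv hs i₀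
  have h4 : ‖WithLp.toLp 2 d‖ ≤ √n * |C| / T ^ 2 := by
    refine (norm_toLp_le hub).trans (le_of_eq ?_)
    rw [abs_div, abs_of_pos (by positivity : 0 < T ^ 2)]
    ring
  have h5 : 0 ≤ speedMax η x₀ / frequencyMin w := (norm_nonneg _).trans h3
  rw [hK.etaNorm_eq hs, h1]
  refine (norm_add_le _ _).trans (add_le_add ?_ h4)
  rw [norm_smul, norm_inv, Complex.norm_real, Real.norm_of_nonneg hT.le, div_eq_inv_mul]
  gcongr
  refine (norm_sub_le _ _).trans ((add_le_add h3 h2).trans ?_)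
  -- The displacement at `s` contributes 1 and the propagated initial one `phaseMax`; since `1 ≤
  -- phaseMax`, their sum is at most the `2 * phaseMax` in `κ`.
  rw [kappa_eq, mul_div_assoc]
  nlinarith

end Kappa

/-! ### Quadratic couplings and their effect on the propagators. -/

section Coupling

variable {n : ℕ} {K : ℝ → Matrix (Fin n) (Fin n) ℝ} {η : ℝ → Matrix (Fin n) (Fin n) ℂ}
  {w : Fin n → ℝ → ℝ} {v : Fin n → ℝ → Fin n → ℂ} {s : ℝ}

/-- The complex functional on real vectors with given coefficients. -/
noncomputable def realFunctional (u : Fin n → ℂ) : (Fin n → ℝ) →ₗ[ℝ] ℂ where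
  toFun y := u ⬝ᵥ toComplex y
  map_add' y z := by
    simp [toComplex, dotProduct, mul_add, Finset.sum_add_distrib]
  map_smul' c y := by
    simp only [toComplex, dotProduct, Pi.smul_apply, smul_eq_mul, Complex.ofReal_mul,
      Complex.real_smul, RingHom.id_apply, Finset.mul_sum]
    exact Finset.sum_congr rfl fun μ _ => by ring

theorem frameCoord_toComplex (y : Fin n → ℝ) (i : Fin n) :
    frameCoord η v s (toComplex y) i = realFunctional (star (leftVec η v i s)) y := rfl

theorem norm_toComplex_le (y : Fin n → ℝ) : ‖toComplex y‖ ≤ ‖y‖ :=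
  (pi_norm_le_iff_of_nonneg (norm_nonneg _)).2 fun μ => by
    simpa [toComplex] using norm_le_pi_norm y μ

theorem IsAdiabatic.exists_frameCoord_bound (hK : IsAdiabatic K η w v) :
    ∃ C, 0 ≤ C ∧ ∀ s ∈ Set.Icc (0 : ℝ) 1, ∀ (y : Fin n → ℝ) (i : Fin n),
      ‖frameCoord η v s (toComplex y) i‖ ≤ C * ‖y‖ := by
  obtain ⟨D, hD⟩ := isCompact_Icc.exists_bound_of_continuousOn (f := fun s i => leftVec η v i s)
    (continuousOn_pi.2 fun i => (hK.contDiffOn_leftVec i).continuousOn)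
  have hD0 : 0 ≤ D := (norm_nonneg _).trans (hD 0 (by simp))
  refine ⟨n * D, by positivity, fun s hs y i => ?_⟩
  refine (norm_dotProduct_le (C := D) fun k => ?_).trans ?_
  · rw [Pi.star_apply, norm_star]
    exact (norm_le_pi_norm (leftVec η v i s) k).trans
      ((norm_le_pi_norm (fun i => leftVec η v i s) i).trans (hD s hs))
  · gcongr
    exact norm_toComplex_le y

/-- The component of a real bilinear map along a complex functional, as a matrix. -/
noncomputable def bilinearComponent (D : (Fin n → ℝ) →L[ℝ] (Fin n → ℝ) →L[ℝ] (Fin n → ℝ))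
    (u : Fin n → ℂ) : Matrix (Fin n) (Fin n) ℂ :=
  Matrix.of fun α β => u ⬝ᵥ toComplex (D (Pi.single α 1) (Pi.single β 1))

theorem bilinearComponent_mulVec (D : (Fin n → ℝ) →L[ℝ] (Fin n → ℝ) →L[ℝ] (Fin n → ℝ))
    (u : Fin n → ℂ) (z : Fin n → ℝ) (α : Fin n) :
    (bilinearComponent D u *ᵥ toComplex z) α = realFunctional u (D (Pi.single α 1) z) := by
  rw [clm_apply_eq_sum_single (D (Pi.single α 1)) z, map_sum]
  simp only [map_smul, Complex.real_smul, Matrix.mulVec]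
  rw [dotProduct]
  refine Finset.sum_congr rfl fun β _ => ?_
  rw [mul_comm]
  rfl

theorem dotProduct_bilinearComponent (D : (Fin n → ℝ) →L[ℝ] (Fin n → ℝ) →L[ℝ] (Fin n → ℝ))
    (u : Fin n → ℂ) (y z : Fin n → ℝ) :
    toComplex y ⬝ᵥ (bilinearComponent D u *ᵥ toComplex z) = realFunctional u (D y z) := by
  have h1 : D y z = ∑ α, y α • D (Pi.single α 1) z := by
    rw [clm_apply_eq_sum_single D y]
    simp only [sum_apply, smul_apply]
  rw [h1, map_sum]
  simp only [map_smul, Complex.real_smul, dotProduct, bilinearComponent_mulVec]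
  rfl

/-- The quadratic couplings of the modes by the second derivative of the vector field. -/
noncomputable def quadraticCoupling (η : ℝ → Matrix (Fin n) (Fin n) ℂ) (v : Fin n → ℝ → Fin n → ℂ)
    (D : ℝ → (Fin n → ℝ) →L[ℝ] (Fin n → ℝ) →L[ℝ] (Fin n → ℝ)) (i : Fin n) (s : ℝ) :
    Matrix (Fin n) (Fin n) ℂ :=
  (1 / 2 : ℂ) • ((frameMatrix v s)ᵀ * bilinearComponent (D s) (star (leftVec η v i s))
    * frameMatrix v s)

variable {D : ℝ → (Fin n → ℝ) →L[ℝ] (Fin n → ℝ) →L[ℝ] (Fin n → ℝ)}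

theorem IsAdiabatic.contDiffOn_quadraticCoupling (hK : IsAdiabatic K η w v)
    (hD : ContDiffOn ℝ ∞ D (Set.Icc 0 1)) (i j k : Fin n) :
    ContDiffOn ℝ ∞ (fun s => quadraticCoupling η v D i s j k) (Set.Icc 0 1) := by
  have hv : ∀ μ k, ContDiffOn ℝ ∞ (fun s => frameMatrix v s μ k) (Set.Icc 0 1) :=
    fun μ k => contDiffOn_pi.1 (hK.smooth_frame k) μ
  simp only [quadraticCoupling, Matrix.smul_apply, Matrix.mul_apply, Matrix.transpose_apply,
    smul_eq_mul]
  refine contDiffOn_const.mul (ContDiffOn.sum fun β _ => ContDiffOn.mul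
    (ContDiffOn.sum fun α _ => (hv α j).mul ?_) (hv β k))
  exact contDiffOn_dotProduct (contDiffOn_star (hK.contDiffOn_leftVec i))
    (contDiffOn_toComplex ((hD.clm_apply contDiffOn_const).clm_apply contDiffOn_const))

theorem IsAdiabatic.quadraticCoupling_apply (hK : IsAdiabatic K η w v)
    (hs : s ∈ Set.Icc (0 : ℝ) 1) (y : Fin n → ℝ) (i : Fin n) :
    frameCoord η v s (toComplex y) ⬝ᵥ
        (quadraticCoupling η v D i s *ᵥ frameCoord η v s (toComplex y))
      = frameCoord η v s (toComplex ((1 / 2 : ℝ) • D s y y)) i := by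
  rw [quadraticCoupling, Matrix.smul_mulVec, dotProduct_smul, ← Matrix.mulVec_mulVec,
    ← Matrix.mulVec_mulVec, Matrix.dotProduct_mulVec, Matrix.vecMul_transpose,
    hK.frame_expansion hs, dotProduct_bilinearComponent, frameCoord_toComplex, map_smul,
    Complex.real_smul]
  simp

theorem IsAdiabatic.frameCoord_frameMatrix (hK : IsAdiabatic K η w v)
    (hs : s ∈ Set.Icc (0 : ℝ) 1) (c : Fin n → ℂ) :
    frameCoord η v s (frameMatrix v s *ᵥ c) = c := by
  ext i
  rw [frameCoord, dotProduct_frameMatrix]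
  simp only [hK.leftVec_dotProduct hs]
  simp [dotProduct]

/-- The displacement of the quasi-equilibrium is a real vector. -/
theorem IsAdiabatic.exists_real_shift (hK : IsAdiabatic K η w v) (hs : s ∈ Set.Icc (0 : ℝ) 1)
    (V : ℝ → Fin n → ℝ) : ∃ P : Fin n → ℝ, toComplex P = frameMatrix v s *ᵥ
      equilibriumShift w (fun s => frameCoord η v s (toComplex (V s))) s := by
  set P := frameMatrix v s *ᵥ
    equilibriumShift w (fun s => frameCoord η v s (toComplex (V s))) s with hP
  -- The shift solves `K P = V` with real `K` and `V`; its conjugate is a solution too, and `K` is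
  -- injective.
  have h1 : complexMatrix (K s) *ᵥ P = toComplex (V s) := by
    rw [← sub_eq_zero]
    refine hK.frameCoord_injective hs (funext fun i => ?_)
    have hw : (w i s : ℂ) ≠ 0 := Complex.ofReal_ne_zero.2 (hK.nonvanishing s hs i)
    have h2 := hK.frameCoord_generator hs P i
    rw [hP, hK.frameCoord_frameMatrix hs, ← hP, equilibriumShift] at h2
    have h3 : frameCoord η v s (complexMatrix (K s) *ᵥ P - toComplex (V s)) i
        = frameCoord η v s (complexMatrix (K s) *ᵥ P) i - frameCoord η v s (toComplex (V s)) i :=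
      dotProduct_sub _ _ _
    rw [h3, h2, Pi.zero_apply]
    field_simp
    linear_combination (-frameCoord η v s (toComplex (V s)) i) * Complex.I_sq
  have h2 : star P = P := by
    rw [← sub_eq_zero]
    refine hK.complexMatrix_injective hs ?_
    have h3 : star (toComplex (V s)) = toComplex (V s) := by
      ext
      simp [toComplex]
    rw [Matrix.mulVec_sub, ← star_complexMatrix_mulVec, h1, h3, sub_self]
  refine ⟨fun μ => (P μ).re, funext fun μ => ?_⟩
  exact Complex.conj_eq_iff_re.1 (congrFun h2 μ)

/-- The shift of the couplings by the displacement of the quasi-equilibrium has imaginary diagonal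
elements if it comes from a symplectic vector field. -/
theorem IsAdiabatic.re_shiftedCoupling (hK : IsAdiabatic K η w v)
    (hs : s ∈ Set.Icc (0 : ℝ) 1) {Ω : Matrix (Fin n) (Fin n) ℝ} (hΩ : Ωᵀ = -Ω)
    (hdet : IsUnit Ω.det) (hΩK : (Ω * K s)ᵀ = Ω * K s)
    (hDsymm : ∀ y z, D s y z = D s z y)
    (hΩD : ∀ p y z, y ⬝ᵥ (Ω *ᵥ D s p z) = z ⬝ᵥ (Ω *ᵥ D s p y))
    (V : ℝ → Fin n → ℝ) (i : Fin n) :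
    (shiftedCoupling w (fun s => frameCoord η v s (toComplex (V s))) (frameCoupling η v)
        (quadraticCoupling η v D) i s i).re = (frameCoupling η v i s i).re := by
  obtain ⟨P, hP⟩ := hK.exists_real_shift hs V
  set p := equilibriumShift w (fun s => frameCoord η v s (toComplex (V s))) s with hp
  set S := bilinearComponent (D s) (star (leftVec η v i s)) with hS
  -- Symmetry of the second derivative makes the two shifted couplings `Q p` and `p Q` equal, so
  -- their halves add up to one matrix element of `G`.
  have hSt : Sᵀ = S := by
    ext α β
    simp only [hS, bilinearComponent, Matrix.transpose_apply, Matrix.of_apply]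
    rw [hDsymm]
  have h1 : (quadraticCoupling η v D i s *ᵥ p) i = 1 / 2 * (v i s ⬝ᵥ (S *ᵥ toComplex P)) := by
    rw [quadraticCoupling, Matrix.smul_mulVec, Pi.smul_apply, smul_eq_mul, ← Matrix.mulVec_mulVec,
      ← hP, ← Matrix.mulVec_mulVec]
    rfl
  have h2 : (p ᵥ* quadraticCoupling η v D i s) i = 1 / 2 * (v i s ⬝ᵥ (S *ᵥ toComplex P)) := by
    have hQt : (quadraticCoupling η v D i s)ᵀ = quadraticCoupling η v D i s := by
      rw [quadraticCoupling, Matrix.transpose_smul, Matrix.transpose_mul, Matrix.transpose_mul,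
        Matrix.transpose_transpose, ← hS, hSt, Matrix.mul_assoc]
    rw [← h1, ← Matrix.mulVec_transpose, hQt]
  -- The first-order change of the generator when its base point is displaced along `P`; it is real
  -- because `P` is.
  set G : Matrix (Fin n) (Fin n) ℝ := Matrix.of fun μ α => D s P (Pi.single α 1) μ with hG
  have hGv : ∀ y, G *ᵥ y = D s P y := by
    intro y
    rw [clm_apply_eq_sum_single (D s P) y]
    ext μ
    simp only [Matrix.mulVec, dotProduct, Finset.sum_apply, Pi.smul_apply, smul_eq_mul, hG,
      Matrix.of_apply]
    exact Finset.sum_congr rfl fun ν _ => mul_comm _ _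
  have hΩG : (Ω * G)ᵀ = Ω * G := by
    ext α β
    have h3 := hΩD P (Pi.single β 1) (Pi.single α 1)
    rw [← hGv, ← hGv, Matrix.mulVec_mulVec, Matrix.mulVec_mulVec] at h3
    simpa using h3
  have h3 : v i s ⬝ᵥ (S *ᵥ toComplex P) = frameCoord η v s (complexMatrix G *ᵥ v i s) i := by
    have hα : S *ᵥ toComplex P = star (leftVec η v i s) ᵥ* complexMatrix G := by
      ext α
      rw [hS, bilinearComponent_mulVec, hDsymm]
      rfl
    rw [hα, frameCoord, Matrix.dotProduct_mulVec, dotProduct_comm]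
  have h4 := hK.re_frameCoord_symplectic hs hΩ hdet hΩK hΩG i
  have h5 : shiftedCoupling w (fun s => frameCoord η v s (toComplex (V s))) (frameCoupling η v)
      (quadraticCoupling η v D) i s i = frameCoupling η v i s i
        + frameCoord η v s (complexMatrix G *ᵥ v i s) i := by
    simp only [shiftedCoupling, Pi.add_apply, ← hp]
    rw [h1, h2, ← h3]
    ring
  rw [h5, Complex.add_re, h4, add_zero]

end Coupling

/-! ### Smoothness and symplectic symmetry along the ground state curve. -/

section Evolution

variable {𝓗 : Type*} [NormedAddCommGroup 𝓗] [InnerProductSpace ℂ 𝓗] [CompleteSpace 𝓗] {n : ℕ}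
  {U : Set (Fin n → ℝ)} {ψ : (Fin n → ℝ) → 𝓗} {H : ℝ → 𝓗 →L[ℂ] 𝓗} {x₀ : ℝ → Fin n → ℝ}
  {η : ℝ → Matrix (Fin n) (Fin n) ℂ} {w : Fin n → ℝ → ℝ} {v : Fin n → ℝ → Fin n → ℂ}

theorem contDiffOn_generator (hψ : IsVariationalFamily U ψ) (hH : IsProtocol H)
    (hx₀ : IsVariationalGroundState U ψ H x₀) (μ ν : Fin n) :
    ContDiffOn ℝ ∞ (fun s => generator ψ H x₀ s μ ν) (Set.Icc 0 1) :=
  contDiffOn_pi.1 ((contDiffOn_curve hH hx₀ (f := fun A => fderiv ℝ (opField ψ A))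
    (contDiffOn_fderiv_param hψ.isOpen (contDiffOn_opField hψ))).clm_apply contDiffOn_const) μ

theorem contDiffOn_fieldHessian (hψ : IsVariationalFamily U ψ) (hH : IsProtocol H)
    (hx₀ : IsVariationalGroundState U ψ H x₀) :
    ContDiffOn ℝ ∞ (fun s => fderiv ℝ (fderiv ℝ (opField ψ (H s))) (x₀ s)) (Set.Icc 0 1) :=
  contDiffOn_curve hH hx₀ (f := fun A => fderiv ℝ (fderiv ℝ (opField ψ A)))
    (contDiffOn_fderiv_param (f := fun A => fderiv ℝ (opField ψ A)) hψ.isOpen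
      (contDiffOn_fderiv_param hψ.isOpen (contDiffOn_opField hψ)))

/-- In Darboux coordinates the second derivative of the variational vector field is symplectic. -/
theorem symplecticMatrix_fieldHessian_symm (hψ : IsVariationalFamily U ψ) {A : 𝓗 →L[ℂ] 𝓗}
    (hA : IsSelfAdjoint A) {x : Fin n → ℝ} (hx : x ∈ U)
    (hconst : ∀ x ∈ U, ∀ y ∈ U, symplecticMatrix ψ x = symplecticMatrix ψ y)
    (p y z : Fin n → ℝ) :
    y ⬝ᵥ (symplecticMatrix ψ x *ᵥ fderiv ℝ (fderiv ℝ (opField ψ A)) x p z)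
      = z ⬝ᵥ (symplecticMatrix ψ x *ᵥ fderiv ℝ (fderiv ℝ (opField ψ A)) x p y) := by
  have hX : HasFDerivAt (fderiv ℝ (opField ψ A)) (fderiv ℝ (fderiv ℝ (opField ψ A)) x) x :=
    (((contDiffAt_slice hψ.isOpen (contDiffOn_opField hψ) A hx).fderiv_right (m := ∞)
      (by simp)).differentiableAt (by simp)).hasFDerivAt
  have hline : HasDerivAt (fun t : ℝ => x + t • p) p 0 := by
    simpa using ((hasDerivAt_id (0 : ℝ)).smul_const p).const_add x
  have hXl : HasDerivAt (fun t : ℝ => fderiv ℝ (opField ψ A) (x + t • p))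
      (fderiv ℝ (fderiv ℝ (opField ψ A)) x p) 0 := by
    refine HasFDerivAt.comp_hasDerivAt (f := fun t : ℝ => x + t • p) 0 ?_ hline
    simpa using hX
  have hd : ∀ a b : Fin n → ℝ, HasDerivAt (fun t : ℝ => a ⬝ᵥ (symplecticMatrix ψ x *ᵥ
      fderiv ℝ (opField ψ A) (x + t • p) b))
      (a ⬝ᵥ (symplecticMatrix ψ x *ᵥ fderiv ℝ (fderiv ℝ (opField ψ A)) x p b)) 0 := by
    intro a b
    have h1 := hasDerivAt_pi.1 ((hXl.clm_apply (hasDerivAt_const (0 : ℝ) b)).congr_deriv (by simp) :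
      HasDerivAt _ (fderiv ℝ (fderiv ℝ (opField ψ A)) x p b) (0 : ℝ))
    simp only [dotProduct, Matrix.mulVec]
    exact HasDerivAt.fun_sum fun μ _ => (HasDerivAt.fun_sum fun ν _ =>
      (h1 ν).const_mul _).const_mul _
  -- With constant `ω` the linearization is infinitesimally symplectic at all points of `U`, not
  -- only at critical ones, so this symmetry may be differentiated along `x + t • p`.
  refine (hd y z).unique ((hd z y).congr_of_eventuallyEq ?_)
  have hev : ∀ᶠ t : ℝ in nhds 0, x + t • p ∈ U := by
    refine hline.continuousAt.eventually_mem (hψ.isOpen.mem_nhds ?_)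
    simpa using hx
  filter_upwards [hev] with t ht
  rw [hconst x hx _ ht]
  refine symplecticMatrix_fderiv_opField_symm hψ hA ht (fun u μ ν => ?_) z y
  have h0 : (fun x => symplecticMatrix ψ x μ ν) =ᶠ[nhds (x + t • p)]
      fun _ => symplecticMatrix ψ x μ ν := by
    filter_upwards [hψ.isOpen.mem_nhds ht] with x' hx'
    rw [hconst x' hx' x hx]
  rw [h0.fderiv_eq]
  simp

theorem symplecticMatrix_mul_generator_transpose (hψ : IsVariationalFamily U ψ)
    (hH : IsProtocol H) (hx₀ : IsVariationalGroundState U ψ H x₀) {s : ℝ}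
    (hs : s ∈ Set.Icc (0 : ℝ) 1) :
    (symplecticMatrix ψ (x₀ s) * generator ψ H x₀ s)ᵀ
      = symplecticMatrix ψ (x₀ s) * generator ψ H x₀ s := by
  ext α β
  have h := symplecticMatrix_fderiv_opField_symm hψ (hH.selfAdjoint s hs) (hx₀.mem s hs)
    (by simp [hx₀.opField_eq_zero hψ hH hs]) (Pi.single α 1) (Pi.single β 1)
  rw [← generator_mulVec, ← generator_mulVec, Matrix.mulVec_mulVec, Matrix.mulVec_mulVec] at h
  simpa using h

end Evolution

/-! ### The three bounds. -/

section Main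

variable {𝓗 : Type*} [NormedAddCommGroup 𝓗] [InnerProductSpace ℂ 𝓗] {n : ℕ}
  {U : Set (Fin n → ℝ)} {ψ : (Fin n → ℝ) → 𝓗} {H : ℝ → 𝓗 →L[ℂ] 𝓗} {x₀ : ℝ → Fin n → ℝ}
  {η : ℝ → Matrix (Fin n) (Fin n) ℂ} {w : Fin n → ℝ → ℝ} {v : Fin n → ℝ → Fin n → ℂ}

/-- The states of the family depend on the parameters in a Lipschitz way near the curve of ground
states. -/
theorem exists_state_lipschitz (hψ : IsVariationalFamily U ψ)
    (hx₀ : IsVariationalGroundState U ψ H x₀) :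
    ∃ r > 0, ∃ C, 0 ≤ C ∧ ∀ s ∈ Set.Icc (0 : ℝ) 1, ∀ y, ‖y‖ ≤ r →
      ‖ψ (x₀ s + y) - ψ (x₀ s)‖ ≤ C * ‖y‖ := by
  obtain ⟨r, hr, htube⟩ := exists_tube hψ.isOpen hx₀.smooth.continuousOn hx₀.mem
  have hd : ContDiffOn ℝ ∞ (fderiv ℝ ψ) U := hψ.smooth.fderiv_of_isOpen hψ.isOpen (by simp)
  obtain ⟨C, hC⟩ := exists_tube_bound (V := ℝ) (f := fun _ x => fderiv ℝ ψ x)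
    (hd.continuousOn.comp continuousOn_snd fun p hp => hp.2) (A := fun _ => 0)
    continuousOn_const hx₀.smooth.continuousOn htube
  refine ⟨r, hr, C, (norm_nonneg _).trans (hC 0 (by simp) 0 (by simpa using hr.le)),
    fun s hs y hy => norm_sub_le_of_norm_fderiv_le (fun z hz => ?_) (hC s hs) hy⟩
  exact (hψ.smooth.contDiffAt (hψ.isOpen.mem_nhds (htube s hs z hz))).differentiableAt (by simp)

theorem fieldHessian_symm (hψ : IsVariationalFamily U ψ) (A : 𝓗 →L[ℂ] 𝓗) {x : Fin n → ℝ}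
    (hx : x ∈ U) (y z : Fin n → ℝ) : fderiv ℝ (fderiv ℝ (opField ψ A)) x y z
      = fderiv ℝ (fderiv ℝ (opField ψ A)) x z y :=
  (contDiffAt_slice hψ.isOpen (contDiffOn_opField hψ) A hx).isSymmSndFDerivAt
    (by simpa using WithTop.coe_le_coe.2 (le_top : (2 : ℕ∞) ≤ ⊤)) y z

/-- The amplitudes of a linearized deviation. -/
theorem IsLinearizedDeviation.isModeEvolution (hK : IsAdiabatic (generator ψ H x₀) η w v) {T : ℝ}
    {ξ : ℝ → Fin n → ℝ} (hξ : IsLinearizedDeviation (generator ψ H x₀) x₀ T ξ) :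
    IsModeEvolution w (fun s => frameCoord η v s (toComplex (velocity x₀ s))) (frameCoupling η v)
      (fun _ _ => 0) T (fun s => frameCoord η v s (toComplex (ξ s))) 0 where
  initial := by
    ext i
    rw [frameCoord_toComplex, hξ.initial, map_zero]
    rfl
  ode s hs i := by
    refine (hK.hasDerivWithinAt_frameCoord hs (hξ.ode s hs) i).congr_deriv ?_
    have h1 := hK.frameCoord_generator hs (toComplex (ξ s)) i
    rw [complexMatrix_mulVec_toComplex, frameCoord_toComplex] at h1
    rw [frameCoord_toComplex (T • (generator ψ H x₀ s *ᵥ ξ s) - velocity x₀ s), map_sub, map_smul,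
      h1, ← frameCoord_toComplex, Complex.real_smul]
    simp only [Matrix.zero_mulVec, dotProduct_zero, mul_zero, Pi.zero_apply, add_zero]
    ring

/-- The remainder of the second order expansion of the variational vector field
around the ground state. -/
noncomputable def taylorRemainder (ψ : (Fin n → ℝ) → 𝓗) (H : ℝ → 𝓗 →L[ℂ] 𝓗)
    (x₀ x : ℝ → Fin n → ℝ) (s : ℝ) : Fin n → ℝ :=
  opField ψ (H s) (x s) - fderiv ℝ (opField ψ (H s)) (x₀ s) (x s - x₀ s)
    - (1 / 2 : ℝ) • fderiv ℝ (fderiv ℝ (opField ψ (H s))) (x₀ s) (x s - x₀ s) (x s - x₀ s)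

/-- The amplitudes of the deviation of a variational evolution. -/
theorem IsVariationalEvolution.isModeEvolution (hx₀ : IsVariationalGroundState U ψ H x₀)
    (hK : IsAdiabatic (generator ψ H x₀) η w v) {T : ℝ}
    {x : ℝ → Fin n → ℝ} (hx : IsVariationalEvolution U ψ H x₀ T x) :
    IsModeEvolution w (fun s => frameCoord η v s (toComplex (velocity x₀ s))) (frameCoupling η v)
      (quadraticCoupling η v fun s => fderiv ℝ (fderiv ℝ (opField ψ (H s))) (x₀ s)) T
      (fun s => frameCoord η v s (toComplex (x s - x₀ s)))
      (fun s => frameCoord η v s (toComplex (T • taylorRemainder ψ H x₀ x s))) where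
  initial := by
    ext i
    rw [frameCoord_toComplex, hx.initial, sub_self, map_zero]
    rfl
  ode s hs i := by
    refine (hK.hasDerivWithinAt_frameCoord hs
      ((hx.ode s hs).fun_sub (hx₀.hasDerivWithinAt hs)) i).congr_deriv ?_
    have h1 := hK.frameCoord_generator hs (toComplex (x s - x₀ s)) i
    rw [complexMatrix_mulVec_toComplex, generator_mulVec] at h1
    have h2 : T • varField ψ H s (x s) - velocity x₀ s
        = T • fderiv ℝ (opField ψ (H s)) (x₀ s) (x s - x₀ s)
          + T • ((1 / 2 : ℝ) •
            fderiv ℝ (fderiv ℝ (opField ψ (H s))) (x₀ s) (x s - x₀ s) (x s - x₀ s))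
          + T • taylorRemainder ψ H x₀ x s - velocity x₀ s := by
      rw [← smul_add, ← smul_add]
      congr 2
      change opField ψ (H s) (x s) = _
      rw [taylorRemainder]
      abel
    rw [hK.quadraticCoupling_apply hs, h2]
    simp only [frameCoord_toComplex _ i, map_sub, map_add, map_smul, Complex.real_smul] at h1 ⊢
    rw [h1]
    ring

variable [CompleteSpace 𝓗]

/-- The variational evolution follows the instantaneous variational ground state. -/
theorem exists_adiabatic_bound (hψ : IsVariationalFamily U ψ) (hH : IsProtocol H)
    (hx₀ : IsVariationalGroundState U ψ H x₀) (hK : IsAdiabatic (generator ψ H x₀) η w v) :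
    ∃ C T₀ : ℝ, 0 < T₀ ∧ ∀ T ≥ T₀, ∀ x : ℝ → Fin n → ℝ,
      IsVariationalEvolution U ψ H x₀ T x → ∀ s ∈ Set.Icc (0 : ℝ) 1,
        ‖ψ (x s) - ψ (x₀ s)‖ ≤ C / T ∧
        etaNorm (η s) (toComplex (x s - x₀ s)) ≤ C * kappa η w v x₀ / T := by
  have hw := hK.contDiffOn_frequency (contDiffOn_generator hψ hH hx₀)
  have hv := contDiffOn_velocity hx₀
  obtain ⟨C₁, T₁, hC₁, hT₁, hzero, hdev⟩ := exists_deviation_bound hψ hH hx₀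
    fun s hs u hu => hK.injective hs hu
  obtain ⟨r, hr, C₂, hC₂, hlip⟩ := exists_state_lipschitz hψ hx₀
  obtain ⟨C₃, hC₃, hcoord⟩ := hK.exists_frameCoord_bound
  set κ := kappa η w v x₀ with hκ
  have hκ0 : 0 ≤ κ := kappa_nonneg
  -- The division is harmless for `κ = 0`: the ground state is then motionless and `C₁ = 0`. The
  -- term `C₁ / r` in the time keeps the deviation inside the Lipschitz tube.
  refine ⟨C₂ * C₁ + √n * (C₃ * C₁) / κ, T₁ + C₁ / r, by positivity, fun T hT x hx s hs => ?_⟩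
  have hC₁r : 0 ≤ C₁ / r := by positivity
  have hT0 : 0 < T := by linarith
  have hy := hdev T (by linarith) x hx s hs
  have hyr : ‖x s - x₀ s‖ ≤ r := by
    refine hy.trans ?_
    rw [div_le_iff₀ hT0]
    have : C₁ / r ≤ T := by linarith
    rw [div_le_iff₀ hr] at this
    linarith
  constructor
  · have h1 := hlip s hs _ hyr
    rw [add_sub_cancel] at h1
    calc _ ≤ C₂ * (C₁ / T) := h1.trans (by gcongr)
      _ = C₂ * C₁ / T := by ring
      _ ≤ _ := by
        gcongr
        linarith [show 0 ≤ √n * (C₃ * C₁) / κ by positivity]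
  · have h1 : etaNorm (η s) (toComplex (x s - x₀ s)) ≤ √n * (C₃ * C₁) / T := by
      rw [hK.etaNorm_eq hs]
      refine (norm_toLp_le (C := C₃ * (C₁ / T)) fun i =>
        (hcoord s hs _ i).trans (by gcongr)).trans (le_of_eq ?_)
      rw [abs_of_nonneg (by positivity)]
      ring
    refine h1.trans (div_le_div_of_nonneg_right ?_ hT0.le)
    rcases hκ0.eq_or_lt with h0 | hpos
    · rw [hzero fun s hs => hK.velocity_eq_zero hw hv h0.symm hs]
      simp
    · rw [add_mul, div_mul_cancel₀ _ hpos.ne']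
      linarith [show 0 ≤ C₂ * C₁ * κ by positivity]

/-- The linearized deviation is at most `κ / T` to leading order. -/
theorem exists_linearized_bound (hψ : IsVariationalFamily U ψ) (hH : IsProtocol H)
    (hx₀ : IsVariationalGroundState U ψ H x₀) (hK : IsAdiabatic (generator ψ H x₀) η w v) :
    ∃ C T₀ : ℝ, 0 < T₀ ∧ ∀ T ≥ T₀, ∀ ξ : ℝ → Fin n → ℝ,
      IsLinearizedDeviation (generator ψ H x₀) x₀ T ξ → ∀ s ∈ Set.Icc (0 : ℝ) 1,
        etaNorm (η s) (toComplex (ξ s)) ≤ kappa η w v x₀ / T + C / T ^ 2 := by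
  have hw := hK.contDiffOn_frequency (contDiffOn_generator hψ hH hx₀)
  have hv := contDiffOn_velocity hx₀
  have hb := hK.contDiffOn_frameCoord (contDiffOn_toComplex hv)
  obtain ⟨A, hA⟩ := exists_linear_mode_bound hw hb hK.contDiffOn_frameCoupling hK.nonvanishing
  -- Without quadratic terms the second-order homological equation is trivial. The maximum with 0 is
  -- there because the constant must also bound the vanishing error term.
  obtain ⟨C, hC⟩ := exists_normal_form_bound (Q := fun _ _ => 0) (R := fun _ _ => 0) hw hb
    hK.contDiffOn_frameCoupling (fun _ _ _ => contDiffOn_const) (fun _ _ _ => contDiffOn_const)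
    hK.nonvanishing hK.gap (by simp) (max A 0)
  refine ⟨√n * |C|, 1, one_pos, fun T hT ξ hξ s hs => ?_⟩
  have hT0 : 0 < T := by linarith
  have hev := hξ.isModeEvolution hK
  refine hK.etaNorm_le_kappa hw hv hs hT0 fun i => ?_
  obtain ⟨u, hu, hub⟩ := hC T hT _ _ hev
    (fun s hs i => (hA T hT _ hev s hs i).trans (by gcongr; exact le_max_left _ _))
    (fun s hs i => by simpa using by positivity) i s hs
  refine ⟨u, ?_, hub⟩
  rw [hu]
  simp [shiftedCoupling]

/-- In Darboux coordinates the quadratic terms do not change the modulus of the propagators. -/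
theorem re_shiftedCoupling_darboux (hψ : IsVariationalFamily U ψ) (hH : IsProtocol H)
    (hx₀ : IsVariationalGroundState U ψ H x₀) (hK : IsAdiabatic (generator ψ H x₀) η w v)
    (hconst : ∀ x ∈ U, ∀ y ∈ U, symplecticMatrix ψ x = symplecticMatrix ψ y) {s : ℝ}
    (hs : s ∈ Set.Icc (0 : ℝ) 1) (i : Fin n) :
    (shiftedCoupling w (fun s => frameCoord η v s (toComplex (velocity x₀ s)))
        (frameCoupling η v)
        (quadraticCoupling η v fun s => fderiv ℝ (fderiv ℝ (opField ψ (H s))) (x₀ s)) i s i).re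
      = (frameCoupling η v i s i).re := by
  have hxs := hx₀.mem s hs
  refine hK.re_shiftedCoupling (D := fun s => fderiv ℝ (fderiv ℝ (opField ψ (H s))) (x₀ s)) hs
    (Ω := symplecticMatrix ψ (x₀ s)) (symplecticMatrix_transpose ψ _) (hψ.nondegenerate _ hxs)
    (symplecticMatrix_mul_generator_transpose hψ hH hx₀ hs) ?_ ?_ (velocity x₀) i
  · intro y z
    exact fieldHessian_symm hψ (H s) hxs y z
  · intro p y z
    exact symplecticMatrix_fieldHessian_symm hψ (hH.selfAdjoint s hs) hxs hconst p y z

/-- In Darboux coordinates and without second order resonances the deviation of the variational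
evolution is at most `κ / T` to leading order. -/
theorem exists_darboux_bound (hψ : IsVariationalFamily U ψ) (hH : IsProtocol H)
    (hx₀ : IsVariationalGroundState U ψ H x₀) (hK : IsAdiabatic (generator ψ H x₀) η w v)
    (hconst : ∀ x ∈ U, ∀ y ∈ U, symplecticMatrix ψ x = symplecticMatrix ψ y)
    (hres : ∀ s ∈ Set.Icc (0 : ℝ) 1, ∀ i j k, w i s ≠ w j s + w k s) :
    ∃ C T₀ : ℝ, 0 < T₀ ∧ ∀ T ≥ T₀, ∀ x : ℝ → Fin n → ℝ,
      IsVariationalEvolution U ψ H x₀ T x → ∀ s ∈ Set.Icc (0 : ℝ) 1,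
        etaNorm (η s) (toComplex (x s - x₀ s)) ≤ kappa η w v x₀ / T + C / T ^ 2 := by
  have hw := hK.contDiffOn_frequency (contDiffOn_generator hψ hH hx₀)
  have hv := contDiffOn_velocity hx₀
  have hb := hK.contDiffOn_frameCoord (contDiffOn_toComplex hv)
  set D : ℝ → (Fin n → ℝ) →L[ℝ] (Fin n → ℝ) →L[ℝ] (Fin n → ℝ) :=
    fun s => fderiv ℝ (fderiv ℝ (opField ψ (H s))) (x₀ s) with hD
  have hQ := hK.contDiffOn_quadraticCoupling (contDiffOn_fieldHessian hψ hH hx₀)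
  obtain ⟨C₁, T₁, hC₁, hT₁, -, hdev⟩ := exists_deviation_bound hψ hH hx₀
    fun s hs u hu => hK.injective hs hu
  obtain ⟨C₃, hC₃, hcoord⟩ := hK.exists_frameCoord_bound
  obtain ⟨r, hr, htube⟩ := exists_tube hψ.isOpen hx₀.smooth.continuousOn hx₀.mem
  obtain ⟨C₄, hC₄⟩ := exists_tube_taylor_two hψ.isOpen (contDiffOn_opField hψ)
    hH.smooth.continuousOn hx₀.smooth.continuousOn htube
  -- `R` solves the second-order homological equation; the nonresonance hypothesis keeps its
  -- denominator away from zero. The final constant is a sum because it must bound the amplitudes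
  -- and the Taylor error at once.
  obtain ⟨C, hC⟩ := exists_normal_form_bound (Q := quadraticCoupling η v D)
    (R := fun i s => Matrix.of fun j k =>
      Complex.I * quadraticCoupling η v D i s j k / ((w i s - (w j s + w k s) : ℝ) : ℂ))
    hw hb hK.contDiffOn_frameCoupling hQ
    (fun i j k => contDiffOn_div_real (contDiffOn_const.mul (hQ i j k))
      ((hw i).sub ((hw j).add (hw k))) fun s hs => sub_ne_zero.2 (hres s hs i j k))
    hK.nonvanishing hK.gap (fun s hs i j k => by
      have h0 : (w i s : ℂ) - w j s - w k s ≠ 0 := by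
        have := Complex.ofReal_ne_zero.2 (sub_ne_zero.2 (hres s hs i j k))
        rwa [Complex.ofReal_sub, Complex.ofReal_add, ← sub_sub] at this
      simp only [Matrix.of_apply, Complex.ofReal_sub, ← sub_sub]
      field_simp
      linear_combination quadraticCoupling η v D i s j k * Complex.I_sq)
    (C₃ * C₁ + C₃ * (|C₄| * C₁ ^ 3))
  refine ⟨√n * |C|, T₁ + C₁ / r, by positivity, fun T hT x hx s hs => ?_⟩
  have hC₁r : 0 ≤ C₁ / r := by positivity
  have hT1 : 1 ≤ T := by linarith
  have hT0 : 0 < T := by linarith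
  have hy := hdev T (by linarith) x hx
  have hyr : ∀ s ∈ Set.Icc (0 : ℝ) 1, ‖x s - x₀ s‖ ≤ r := by
    intro s hs
    refine (hy s hs).trans ?_
    rw [div_le_iff₀ hT0]
    have : C₁ / r ≤ T := by linarith
    rw [div_le_iff₀ hr] at this
    linarith
  have hrem : ∀ s ∈ Set.Icc (0 : ℝ) 1, ‖taylorRemainder ψ H x₀ x s‖ ≤ |C₄| * (C₁ / T) ^ 3 := by
    intro s hs
    have h1 := hC₄ s hs _ (hyr s hs)
    rw [add_sub_cancel, hx₀.opField_eq_zero hψ hH hs, sub_zero] at h1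
    refine h1.trans (mul_le_mul (le_abs_self _) ?_ (by positivity) (by positivity))
    gcongr
    exact hy s hs
  have hev := hx.isModeEvolution hx₀ hK
  refine hK.etaNorm_le_kappa hw hv hs hT0 fun i => ?_
  have hamp : ∀ s ∈ Set.Icc (0 : ℝ) 1, ∀ i, ‖frameCoord η v s (toComplex (x s - x₀ s)) i‖
      ≤ (C₃ * C₁ + C₃ * (|C₄| * C₁ ^ 3)) / T := by
    intro s hs i
    calc _ ≤ C₃ * (C₁ / T) := (hcoord s hs _ i).trans (by gcongr; exact hy s hs)
      _ = C₃ * C₁ / T := by ring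
      _ ≤ _ := by
        gcongr
        linarith [show 0 ≤ C₃ * (|C₄| * C₁ ^ 3) by positivity]
  have herr : ∀ s ∈ Set.Icc (0 : ℝ) 1, ∀ i,
      ‖frameCoord η v s (toComplex (T • taylorRemainder ψ H x₀ x s)) i‖
        ≤ (C₃ * C₁ + C₃ * (|C₄| * C₁ ^ 3)) / T ^ 2 := by
    intro s hs i
    -- The cubic Taylor remainder is `O(1/T³)` by the a priori bound, and the equation multiplies it
    -- by `T`.
    calc _ ≤ C₃ * (T * (|C₄| * (C₁ / T) ^ 3)) := by
          refine (hcoord s hs _ i).trans ?_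
          rw [norm_smul, Real.norm_of_nonneg hT0.le]
          gcongr
          exact hrem s hs
      _ = C₃ * (|C₄| * C₁ ^ 3) / T ^ 2 := by field_simp
      _ ≤ _ := by
        gcongr
        linarith [show 0 ≤ C₃ * C₁ by positivity]
  obtain ⟨u, hu, hub⟩ := hC T hT1 _ _ hev hamp herr i s hs
  refine ⟨u, ?_, hub⟩
  rw [hu]
  congr 1
  -- Only the real part of the diagonal coupling enters `‖u‖`, and there the quadratic terms
  -- contribute nothing.
  refine intervalIntegral.integral_congr fun t ht => ?_
  rw [Set.uIcc_of_le hs.1] at ht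
  exact re_shiftedCoupling_darboux hψ hH hx₀ hK hconst ⟨ht.1, ht.2.trans hs.2⟩ i

end Main

end VarAdiabatic

theorem mainTheorem1 {𝓗 : Type*} [NormedAddCommGroup 𝓗] [InnerProductSpace ℂ 𝓗] [CompleteSpace 𝓗]
    {n : ℕ} (U : Set (Fin n → ℝ)) (ψ : (Fin n → ℝ) → 𝓗) (H : ℝ → 𝓗 →L[ℂ] 𝓗)
    (x₀ : ℝ → Fin n → ℝ)
    (hψ : VarAdiabatic.IsVariationalFamily U ψ)
    (hH : VarAdiabatic.IsProtocol H)
    (hx₀ : VarAdiabatic.IsVariationalGroundState U ψ H x₀)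
    (η : ℝ → Matrix (Fin n) (Fin n) ℂ) (w : Fin n → ℝ → ℝ) (v : Fin n → ℝ → Fin n → ℂ)
    (hK : VarAdiabatic.IsAdiabatic (VarAdiabatic.generator ψ H x₀) η w v) :
    -- the exact variational evolution stays `O(1/T)`-close to the variational ground state
    (∃ C T₀ : ℝ, 0 < T₀ ∧ ∀ T ≥ T₀, ∀ x : ℝ → Fin n → ℝ,
      VarAdiabatic.IsVariationalEvolution U ψ H x₀ T x → ∀ s ∈ Set.Icc (0 : ℝ) 1,
        ‖ψ (x s) - ψ (x₀ s)‖ ≤ C / T ∧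
        VarAdiabatic.etaNorm (η s) (VarAdiabatic.toComplex (x s - x₀ s))
          ≤ C * VarAdiabatic.kappa η w v x₀ / T) ∧
    -- the linearized deviation is at most `κ / T` to leading order
    (∃ C T₀ : ℝ, 0 < T₀ ∧ ∀ T ≥ T₀, ∀ ξ : ℝ → Fin n → ℝ,
      VarAdiabatic.IsLinearizedDeviation (VarAdiabatic.generator ψ H x₀) x₀ T ξ →
      ∀ s ∈ Set.Icc (0 : ℝ) 1,
        VarAdiabatic.etaNorm (η s) (VarAdiabatic.toComplex (ξ s))
          ≤ VarAdiabatic.kappa η w v x₀ / T + C / T ^ 2) ∧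
    -- so is the exact deviation, in Darboux coordinates and without second-order resonances
    ((∀ x ∈ U, ∀ y ∈ U,
        VarAdiabatic.symplecticMatrix ψ x = VarAdiabatic.symplecticMatrix ψ y) →
      (∀ s ∈ Set.Icc (0 : ℝ) 1, ∀ i j k, w i s ≠ w j s + w k s) →
      ∃ C T₀ : ℝ, 0 < T₀ ∧ ∀ T ≥ T₀, ∀ x : ℝ → Fin n → ℝ,
        VarAdiabatic.IsVariationalEvolution U ψ H x₀ T x → ∀ s ∈ Set.Icc (0 : ℝ) 1,
          VarAdiabatic.etaNorm (η s) (VarAdiabatic.toComplex (x s - x₀ s))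
            ≤ VarAdiabatic.kappa η w v x₀ / T + C / T ^ 2) := by
  exact ⟨VarAdiabatic.exists_adiabatic_bound hψ hH hx₀ hK,
    VarAdiabatic.exists_linearized_bound hψ hH hx₀ hK,
    VarAdiabatic.exists_darboux_bound hψ hH hx₀ hK⟩
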